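/- Notation. Let $\mathbb T=\mathbb R/2\pi\mathbb Z$; $H^{-r}(\mathbb T^d)$ is the dual of the Sobolev space $H^r(\mathbb T^d)$, with norm $\|\cdot\|_{-r}$. For every $n$ let $\xi^{(n)}=(\xi^{(n)}_{ij})_{1\le i,j\le n}$ be the adjacency matrix of an Erdős–Rényi graph with parameter $p_n=\frac12$ on a probability space $(\Omega,\mathbb P)$; it is either directed (all entries i.i.d. Bernoulli($\frac12$)) or symmetric ($\xi^{(n)}_{ij}=\xi^{(n)}_{ji}$ and the entries with $i\le j$ i.i.d. Bernoulli($\frac12$)). Nothing is assumed on the joint law of the graphs for different $n$. Let $\Gamma(\theta,\theta')=-K\sin(\theta-\theta')$ with $K>0$, $\mu_0=\frac12(\delta_0+\delta_{\pi/2})$, and for an initial condition $(\theta_0^{1,n},\dots,\theta_0^{n,n})$ put $$\mu^n_0=\frac1n\sum_{i}\delta_{\theta^{i,n}_0},\qquad \eta^n_0=\sqrt n(\mu_0^n-\mu_0),\qquad \hat\eta^n_0=\frac{\sqrt n}{n^2}\sum_{i,j}\Big(\frac{\xi_{ij}^{(n)}}{p_n}-1\Big)\delta_{\theta^{i,n}_0}\otimes\delta_{\theta^{j,n}_0},$$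 and $\langle\Gamma*h,f\rangle=\langle h,f(\theta_1)\Gamma(\theta_1,\theta_2)\rangle$ for a distribution $h$ on $\mathbb T^2$. Proposition. For any such graph sequence there are random variables $\theta^{i,n}_0$ on $\Omega$ with values in $\{0,\frac\pi2\}$ (depending on the graph) such that the bounded Lipschitz distance $d_{BL}(\mu^n_0,\mu_0)\to0$ almost surely and such that, for all $r_0>3$, with $r_1=r_0+2$ and $r_2=r_0+4$: 1. For some $\alpha\in(0,1)$, $\sup_n\mathbb E\|\eta^n_0\|_{-r_0}^{1+\alpha}<\infty$ and $\sup_n\mathbb E\|\hat\eta^n_0\|_{-r_0}^{1+\alpha}<\infty$; and $(\eta^n_0,\hat\eta^n_0)$ converges in law under $\mathbb P$ (the joint law of graph and initial condition) in $H^{-r_1}(\mathbb T)\times H^{-r_1}(\mathbb T^2)$ to $(\eta_0,\hat\eta_0)$, where $\eta_0=Z_1\delta_0+Z_2\delta_{\pi/2}$ with $(Z_1,Z_2)\sim\mathcal N\left(0,\begin{pmatrix}\frac14&-\frac14\\-\frac14&\frac14\end{pmatrix}\right)$, and $\hat\eta_0$ is the deterministic distribution $$\hat\eta_0=\frac1{6\sqrt\pi}\left(-\delta_{(0,0)}+2\delta_{(\frac\pi2,0)}-\delta_{(\frac\pi2,\frac\pi2)}\right)\quad\text{for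 directed graphs},$$ $$\hat\eta_0=\frac2{3\sqrt{2\pi}}\left(-\delta_{(0,0)}+\delta_{(0,\frac\pi2)}+\delta_{(\frac\pi2,0)}-\delta_{(\frac\pi2,\frac\pi2)}\right)\quad\text{for symmetric graphs}.$$ 2. $\Gamma*\hat\eta^n_0$ converges in law in $H^{-r_1}(\mathbb T)$ to $\Gamma*\hat\eta_0\neq0$, which equals $-\frac{K}{3\sqrt\pi}\delta_{\pi/2}$ for directed graphs and $\frac{2K}{3\sqrt{2\pi}}(\delta_0-\delta_{\pi/2})$ for symmetric graphs. 3. The limit fluctuations are not the universal mean-field ones. Let $T>0$ and let $\mu\in C([0,T],\mathcal P(\mathbb T))$ be a weak solution of $\partial_t\mu_t=\frac12\partial_\theta^2\mu_t-\partial_\theta(\mu_t(\Gamma*\mu_t))$ started from $\mu_0$. Put $\Theta f(\theta_1,\theta_2)=\Gamma(\theta_1,\theta_2)f'(\theta_1)$, $$\mathcal L^{(1)}_\nu f(\theta)=\tfrac12f''(\theta)+\int\Theta f(\theta,\theta')\,\nu(d\theta')+\int\Theta f(\theta',\theta)\,\nu(d\theta'),$$ $$\mathcal L^{(2)}_\nu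 g=\tfrac12\Delta g+\Big(\int\Gamma(\theta_1,\theta')\nu(d\theta'),\int\Gamma(\theta_2,\theta')\nu(d\theta')\Big)\cdot\nabla g.$$ Let $W$ (and $W'$) denote centred Gaussian processes in $C([0,T],H^{-r_2}(\mathbb T))$ with $\mathbf E[W_s(f_1)W_t(f_2)]=\int_0^s\langle\mu_u,f_1'f_2'\rangle du$, $s\le t$. If $(\eta,\hat\eta)$, with paths in $C([0,T],H^{-r_2}(\mathbb T))\times C([0,T],H^{-r_2}(\mathbb T^2))$, solves the limit system $$\eta_t=\eta_0+\int_0^t\mathcal L^{(1),*}_{\mu_s}\eta_s\,ds+\int_0^t\Theta^*\hat\eta_s\,ds+W_t,\qquad \hat\eta_t=\hat\eta_0+\int_0^t\mathcal L^{(2),*}_{\mu_s}\hat\eta_s\,ds,$$ with $(\eta_0,\hat\eta_0)$ distributed as in 1. and independent of $W$, then the law of $\eta$ on $C([0,T],H^{-r_2}(\mathbb T))$ differs from the law of every solution $\eta'$ with paths in $C([0,T],H^{-r_2}(\mathbb T))$ of the universal mean-field equation $\eta'_t=\eta'_0+\int_0^t\mathcal L^{(1),*}_{\mu_s}\eta'_s\,ds+W'_t$,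 $\eta'_0$ independent of $W'$. -/

import Mathlib

open Real Set Filter Topology MeasureTheory ProbabilityTheory
open scoped ENNReal

universe u v w

noncomputable section

namespace KuramotoFluct

instance factTwoPiPos : Fact (0 < 2 * π) := ⟨Real.two_pi_pos⟩

/-! ### Tori and their real Fourier bases -/

/-- The one-dimensional torus `ℝ / 2πℤ`. -/
abbrev Circ : Type := AddCircle (2 * π)

/-- The point `π / 2` of the torus. -/
def quarter : Circ := ((π / 2 : ℝ) : Circ)

/-- The real orthonormal Fourier basis of `L²(dθ / 2π)`: the constant `1`, the functions
`√2 cos (kθ)` for `k > 0` and `√2 sin (|k|θ)` for `k < 0`. -/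
def trig (k : ℤ) (θ : Circ) : ℝ :=
  if k = 0 then 1
  else if 0 < k then √2 * Real.Angle.cos (k • θ)
  else √2 * Real.Angle.sin ((-k) • θ)

/-- The data needed to do Fourier analysis on the torus, used for dimensions one and two only:
real eigenfunctions `basis k` of the Laplacian, orthonormal for the normalised Haar measure, with
eigenvalue `-lap k`; and the class of smooth functions. -/
class FlatTorus (X : Type) [MeasurableSpace X] where
  Freq : Type
  countable_freq : Countable Freq
  lap : Freq → ℝ
  basis : Freq → X → ℝ
  haar : Measure X
  Smooth : (X → ℝ) → Prop

instance torusOne : FlatTorus Circ where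
  Freq := ℤ
  countable_freq := inferInstance
  lap k := (k : ℝ) ^ 2
  basis := trig
  haar := AddCircle.haarAddCircle
  Smooth f := ContDiff ℝ (⊤ : ℕ∞) (fun x : ℝ => f (x : Circ))

instance torusTwo : FlatTorus (Circ × Circ) where
  Freq := ℤ × ℤ
  countable_freq := inferInstance
  lap k := (k.1 : ℝ) ^ 2 + (k.2 : ℝ) ^ 2
  basis k x := trig k.1 x.1 * trig k.2 x.2
  haar := AddCircle.haarAddCircle.prod AddCircle.haarAddCircle
  Smooth f := ContDiff ℝ (⊤ : ℕ∞) (fun x : ℝ × ℝ => f ((x.1 : Circ), (x.2 : Circ)))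

instance (X : Type) [MeasurableSpace X] [FlatTorus X] : Countable (FlatTorus.Freq X) := FlatTorus.countable_freq

/-! ### The Hilbert spaces `H^{-r}` -/

/-- The Sobolev space `H^{-r}(X)`, the dual of `H^r(X)`, of the distributions `h` with
`‖h‖² = ∑ₖ (1 + |k|²)^{-r} ⟨h, eₖ⟩² < ∞`. The element `h` is stored through its coordinates
`(1 + |k|²)^{-r/2} ⟨h, eₖ⟩`, so that the norm is the `ℓ²` norm. -/
def HNeg (X : Type) [MeasurableSpace X] [FlatTorus X] (_r : ℝ) : Type :=
  lp (fun _ : FlatTorus.Freq X => ℝ) 2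

namespace HNeg

variable {X : Type} [MeasurableSpace X] [FlatTorus X] {r : ℝ}

instance : NormedAddCommGroup (HNeg X r) :=
  inferInstanceAs (NormedAddCommGroup (lp (fun _ : FlatTorus.Freq X => ℝ) 2))

instance : InnerProductSpace ℝ (HNeg X r) :=
  inferInstanceAs (InnerProductSpace ℝ (lp (fun _ : FlatTorus.Freq X => ℝ) 2))

instance : CompleteSpace (HNeg X r) :=
  inferInstanceAs (CompleteSpace (lp (fun _ : FlatTorus.Freq X => ℝ) 2))

instance : SecondCountableTopology (HNeg X r) := by
  let b : HilbertBasis (FlatTorus.Freq X) ℝ (lp (fun _ : FlatTorus.Freq X => ℝ) 2) :=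
    ⟨LinearIsometryEquiv.refl ℝ _⟩
  have h1 : TopologicalSpace.IsSeparable
      (Submodule.span ℝ (Set.range b) : Set (lp (fun _ : FlatTorus.Freq X => ℝ) 2)) :=
    (Set.countable_range b).isSeparable.span
  have h2 : TopologicalSpace.SeparableSpace (lp (fun _ : FlatTorus.Freq X => ℝ) 2) := by
    have h3 := h1.closure
    rw [← Submodule.topologicalClosure_coe, b.dense_span, Submodule.top_coe] at h3
    exact TopologicalSpace.isSeparable_univ_iff.mp h3
  have h4 : TopologicalSpace.SeparableSpace (HNeg X r) := h2
  exact UniformSpace.secondCountable_of_separable (HNeg X r)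

instance : MeasurableSpace (HNeg X r) := borel _

instance : BorelSpace (HNeg X r) := ⟨rfl⟩

/-- The number `⟨h, eₖ⟩`. -/
def coeff (h : HNeg X r) (k : FlatTorus.Freq X) : ℝ :=
  (1 + FlatTorus.lap k) ^ (r / 2) *
    (show lp (fun _ : FlatTorus.Freq X => ℝ) 2 from h) k

/-- The duality bracket `⟨h, f⟩ = ∑ₖ ⟨f, eₖ⟩_{L²} ⟨h, eₖ⟩` with a test function `f`. -/
def pair (h : HNeg X r) (f : X → ℝ) : ℝ :=
  ∑' k, (∫ x, f x * FlatTorus.basis k x ∂(FlatTorus.haar : Measure X)) * coeff h k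

open Classical in
/-- The element `h` of `H^{-r}` with `⟨h, eₖ⟩ = c k` for all `k` (`0` if there is none). -/
def ofCoeffs (r : ℝ) (c : FlatTorus.Freq X → ℝ) : HNeg X r :=
  if h : Memℓp (fun k => (1 + FlatTorus.lap k) ^ (-r / 2) * c k) 2 then
    (show lp (fun _ : FlatTorus.Freq X => ℝ) 2 from ⟨_, h⟩)
  else (0 : lp (fun _ : FlatTorus.Freq X => ℝ) 2)

/-- The embedding of finite measures into `H^{-r}`, for `r` larger than half of the dimension. -/
def ofMeasure (r : ℝ) (μ : Measure X) : HNeg X r :=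
  ofCoeffs r (fun k => ∫ x, FlatTorus.basis k x ∂μ)

/-- The Dirac mass at `x` as an element of `H^{-r}`. -/
def dirac (r : ℝ) (x : X) : HNeg X r := ofMeasure r (Measure.dirac x)

end HNeg

/-! ### Graphs -/

/-- `ξ n` is, for every `n`, the adjacency matrix of a directed Erdős–Rényi graph on `n` vertices
with parameter `p n`: its `n²` entries are i.i.d. Bernoulli variables. Nothing is assumed on the
joint law of the graphs for different `n`. -/
structure IsDirectedER {Ω : Type*} [MeasurableSpace Ω] (P : Measure Ω) (p : ℕ → ℝ)
    (ξ : (n : ℕ) → Fin n → Fin n → Ω → ℝ) : Prop where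
  measurable : ∀ n i j, Measurable (ξ n i j)
  values : ∀ n i j ω, ξ n i j ω = 0 ∨ ξ n i j ω = 1
  law : ∀ n i j, P {ω | ξ n i j ω = 1} = ENNReal.ofReal (p n)
  indep : ∀ n, iIndepFun (fun q : Fin n × Fin n => ξ n q.1 q.2) P

/-- The same for symmetric Erdős–Rényi graphs: `ξ n i j = ξ n j i`, and the entries with `i ≤ j`
are i.i.d. Bernoulli variables. -/
structure IsSymmetricER {Ω : Type*} [MeasurableSpace Ω] (P : Measure Ω) (p : ℕ → ℝ)
    (ξ : (n : ℕ) → Fin n → Fin n → Ω → ℝ) : Prop where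
  measurable : ∀ n i j, Measurable (ξ n i j)
  values : ∀ n i j ω, ξ n i j ω = 0 ∨ ξ n i j ω = 1
  symm : ∀ n i j, ξ n i j = ξ n j i
  law : ∀ n i j, P {ω | ξ n i j ω = 1} = ENNReal.ofReal (p n)
  indep : ∀ n, iIndepFun (fun q : {q : Fin n × Fin n // q.1 ≤ q.2} => ξ n q.1.1 q.1.2) P

/-! ### Empirical measures and initial fluctuations -/

/-- The bounded Lipschitz distance. -/
def dBL (μ ν : Measure Circ) : ℝ :=
  sSup {x : ℝ | ∃ f : Circ → ℝ, (∀ θ, |f θ| ≤ 1) ∧ LipschitzWith 1 f ∧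
    x = ∫ θ, f θ ∂μ - ∫ θ, f θ ∂ν}

/-- The empirical measure `(1/n) ∑ᵢ δ_{θᵢ}`. -/
def empMeasure {n : ℕ} (θ : Fin n → Circ) : Measure Circ :=
  (n : ℝ≥0∞)⁻¹ • ∑ i, Measure.dirac (θ i)

/-- The fluctuation `√n (μⁿ - μ₀)` of the empirical measure of `θ` around `μ₀`. -/
def fluct (r : ℝ) (μ₀ : Measure Circ) {n : ℕ} (θ : Fin n → Circ) : HNeg Circ r :=
  √(n : ℝ) • (HNeg.ofMeasure r (empMeasure θ) - HNeg.ofMeasure r μ₀)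

/-- The graph fluctuation `√n (1/n²) ∑ᵢⱼ (ξᵢⱼ/p - 1) δ_{θᵢ} ⊗ δ_{θⱼ}`. -/
def graphFluct (r p : ℝ) {n : ℕ} (ξ : Fin n → Fin n → ℝ) (θ : Fin n → Circ) :
    HNeg (Circ × Circ) r :=
  √(n : ℝ) • ((1 / (n : ℝ) ^ 2) • ∑ i, ∑ j, (ξ i j / p - 1) • HNeg.dirac r (θ i, θ j))

/-- Annealed initial fluctuations, with the limit in law given by the random variable `L` under
the law `Q`: a moment bound of some order `1 + α`, `α ∈ (0, 1)`, in `H^{-r₀}`, and the joint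
convergence in law in `H^{-r₁}(𝕋) × H^{-r₁}(𝕋²)`, `r₁ = r₀ + 2`, both with respect to the joint
law `P` of the graph and the initial condition. -/
structure AnnealedFluctuations {Ω : Type*} [MeasurableSpace Ω] (P : Measure Ω)
    [IsProbabilityMeasure P] (p : ℕ → ℝ) (ξ : (n : ℕ) → Fin n → Fin n → Ω → ℝ)
    (θ : (n : ℕ) → Fin n → Ω → Circ) (μ₀ : Measure Circ) (r₀ : ℝ)
    {Ω' : Type*} [MeasurableSpace Ω'] (Q : Measure Ω') [IsProbabilityMeasure Q]
    (L : Ω' → HNeg Circ (r₀ + 2) × HNeg (Circ × Circ) (r₀ + 2)) : Prop where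
  moments : ∃ α : ℝ, 0 < α ∧ α < 1 ∧
    (⨆ n, ∫⁻ ω, ‖fluct r₀ μ₀ (fun i => θ n i ω)‖ₑ ^ (1 + α) ∂P) < ⊤ ∧
    (⨆ n, ∫⁻ ω, ‖graphFluct r₀ (p n) (fun i j => ξ n i j ω) (fun i => θ n i ω)‖ₑ ^ (1 + α) ∂P) < ⊤
  convergence : TendstoInDistribution
    (fun n ω => (fluct (r₀ + 2) μ₀ (fun i => θ n i ω),
      graphFluct (r₀ + 2) (p n) (fun i j => ξ n i j ω) (fun i => θ n i ω)))
    atTop L (fun _ => P) Q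

/-! ### The limit equations -/

/-- The Kuramoto kernel `-K sin (θ - θ')`. -/
def kuramoto (K : ℝ) (θ θ' : Circ) : ℝ := -K * Real.Angle.sin (θ - θ')

/-- `Γ * h`, the integration with respect to the second variable:
`⟨Γ * h, f⟩ = ⟨h, f(θ₁) Γ(θ₁, θ₂)⟩`. -/
def convSnd (Γ : Circ → Circ → ℝ) {r : ℝ} (h : HNeg (Circ × Circ) r) : HNeg Circ r :=
  HNeg.ofCoeffs r (fun k => HNeg.pair h (fun x => trig k x.1 * Γ x.1 x.2))

/-- The derivative of a function on the torus. -/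
def dC (f : Circ → ℝ) (θ : Circ) : ℝ := deriv (fun h : ℝ => f (θ + (h : Circ))) 0

/-- The partial derivatives of a function on the two-dimensional torus. -/
def dFst (g : Circ × Circ → ℝ) (x : Circ × Circ) : ℝ := dC (fun θ => g (θ, x.2)) x.1

/-- See `dFst`. -/
def dSnd (g : Circ × Circ → ℝ) (x : Circ × Circ) : ℝ := dC (fun θ => g (x.1, θ)) x.2

/-- `Θf(θ₁, θ₂) = Γ(θ₁, θ₂) f'(θ₁)`. -/
def opTheta (Γ : Circ → Circ → ℝ) (f : Circ → ℝ) (x : Circ × Circ) : ℝ :=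
  Γ x.1 x.2 * dC f x.1

/-- `L⁽¹⁾_ν f(θ) = f''(θ)/2 + ⟨ν(dθ'), Θf(θ, θ')⟩ + ⟨ν(dθ'), Θf(θ', θ)⟩`. -/
def opL1 (Γ : Circ → Circ → ℝ) (ν : Measure Circ) (f : Circ → ℝ) (θ : Circ) : ℝ :=
  (1 / 2) * dC (dC f) θ + ∫ θ', opTheta Γ f (θ, θ') ∂ν + ∫ θ', opTheta Γ f (θ', θ) ∂ν

/-- `L⁽²⁾_ν g(θ₁, θ₂) = Δg/2 + (⟨ν(dθ'), Γ(θ₁, θ')⟩, ⟨ν(dθ'), Γ(θ₂, θ')⟩) · ∇g(θ₁, θ₂)`. -/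
def opL2 (Γ : Circ → Circ → ℝ) (ν : Measure Circ) (g : Circ × Circ → ℝ) (x : Circ × Circ) : ℝ :=
  (1 / 2) * (dFst (dFst g) x + dSnd (dSnd g) x)
    + ((∫ θ', Γ x.1 θ' ∂ν) * dFst g x + (∫ θ', Γ x.2 θ' ∂ν) * dSnd g x)

/-- Weak solutions on `[0, T]` of the nonlinear Fokker–Planck equation
`∂ₜ μ = ∂²μ/2 - ∂(μ (Γ * μ))` started from `μ₀`. -/
structure IsFokkerPlanck (Γ : Circ → Circ → ℝ) (T : ℝ) (μ₀ : Measure Circ)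
    (μ : ℝ → ProbabilityMeasure Circ) : Prop where
  continuousOn : ContinuousOn μ (Icc 0 T)
  init : (μ 0 : Measure Circ) = μ₀
  eqn : ∀ t ∈ Icc 0 T, ∀ f : Circ → ℝ, FlatTorus.Smooth f →
    ∫ θ, f θ ∂(μ t : Measure Circ) = ∫ θ, f θ ∂(μ 0 : Measure Circ)
      + ∫ s in (0 : ℝ)..t, ∫ θ, ((1 / 2) * dC (dC f) θ
          + dC f θ * ∫ θ', Γ θ θ' ∂(μ s : Measure Circ)) ∂(μ s : Measure Circ)

/-- The space `C([0, T], H^{-r}(X))`, with its Borel σ-algebra. -/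
abbrev PathSpace (X : Type) [MeasurableSpace X] [FlatTorus X] (r T : ℝ) : Type := C(Icc (0 : ℝ) T, HNeg X r)

instance (X : Type) [MeasurableSpace X] [FlatTorus X] (r T : ℝ) : MeasurableSpace (PathSpace X r T) := borel _

section

variable {X : Type} [MeasurableSpace X] [FlatTorus X] {r T : ℝ}

/-- The value at time `s ∈ [0, T]` (times outside `[0, T]` are projected onto `[0, T]`). -/
def pathAt (hT : 0 < T) (x : PathSpace X r T) (s : ℝ) : HNeg X r := x (projIcc 0 T hT.le s)

end

/-- `W` is a centred Gaussian process with paths in `C([0, T], H^{-r}(𝕋))` and with covariance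
`E[W_s(f₁) W_t(f₂)] = ∫₀ˢ ⟨μ_u, f₁' f₂'⟩ du` for `s ≤ t`. -/
structure IsNoise {Ω : Type*} [MeasurableSpace Ω] (P : Measure Ω) {r T : ℝ} (hT : 0 < T)
    (μ : ℝ → ProbabilityMeasure Circ) (W : Ω → PathSpace Circ r T) : Prop where
  measurable : Measurable W
  gaussian : IsGaussianProcess
    (fun (q : Icc (0 : ℝ) T × {f : Circ → ℝ // FlatTorus.Smooth f}) ω =>
      HNeg.pair (W ω q.1) q.2.1) P
  centred : ∀ t ∈ Icc 0 T, ∀ f : Circ → ℝ, FlatTorus.Smooth f →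
    ∫ ω, HNeg.pair (pathAt hT (W ω) t) f ∂P = 0
  covariance : ∀ s t : ℝ, 0 ≤ s → s ≤ t → t ≤ T → ∀ f₁ f₂ : Circ → ℝ,
    FlatTorus.Smooth f₁ → FlatTorus.Smooth f₂ →
    ∫ ω, HNeg.pair (pathAt hT (W ω) s) f₁ * HNeg.pair (pathAt hT (W ω) t) f₂ ∂P
      = ∫ u in (0 : ℝ)..s, ∫ θ, dC f₁ θ * dC f₂ θ ∂(μ u : Measure Circ)

/-- `(η, η̂)` solves, with the noise `W`, the general limit system
`ηₜ = η₀ + ∫₀ᵗ L⁽¹⁾* ηₛ ds + ∫₀ᵗ Θ* η̂ₛ ds + Wₜ`, `η̂ₜ = η̂₀ + ∫₀ᵗ L⁽²⁾* η̂ₛ ds`,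
where `(η₀, η̂₀)` has law `ν₀` and is independent of `W`. -/
structure IsLimitSystem {Ω : Type*} [MeasurableSpace Ω] (P : Measure Ω) {r T : ℝ} (hT : 0 < T)
    (Γ : Circ → Circ → ℝ) (μ : ℝ → ProbabilityMeasure Circ)
    (ν₀ : Measure (HNeg Circ r × HNeg (Circ × Circ) r))
    (η : Ω → PathSpace Circ r T) (ηhat : Ω → PathSpace (Circ × Circ) r T)
    (W : Ω → PathSpace Circ r T) : Prop where
  measurable_eta : Measurable η
  measurable_etahat : Measurable ηhat
  noise : IsNoise P hT μ W
  init : P.map (fun ω => (pathAt hT (η ω) 0, pathAt hT (ηhat ω) 0)) = ν₀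
  indep : IndepFun (fun ω => (pathAt hT (η ω) 0, pathAt hT (ηhat ω) 0)) W P
  eqn_eta : ∀ᵐ ω ∂P, ∀ t ∈ Icc 0 T, ∀ f : Circ → ℝ, FlatTorus.Smooth f →
    HNeg.pair (pathAt hT (η ω) t) f = HNeg.pair (pathAt hT (η ω) 0) f
      + (∫ s in (0 : ℝ)..t, HNeg.pair (pathAt hT (η ω) s) (opL1 Γ (μ s) f))
      + (∫ s in (0 : ℝ)..t, HNeg.pair (pathAt hT (ηhat ω) s) (opTheta Γ f))
      + HNeg.pair (pathAt hT (W ω) t) f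
  eqn_etahat : ∀ᵐ ω ∂P, ∀ t ∈ Icc 0 T, ∀ g : Circ × Circ → ℝ, FlatTorus.Smooth g →
    HNeg.pair (pathAt hT (ηhat ω) t) g = HNeg.pair (pathAt hT (ηhat ω) 0) g
      + ∫ s in (0 : ℝ)..t, HNeg.pair (pathAt hT (ηhat ω) s) (opL2 Γ (μ s) g)

/-- `η` solves, with the noise `W`, the universal mean-field equation
`ηₜ = η₀ + ∫₀ᵗ L⁽¹⁾* ηₛ ds + Wₜ`, where `η₀` is independent of `W`. -/
structure IsMeanFieldSPDE {Ω : Type*} [MeasurableSpace Ω] (P : Measure Ω) {r T : ℝ} (hT : 0 < T)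
    (Γ : Circ → Circ → ℝ) (μ : ℝ → ProbabilityMeasure Circ)
    (η : Ω → PathSpace Circ r T) (W : Ω → PathSpace Circ r T) : Prop where
  measurable_eta : Measurable η
  noise : IsNoise P hT μ W
  indep : IndepFun (fun ω => pathAt hT (η ω) 0) W P
  eqn_eta : ∀ᵐ ω ∂P, ∀ t ∈ Icc 0 T, ∀ f : Circ → ℝ, FlatTorus.Smooth f →
    HNeg.pair (pathAt hT (η ω) t) f = HNeg.pair (pathAt hT (η ω) 0) f
      + (∫ s in (0 : ℝ)..t, HNeg.pair (pathAt hT (η ω) s) (opL1 Γ (μ s) f))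
      + HNeg.pair (pathAt hT (W ω) t) f

/-! ### The example -/

/-- The measure `(δ_0 + δ_{π/2}) / 2`. -/
def halfHalf : Measure Circ :=
  (2 : ℝ≥0∞)⁻¹ • (Measure.dirac (0 : Circ) + Measure.dirac quarter)

/-- The covariance matrix of `(Z₁, Z₂)`. -/
def covZ : Matrix (Fin 2) (Fin 2) ℝ := !![1 / 4, -1 / 4; -1 / 4, 1 / 4]

/-- The law `N(0, C)` of `(Z₁, Z₂)`. -/
def lawZ : Measure (EuclideanSpace ℝ (Fin 2)) := multivariateGaussian 0 covZ

instance : IsProbabilityMeasure lawZ := by unfold lawZ; infer_instance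

/-- The pair `(Z₁ δ_0 + Z₂ δ_{π/2}, η̂₀)` as a function of `z = (Z₁, Z₂)`. -/
def limitPair (r : ℝ) (ηhat₀ : HNeg (Circ × Circ) r) (z : EuclideanSpace ℝ (Fin 2)) :
    HNeg Circ r × HNeg (Circ × Circ) r :=
  (z 0 • HNeg.dirac r (0 : Circ) + z 1 • HNeg.dirac r quarter, ηhat₀)

/-- The initial condition `θ` on the graphs `ξ` is an example of non-universal fluctuations for the
Kuramoto kernel, with limits `Z₁ δ_0 + Z₂ δ_{π/2}`, `ηhat₀` and `conv₀` of `η₀ⁿ`, `η̂₀ⁿ` and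
`Γ * η̂₀ⁿ`. -/
structure NonUniversalExample {Ω : Type u} [MeasurableSpace Ω] (P : Measure Ω)
    [IsProbabilityMeasure P] (p : ℕ → ℝ) (ξ : (n : ℕ) → Fin n → Fin n → Ω → ℝ) (K : ℝ)
    (θ : (n : ℕ) → Fin n → Ω → Circ)
    (ηhat₀ : (r : ℝ) → HNeg (Circ × Circ) r) (conv₀ : (r : ℝ) → HNeg Circ r) : Prop where
  measurable : ∀ n i, Measurable (θ n i)
  values : ∀ n i ω, θ n i ω = 0 ∨ θ n i ω = quarter
  lawOfLargeNumbers : ∀ᵐ ω ∂P,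
    Tendsto (fun n => dBL (empMeasure (fun i => θ n i ω)) halfHalf) atTop (𝓝 0)
  annealed : ∀ r₀ : ℝ, 3 < r₀ → AnnealedFluctuations P p ξ θ halfHalf r₀ lawZ
    (limitPair (r₀ + 2) (ηhat₀ (r₀ + 2)))
  convergence_conv : ∀ r₀ : ℝ, 3 < r₀ → TendstoInDistribution
    (fun n ω => convSnd (kuramoto K)
      (graphFluct (r₀ + 2) (p n) (fun i j => ξ n i j ω) (fun i => θ n i ω)))
    atTop (fun _ : Ω => conv₀ (r₀ + 2)) (fun _ => P) P
  conv_eq : ∀ r₀ : ℝ, 3 < r₀ → convSnd (kuramoto K) (ηhat₀ (r₀ + 2)) = conv₀ (r₀ + 2)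
  conv_ne : ∀ r₀ : ℝ, 3 < r₀ → conv₀ (r₀ + 2) ≠ 0
  /-- Solutions `η` of the limit system started from the law of `(Z₁ δ_0 + Z₂ δ_{π/2}, ηhat₀)` do
  not have the law of a solution of the mean-field equation. -/
  not_meanField : ∀ r₀ : ℝ, 3 < r₀ → ∀ (T : ℝ) (hT : 0 < T) (μ : ℝ → ProbabilityMeasure Circ),
    IsFokkerPlanck (kuramoto K) T halfHalf μ →
    ∀ (Ω₁ : Type v) [MeasurableSpace Ω₁] (P₁ : Measure Ω₁) [IsProbabilityMeasure P₁]
      (η : Ω₁ → PathSpace Circ (r₀ + 4) T) (ηhat : Ω₁ → PathSpace (Circ × Circ) (r₀ + 4) T)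
      (W : Ω₁ → PathSpace Circ (r₀ + 4) T),
    IsLimitSystem P₁ hT (kuramoto K) μ (lawZ.map (limitPair (r₀ + 4) (ηhat₀ (r₀ + 4)))) η ηhat W →
    ∀ (Ω₂ : Type w) [MeasurableSpace Ω₂] (P₂ : Measure Ω₂) [IsProbabilityMeasure P₂]
      (η' W' : Ω₂ → PathSpace Circ (r₀ + 4) T),
    IsMeanFieldSPDE P₂ hT (kuramoto K) μ η' W' →
    P₁.map η ≠ P₂.map η'

end KuramotoFluct

end

/-!
The initial phases are chosen, as functions of the graph, among `0` and `π / 2`, and are coded by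
signs `σ i = ± 1` of the vertices. They have to be i.i.d. uniform, so that the empirical measure has
the usual Gaussian fluctuations, and nevertheless correlated with the centred edges
`ε i j = 2 ξ i j - 1` strongly enough for the block sums `∑ ε i j 1{σ i = a} 1{σ j = b}` to be of
order `n^{3/2}`, which is the scale of the graph fluctuations.

The construction starts from a uniform matrix `w` of signs. The vertex `i` gets the majority sign of
`w i 0, …, w i (m - 1)` (`rowSign`, `vSign`), where `m = i` for symmetric graphs and `m = i / 2` for
directed ones; a further entry breaks ties. Rows are independent and `w ↦ -w` changes the signs, so
the signs are i.i.d. uniform (`expect_vSign`), and `∑_{j < i} w i j σ i` has expectation `E|S_m|`,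
the mean absolute value of the simple random walk, which is `~ √(2m/π)` by Wallis' formula
(`tendsto_absWalk_div_sqrt`). The graph is then read off from `w` by moving `w i j`, `j < i`, to the
places `(i, j)` and `(j, i)` according to the sign of the earlier vertex `j` (`symGraph`,
`dirGraph`). Going through the rows in order one recovers `w` from the graph, so this map is a
bijection, and a uniform graph is the image of a uniform `w` which is a function of the graph
(`exists_signs`). The signs are functions of the graph on the given probability space, with no
additional randomness.

A block sum is a sum over the pairs `j < i` of `w i j` or `w j i` times functions of `(σ i, σ j)`.
Expanding these in `1, σ i, σ j, σ i σ j`, all terms are `O(n)` in `L²` except `w i j σ i`, which is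
within `O(n)` of its expectation (`quadBounded_lower`, `quadBounded_blockSum`). The delicate term is
`∑ w i j σ i σ j`, where Bessel's inequality for the majority sign bounds the column sums
(`expect_sq_sign_mul_sign_mul_lower_le`). Summing `E|S_m|` over `i` gives the deterministic limit of
`n^{-3/2}` times the block sums, in `L²`, for both kinds of graphs (`IsSignChoice.block`).

The measure fluctuation is `(2√n)⁻¹ ∑ σ i` times `δ_0 - δ_{π/2}`, so its law converges by
characteristic functions, and the graph fluctuation converges in probability to a constant, so the
pair converges in law by Slutsky's theorem. The law of large numbers follows from the fourth moment
of `∑ σ i`.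

For the last part, the test function `f = √2 cos` is used. Subtracting from `⟨η_t, f⟩` its initial
value and the linear drift gives a continuous functional of the path (`noisePart`). Under the
mean-field equation its expectation is that of the noise, which vanishes. Under the limit system it
is `E ∫₀ᵗ ⟨η̂_s, Θf⟩ ds`. The initial value `⟨η̂_0, Θf⟩` is a nonzero constant, and an energy estimate
in `H^{-r}` for `∂_t η̂ = L⁽²⁾* η̂` (`norm_sq_le_add_integral`), in which the Laplacian absorbs the
drift of order one, bounds the variation of `⟨η̂_s, Θf⟩` for small times by the deterministic norm of
`η̂_0`. Hence the expectation is not zero for small `t`, and the two laws differ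
(`IsLimitSystem.map_ne_of_isMeanFieldSPDE`).
-/


noncomputable section

open scoped BigOperators

namespace KuramotoFluct

/-! ### Trigonometric functions on the torus -/

/-- The function `cos (nθ)` on the torus. -/
def cosMul (n : ℤ) (θ : Circ) : ℝ := Real.Angle.cos (n • θ)

/-- The function `sin (nθ)` on the torus. -/
def sinMul (n : ℤ) (θ : Circ) : ℝ := Real.Angle.sin (n • θ)

lemma cosMul_coe (n : ℤ) (x : ℝ) : cosMul n (x : Circ) = Real.cos (n * x) := by
  have : n • (x : Circ) = ((n * x : ℝ) : Circ) := by
    rw [← AddCircle.coe_zsmul, zsmul_eq_mul]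
  rw [cosMul, this]
  exact Real.Angle.cos_coe _

lemma sinMul_coe (n : ℤ) (x : ℝ) : sinMul n (x : Circ) = Real.sin (n * x) := by
  have : n • (x : Circ) = ((n * x : ℝ) : Circ) := by
    rw [← AddCircle.coe_zsmul, zsmul_eq_mul]
  rw [sinMul, this]
  exact Real.Angle.sin_coe _

lemma continuous_cosMul (n : ℤ) : Continuous (cosMul n) :=
  Real.Angle.continuous_cos.comp (continuous_zsmul n)

lemma continuous_sinMul (n : ℤ) : Continuous (sinMul n) :=
  Real.Angle.continuous_sin.comp (continuous_zsmul n)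

/-- Reduction of identities on the torus to identities on the line. -/
lemma circ_forall {p : Circ → Prop} (h : ∀ x : ℝ, p (x : Circ)) (θ : Circ) : p θ := by
  induction θ using QuotientAddGroup.induction_on with
  | H x => exact h x

lemma trig_zero (θ : Circ) : trig 0 θ = 1 := by simp [trig]

lemma trig_of_pos {k : ℤ} (hk : 0 < k) (θ : Circ) : trig k θ = √2 * cosMul k θ := by
  simp [trig, hk, hk.ne', cosMul]

lemma trig_of_neg {k : ℤ} (hk : k < 0) (θ : Circ) : trig k θ = √2 * sinMul (-k) θ := by
  simp [trig, hk.not_gt, hk.ne, sinMul]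

lemma continuous_trig (k : ℤ) : Continuous (trig k) := by
  rcases lt_trichotomy k 0 with hk | rfl | hk
  · rw [show trig k = fun θ => √2 * sinMul (-k) θ from funext (trig_of_neg hk)]
    exact continuous_const.mul (continuous_sinMul _)
  · rw [show trig 0 = fun _ => 1 from funext trig_zero]
    exact continuous_const
  · rw [show trig k = fun θ => √2 * cosMul k θ from funext (trig_of_pos hk)]
    exact continuous_const.mul (continuous_cosMul _)

lemma abs_trig_le (k : ℤ) (θ : Circ) : |trig k θ| ≤ √2 := by
  induction θ using circ_forall with | h x => ?_
  rcases lt_trichotomy k 0 with hk | rfl | hk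
  · rw [trig_of_neg hk, sinMul_coe, abs_mul, abs_of_nonneg (Real.sqrt_nonneg 2)]
    exact mul_le_of_le_one_right (by positivity) (Real.abs_sin_le_one _)
  · simp [trig_zero]
  · rw [trig_of_pos hk, cosMul_coe, abs_mul, abs_of_nonneg (Real.sqrt_nonneg 2)]
    exact mul_le_of_le_one_right (by positivity) (Real.abs_cos_le_one _)

/-! #### Orthonormality -/

lemma integral_eq_zero_of_antiperiodic {f : Circ → ℝ} (a : Circ) (h : ∀ θ, f (θ + a) = -f θ) :
    ∫ θ, f θ ∂(AddCircle.haarAddCircle : Measure Circ) = 0 := by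
  have h1 := integral_add_right_eq_self (μ := (AddCircle.haarAddCircle : Measure Circ)) f a
  simp only [h, integral_neg] at h1
  linarith

/-- The translation by `π / n` changes the sign of `cos (nθ)`. -/
lemma integral_cosMul {n : ℤ} (hn : n ≠ 0) :
    ∫ θ, cosMul n θ ∂(AddCircle.haarAddCircle : Measure Circ) = 0 := by
  have hn' : (n : ℝ) ≠ 0 := by exact_mod_cast hn
  refine integral_eq_zero_of_antiperiodic ((π / n : ℝ) : Circ) (circ_forall fun x => ?_)
  rw [← AddCircle.coe_add, cosMul_coe, cosMul_coe, mul_add, mul_div_cancel₀ _ hn', Real.cos_add_pi]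

lemma integral_sinMul (n : ℤ) :
    ∫ θ, sinMul n θ ∂(AddCircle.haarAddCircle : Measure Circ) = 0 := by
  rcases eq_or_ne n 0 with rfl | hn
  · simp [sinMul, show Real.Angle.sin (0 : Circ) = 0 from Real.Angle.sin_zero]
  have hn' : (n : ℝ) ≠ 0 := by exact_mod_cast hn
  refine integral_eq_zero_of_antiperiodic ((π / n : ℝ) : Circ) (circ_forall fun x => ?_)
  rw [← AddCircle.coe_add, sinMul_coe, sinMul_coe, mul_add, mul_div_cancel₀ _ hn', Real.sin_add_pi]

lemma integrable_of_continuous {f : Circ → ℝ} (hf : Continuous f) (μ : Measure Circ)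
    [IsFiniteMeasure μ] : Integrable f μ :=
  hf.integrable_of_hasCompactSupport (HasCompactSupport.of_compactSpace f)

lemma integral_cosMul_eq (n : ℤ) :
    ∫ θ, cosMul n θ ∂(AddCircle.haarAddCircle : Measure Circ) = if n = 0 then 1 else 0 := by
  split_ifs with hn
  · subst hn; simp [cosMul, show Real.Angle.cos (0 : Circ) = 1 from Real.Angle.cos_zero]
  · exact integral_cosMul hn

lemma integral_cosMul_mul_cosMul (k l : ℤ) :
    ∫ θ, cosMul k θ * cosMul l θ ∂(AddCircle.haarAddCircle : Measure Circ)
      = ((if k - l = 0 then 1 else 0) + (if k + l = 0 then 1 else 0)) / 2 := by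
  have : ∀ θ, cosMul k θ * cosMul l θ = (cosMul (k - l) θ + cosMul (k + l) θ) / 2 := by
    refine circ_forall fun x => ?_
    simp only [cosMul_coe]
    push_cast
    rw [sub_mul, add_mul, Real.cos_sub, Real.cos_add]; ring
  simp_rw [this]
  rw [integral_div, integral_add (integrable_of_continuous (continuous_cosMul _) _)
    (integrable_of_continuous (continuous_cosMul _) _), integral_cosMul_eq, integral_cosMul_eq]

lemma integral_sinMul_mul_sinMul (k l : ℤ) :
    ∫ θ, sinMul k θ * sinMul l θ ∂(AddCircle.haarAddCircle : Measure Circ)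
      = ((if k - l = 0 then 1 else 0) - (if k + l = 0 then 1 else 0)) / 2 := by
  have : ∀ θ, sinMul k θ * sinMul l θ = (cosMul (k - l) θ - cosMul (k + l) θ) / 2 := by
    refine circ_forall fun x => ?_
    simp only [cosMul_coe, sinMul_coe]
    push_cast
    rw [sub_mul, add_mul, Real.cos_sub, Real.cos_add]; ring
  simp_rw [this]
  rw [integral_div, integral_sub (integrable_of_continuous (continuous_cosMul _) _)
    (integrable_of_continuous (continuous_cosMul _) _), integral_cosMul_eq, integral_cosMul_eq]

lemma integral_sinMul_mul_cosMul (k l : ℤ) :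
    ∫ θ, sinMul k θ * cosMul l θ ∂(AddCircle.haarAddCircle : Measure Circ) = 0 := by
  have : ∀ θ, sinMul k θ * cosMul l θ = (sinMul (k - l) θ + sinMul (k + l) θ) / 2 := by
    refine circ_forall fun x => ?_
    simp only [cosMul_coe, sinMul_coe]
    push_cast
    rw [sub_mul, add_mul, Real.sin_sub, Real.sin_add]; ring
  simp_rw [this]
  rw [integral_div, integral_add (integrable_of_continuous (continuous_sinMul _) _)
    (integrable_of_continuous (continuous_sinMul _) _), integral_sinMul, integral_sinMul]
  simp

lemma trig_orthonormal (k l : ℤ) :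
    ∫ θ, trig k θ * trig l θ ∂(AddCircle.haarAddCircle : Measure Circ)
      = if k = l then 1 else 0 := by
  have h2 : √2 * √2 = 2 := Real.mul_self_sqrt (by norm_num)
  have e : ∀ a b : ℝ, √2 * a * (√2 * b) = 2 * (a * b) := fun a b => by
    rw [mul_mul_mul_comm, h2]
  rcases lt_trichotomy k 0 with hk | rfl | hk <;> rcases lt_trichotomy l 0 with hl | rfl | hl
  · simp_rw [trig_of_neg hk, trig_of_neg hl, e]
    rw [integral_const_mul, integral_sinMul_mul_sinMul]
    rw [if_neg (show ¬(-k + -l = 0) by omega)]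
    by_cases h : k = l
    · rw [if_pos h, if_pos (by omega)]; norm_num
    · rw [if_neg h, if_neg (by omega)]; norm_num
  · simp_rw [trig_of_neg hk, trig_zero, mul_one]
    rw [integral_const_mul, integral_sinMul, if_neg hk.ne, mul_zero]
  · simp_rw [trig_of_neg hk, trig_of_pos hl, e]
    rw [integral_const_mul, integral_sinMul_mul_cosMul, if_neg (by omega), mul_zero]
  · simp_rw [trig_of_neg hl, trig_zero, one_mul]
    rw [integral_const_mul, integral_sinMul, if_neg hl.ne', mul_zero]
  · simp [trig_zero]
  · simp_rw [trig_of_pos hl, trig_zero, one_mul]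
    rw [integral_const_mul, integral_cosMul hl.ne', if_neg hl.ne, mul_zero]
  · simp_rw [trig_of_pos hk, trig_of_neg hl, e, mul_comm (cosMul k _)]
    rw [integral_const_mul, integral_sinMul_mul_cosMul, if_neg (by omega), mul_zero]
  · simp_rw [trig_of_pos hk, trig_zero, mul_one]
    rw [integral_const_mul, integral_cosMul hk.ne', if_neg hk.ne', mul_zero]
  · simp_rw [trig_of_pos hk, trig_of_pos hl, e]
    rw [integral_const_mul, integral_cosMul_mul_cosMul]
    rw [if_neg (show ¬(k + l = 0) by omega)]
    by_cases h : k = l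
    · rw [if_pos h, if_pos (by omega)]; norm_num
    · rw [if_neg h, if_neg (by omega)]; norm_num

/-! #### Products and derivatives -/

/-- Multiplication by `cos θ` shifts the frequency by one. -/
lemma exists_cosMul_one_mul_trig (k : ℤ) : ∃ α β : ℝ, |α| ≤ 1 ∧ |β| ≤ 1 ∧
    ∀ θ, cosMul 1 θ * trig k θ = α * trig (k + 1) θ + β * trig (k - 1) θ := by
  have h2 : √2 * √2 = 2 := Real.mul_self_sqrt (by norm_num)
  have h4 : |√2 / 2| ≤ 1 := by
    rw [abs_of_nonneg (by positivity)]; nlinarith [Real.sqrt_nonneg 2]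
  have c (x : ℝ) (m : ℤ) : Real.cos (1 * x) * Real.cos (m * x)
      = (Real.cos ((m + 1 : ℤ) * x) + Real.cos ((m - 1 : ℤ) * x)) / 2 := by
    push_cast
    rw [add_mul, sub_mul, Real.cos_add, Real.cos_sub]; ring
  have s (x : ℝ) (m : ℤ) : Real.cos (1 * x) * Real.sin (m * x)
      = (Real.sin ((m + 1 : ℤ) * x) + Real.sin ((m - 1 : ℤ) * x)) / 2 := by
    push_cast
    rw [add_mul, sub_mul, Real.sin_add, Real.sin_sub]; ring
  rcases lt_trichotomy k 0 with hk | rfl | hk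
  · rcases (show k = -1 ∨ k < -1 by omega) with rfl | hk1
    · refine ⟨0, 1 / 2, by simp, by norm_num [abs_le], circ_forall fun x => ?_⟩
      rw [trig_of_neg (show (-1 : ℤ) < 0 by norm_num),
        trig_of_neg (show (-1 - 1 : ℤ) < 0 by norm_num), cosMul_coe, sinMul_coe, sinMul_coe]
      have := s x 1
      norm_num at this ⊢
      rw [mul_left_comm, this]; ring
    · refine ⟨1 / 2, 1 / 2, by norm_num [abs_le], by norm_num [abs_le], circ_forall fun x => ?_⟩
      rw [trig_of_neg hk, trig_of_neg (by omega), trig_of_neg (by omega), cosMul_coe, sinMul_coe,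
        sinMul_coe, sinMul_coe, mul_left_comm, Int.cast_one, s,
        show -(k + 1) = -k - 1 by ring, show -(k - 1) = -k + 1 by ring]
      ring
  · refine ⟨√2 / 2, 0, h4, by simp, circ_forall fun x => ?_⟩
    rw [trig_zero, zero_add, trig_of_pos one_pos, ← mul_assoc, div_mul_eq_mul_div, h2]; ring
  · rcases (show k = 1 ∨ 1 < k by omega) with rfl | hk1
    · refine ⟨1 / 2, √2 / 2, by norm_num [abs_le], h4, circ_forall fun x => ?_⟩
      rw [trig_of_pos (show (0 : ℤ) < 1 by norm_num),
        trig_of_pos (show (0 : ℤ) < 1 + 1 by norm_num), cosMul_coe, cosMul_coe,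
        sub_self, trig_zero]
      have := c x 1
      norm_num at this ⊢
      rw [mul_left_comm, this]; ring
    · refine ⟨1 / 2, 1 / 2, by norm_num [abs_le], by norm_num [abs_le], circ_forall fun x => ?_⟩
      rw [trig_of_pos hk, trig_of_pos (by omega), trig_of_pos (by omega), cosMul_coe, cosMul_coe,
        cosMul_coe, cosMul_coe, mul_left_comm, Int.cast_one, c]
      ring

/-- Multiplication by `sin θ` shifts the frequency by one and exchanges cosines and sines. -/
lemma exists_sinMul_one_mul_trig (k : ℤ) : ∃ α β : ℝ, |α| ≤ 1 ∧ |β| ≤ 1 ∧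
    ∀ θ, sinMul 1 θ * trig k θ = α * trig (-k + 1) θ + β * trig (-k - 1) θ := by
  have h2 : √2 * √2 = 2 := Real.mul_self_sqrt (by norm_num)
  have h4 : |√2 / 2| ≤ 1 := by
    rw [abs_of_nonneg (by positivity)]; nlinarith [Real.sqrt_nonneg 2]
  have c (x : ℝ) (m : ℤ) : Real.sin (1 * x) * Real.cos (m * x)
      = (Real.sin ((m + 1 : ℤ) * x) - Real.sin ((m - 1 : ℤ) * x)) / 2 := by
    push_cast
    rw [add_mul, sub_mul, Real.sin_add, Real.sin_sub]; ring
  have s (x : ℝ) (m : ℤ) : Real.sin (1 * x) * Real.sin (m * x)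
      = (Real.cos ((m - 1 : ℤ) * x) - Real.cos ((m + 1 : ℤ) * x)) / 2 := by
    push_cast
    rw [add_mul, sub_mul, Real.cos_add, Real.cos_sub]; ring
  rcases lt_trichotomy k 0 with hk | rfl | hk
  · rcases (show k = -1 ∨ k < -1 by omega) with rfl | hk1
    · refine ⟨-(1 / 2), √2 / 2, by norm_num [abs_le], h4, circ_forall fun x => ?_⟩
      rw [trig_of_neg (show (-1 : ℤ) < 0 by norm_num),
        trig_of_pos (show (0 : ℤ) < - -1 + 1 by norm_num), sinMul_coe, sinMul_coe, cosMul_coe,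
        show (- -1 - 1 : ℤ) = 0 by norm_num, trig_zero]
      have := s x 1
      norm_num at this ⊢
      rw [mul_left_comm, this]; ring
    · refine ⟨-(1 / 2), 1 / 2, by norm_num [abs_le], by norm_num [abs_le],
        circ_forall fun x => ?_⟩
      rw [trig_of_neg hk, trig_of_pos (by omega), trig_of_pos (by omega), sinMul_coe, sinMul_coe,
        cosMul_coe, cosMul_coe, mul_left_comm, Int.cast_one, s]
      ring
  · refine ⟨0, √2 / 2, by simp, h4, circ_forall fun x => ?_⟩
    rw [trig_zero, neg_zero, zero_sub, trig_of_neg (show (-1 : ℤ) < 0 by norm_num), neg_neg, ← mul_assoc,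
      div_mul_eq_mul_div, h2]; ring
  · rcases (show k = 1 ∨ 1 < k by omega) with rfl | hk1
    · refine ⟨0, 1 / 2, by simp, by norm_num [abs_le], circ_forall fun x => ?_⟩
      rw [trig_of_pos (show (0 : ℤ) < 1 by norm_num),
        trig_of_neg (show (-1 - 1 : ℤ) < 0 by norm_num), sinMul_coe, sinMul_coe, cosMul_coe]
      have := c x 1
      norm_num at this ⊢
      rw [mul_left_comm, this]; ring
    · refine ⟨-(1 / 2), 1 / 2, by norm_num [abs_le], by norm_num [abs_le],
        circ_forall fun x => ?_⟩
      rw [trig_of_pos hk, trig_of_neg (by omega), trig_of_neg (by omega), sinMul_coe, sinMul_coe,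
        sinMul_coe, cosMul_coe, mul_left_comm, Int.cast_one, c,
        show -(-k + 1) = k - 1 by ring, show -(-k - 1) = k + 1 by ring]
      ring

lemma dC_coe (f : Circ → ℝ) (x : ℝ) :
    dC f (x : Circ) = deriv (fun y : ℝ => f (y : Circ)) x := by
  have h := deriv_comp_const_add (fun y : ℝ => f (y : Circ)) x 0
  rw [add_zero] at h
  exact h

lemma hasDerivAt_trig (k : ℤ) (x : ℝ) :
    HasDerivAt (fun y : ℝ => trig k (y : Circ)) (-k * trig (-k) (x : Circ)) x := by
  have hl (m : ℝ) : HasDerivAt (fun y : ℝ => m * y) m x := by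
    simpa using (hasDerivAt_id x).const_mul m
  rcases lt_trichotomy k 0 with hk | rfl | hk
  · simp_rw [trig_of_neg hk, sinMul_coe]
    rw [trig_of_pos (by omega), cosMul_coe]
    refine ((hl ((-k : ℤ) : ℝ)).sin.const_mul √2).congr_deriv ?_
    push_cast; ring
  · simp_rw [trig_zero]
    simpa using hasDerivAt_const x (1 : ℝ)
  · simp_rw [trig_of_pos hk, cosMul_coe]
    rw [trig_of_neg (by omega), sinMul_coe]
    refine ((hl (k : ℝ)).cos.const_mul √2).congr_deriv ?_
    rw [neg_neg]; ring

lemma dC_trig (k : ℤ) (θ : Circ) : dC (trig k) θ = -k * trig (-k) θ := by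
  induction θ using circ_forall with | h x => ?_
  rw [dC_coe, (hasDerivAt_trig k x).deriv]

lemma contDiff_trig (k : ℤ) : ContDiff ℝ (⊤ : ℕ∞) (fun x : ℝ => trig k (x : Circ)) := by
  rcases lt_trichotomy k 0 with hk | rfl | hk
  · simp_rw [trig_of_neg hk, sinMul_coe]; fun_prop
  · simp_rw [trig_zero]; fun_prop
  · simp_rw [trig_of_pos hk, cosMul_coe]; fun_prop

/-! ### Fourier coefficients in `H^{-r}` -/

/-- The Fourier basis of `X` is orthonormal and uniformly bounded, and `H^{-r}` contains the Dirac
masses for `r > 1`, by the summability of the weights; this holds in dimensions one and two. -/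
class OrthonormalTorus (X : Type) [MeasurableSpace X] [FlatTorus X] : Prop where
  lap_nonneg : ∀ k : FlatTorus.Freq X, 0 ≤ FlatTorus.lap k
  integrable : ∀ k l : FlatTorus.Freq X, Integrable
    (fun x => FlatTorus.basis k x * FlatTorus.basis l x) (FlatTorus.haar : Measure X)
  orthonormal : ∀ k l : FlatTorus.Freq X, k ≠ l →
    ∫ x, FlatTorus.basis k x * FlatTorus.basis l x ∂(FlatTorus.haar : Measure X) = 0
  normalized : ∀ k : FlatTorus.Freq X,
    ∫ x, FlatTorus.basis k x * FlatTorus.basis k x ∂(FlatTorus.haar : Measure X) = 1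
  bounded : ∀ (k : FlatTorus.Freq X) (x : X), |FlatTorus.basis k x| ≤ 2
  summable : ∀ r : ℝ, 1 < r → Summable fun k : FlatTorus.Freq X => (1 + FlatTorus.lap k) ^ (-r)

lemma summable_one_add_sq_rpow {s : ℝ} (hs : 1 / 2 < s) :
    Summable fun k : ℤ => (1 + (k : ℝ) ^ 2) ^ (-s) := by
  refine Summable.of_norm_bounded_eventually
    (Real.summable_abs_int_rpow (show 1 < 2 * s by linarith)) ?_
  refine (Set.finite_singleton (0 : ℤ)).subset fun k hk => ?_
  by_contra hk0
  refine hk ?_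
  change ‖(1 + (k : ℝ) ^ 2) ^ (-s)‖ ≤ |(k : ℝ)| ^ (-(2 * s))
  have h0 : 0 < |(k : ℝ)| := abs_pos.mpr (by exact_mod_cast hk0)
  rw [Real.norm_of_nonneg (by positivity), show -(2 * s) = (2 : ℕ) * -s by push_cast; ring,
    Real.rpow_mul h0.le, Real.rpow_natCast, sq_abs]
  exact Real.rpow_le_rpow_of_nonpos (by rw [← sq_abs]; positivity) (by linarith) (by linarith)

lemma integrable_trig_mul_trig (k l : ℤ) :
    Integrable (fun θ => trig k θ * trig l θ) (AddCircle.haarAddCircle : Measure Circ) :=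
  integrable_of_continuous ((continuous_trig k).mul (continuous_trig l)) _

instance : OrthonormalTorus Circ where
  lap_nonneg _ := sq_nonneg _
  integrable := integrable_trig_mul_trig
  orthonormal k l h := (trig_orthonormal k l).trans (if_neg h)
  normalized k := (trig_orthonormal k k).trans (if_pos rfl)
  bounded k x := (abs_trig_le k x).trans (Real.sqrt_le_iff.mpr (by norm_num))
  summable _ hr := summable_one_add_sq_rpow (by linarith)

lemma integral_tensor_mul_tensor (k l : ℤ × ℤ) :
    ∫ x : Circ × Circ, trig k.1 x.1 * trig k.2 x.2 * (trig l.1 x.1 * trig l.2 x.2)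
      ∂(AddCircle.haarAddCircle.prod AddCircle.haarAddCircle)
      = (if k.1 = l.1 then 1 else 0) * (if k.2 = l.2 then 1 else 0) := by
  rw [← trig_orthonormal, ← trig_orthonormal, ← integral_prod_mul]
  congr 1
  funext x
  ring

instance : OrthonormalTorus (Circ × Circ) where
  lap_nonneg k := by change 0 ≤ (k.1 : ℝ) ^ 2 + (k.2 : ℝ) ^ 2; positivity
  integrable k l := by
    have := (integrable_trig_mul_trig k.1 l.1).mul_prod (integrable_trig_mul_trig k.2 l.2)
    refine this.congr (Filter.Eventually.of_forall fun x => ?_)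
    change _ = trig k.1 x.1 * trig k.2 x.2 * (trig l.1 x.1 * trig l.2 x.2)
    ring
  orthonormal k l h := by
    refine (integral_tensor_mul_tensor k l).trans ?_
    by_cases h1 : k.1 = l.1
    · rw [if_neg fun h2 => h (Prod.ext h1 h2), mul_zero]
    · rw [if_neg h1, zero_mul]
  normalized k := by
    refine (integral_tensor_mul_tensor k k).trans ?_
    simp
  bounded k x := by
    change |trig k.1 x.1 * trig k.2 x.2| ≤ 2
    rw [abs_mul]
    exact (mul_le_mul (abs_trig_le _ _) (abs_trig_le _ _) (abs_nonneg _)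
      (Real.sqrt_nonneg 2)).trans (Real.mul_self_sqrt zero_le_two).le
  summable r hr := by
    have h1 : Summable fun k : ℤ => (1 + (k : ℝ) ^ 2) ^ (-(r / 2)) :=
      summable_one_add_sq_rpow (by linarith)
    refine Summable.of_nonneg_of_le (fun k => ?_) (fun k => ?_)
      (h1.mul_of_nonneg h1 (fun k => by positivity) fun k => by positivity)
    · change 0 ≤ (1 + ((k.1 : ℝ) ^ 2 + (k.2 : ℝ) ^ 2)) ^ (-r)
      positivity
    · change (1 + ((k.1 : ℝ) ^ 2 + (k.2 : ℝ) ^ 2)) ^ (-r) ≤ _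
      have ha : 0 < 1 + ((k.1 : ℝ) ^ 2 + (k.2 : ℝ) ^ 2) := by positivity
      rw [show -r = -(r / 2) + -(r / 2) by ring, Real.rpow_add ha]
      refine mul_le_mul ?_ ?_ (by positivity) (by positivity) <;>
        refine Real.rpow_le_rpow_of_nonpos (by positivity) ?_ (by linarith) <;>
        nlinarith [sq_nonneg (k.1 : ℝ), sq_nonneg (k.2 : ℝ)]

namespace HNeg

variable {X : Type} [MeasurableSpace X] [FlatTorus X] {r : ℝ}

lemma coeff_add (h g : HNeg X r) (k : FlatTorus.Freq X) :
    coeff (h + g) k = coeff h k + coeff g k :=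
  mul_add _ _ _

lemma coeff_smul (c : ℝ) (h : HNeg X r) (k : FlatTorus.Freq X) :
    coeff (c • h) k = c * coeff h k :=
  mul_left_comm _ _ _

/-- The Fourier coefficient as a continuous linear functional on `H^{-r}`. -/
def coeffL (r : ℝ) (k : FlatTorus.Freq X) : HNeg X r →L[ℝ] ℝ :=
  LinearMap.mkContinuous
    { toFun := fun h => coeff h k
      map_add' := fun h g => coeff_add h g k
      map_smul' := fun c h => coeff_smul c h k }
    |(1 + FlatTorus.lap k) ^ (r / 2)|
    (fun h => by
      change ‖(1 + FlatTorus.lap k) ^ (r / 2) * (show lp (fun _ : FlatTorus.Freq X => ℝ) 2 from h) k‖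
        ≤ _
      rw [norm_mul, Real.norm_eq_abs]
      exact mul_le_mul_of_nonneg_left (lp.norm_apply_le_norm two_ne_zero
        (show lp (fun _ : FlatTorus.Freq X => ℝ) 2 from h) k) (abs_nonneg _))

lemma coeff_sub (h g : HNeg X r) (k : FlatTorus.Freq X) :
    coeff (h - g) k = coeff h k - coeff g k := map_sub (coeffL r k) h g

lemma coeff_zero (k : FlatTorus.Freq X) : coeff (0 : HNeg X r) k = 0 := map_zero (coeffL r k)

lemma coeff_sum {ι : Type*} (s : Finset ι) (h : ι → HNeg X r) (k : FlatTorus.Freq X) :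
    coeff (∑ i ∈ s, h i) k = ∑ i ∈ s, coeff (h i) k := map_sum (coeffL r k) h s

/-- The trigonometric polynomials: the linear span of the Fourier basis. -/
def trigPoly (X : Type) [MeasurableSpace X] [FlatTorus X] : Submodule ℝ (X → ℝ) :=
  Submodule.span ℝ (Set.range (FlatTorus.basis : FlatTorus.Freq X → X → ℝ))

lemma trigPoly_congr {f g : X → ℝ} (hg : g ∈ trigPoly X) (h : ∀ x, f x = g x) :
    f ∈ trigPoly X := by
  rwa [show f = g from funext h]

lemma basis_mem (k : FlatTorus.Freq X) : FlatTorus.basis k ∈ trigPoly X :=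
  Submodule.subset_span ⟨k, rfl⟩

lemma exists_linearCombination {f : X → ℝ} (hf : f ∈ trigPoly X) :
    ∃ a : FlatTorus.Freq X →₀ ℝ, Finsupp.linearCombination ℝ FlatTorus.basis a = f :=
  Finsupp.mem_span_range_iff_exists_finsupp.mp hf

variable [OrthonormalTorus X]

lemma one_add_lap_pos (k : FlatTorus.Freq X) : 0 < 1 + FlatTorus.lap k := by
  linarith [OrthonormalTorus.lap_nonneg k]

lemma ext_coeff {h g : HNeg X r} (H : ∀ k, coeff h k = coeff g k) : h = g := by
  refine lp.ext (E := fun _ : FlatTorus.Freq X => ℝ) (funext fun k => ?_)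
  exact mul_left_cancel₀ (Real.rpow_pos_of_pos (one_add_lap_pos k) (r / 2)).ne' (H k)

lemma coeff_ofCoeffs {c : FlatTorus.Freq X → ℝ}
    (hc : Memℓp (fun k => (1 + FlatTorus.lap k) ^ (-r / 2) * c k) 2) (k : FlatTorus.Freq X) :
    coeff (ofCoeffs r c) k = c k := by
  have e : ofCoeffs r c = (show HNeg X r from
    (⟨fun k => (1 + FlatTorus.lap k) ^ (-r / 2) * c k, hc⟩ :
      lp (fun _ : FlatTorus.Freq X => ℝ) 2)) := dif_pos hc
  rw [e]
  change (1 + FlatTorus.lap k) ^ (r / 2) * ((1 + FlatTorus.lap k) ^ (-r / 2) * c k) = c k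
  rw [← mul_assoc, ← Real.rpow_add (one_add_lap_pos k), neg_div, add_neg_cancel, Real.rpow_zero,
    one_mul]

/-- The norm of `H^{-r}` in terms of the Fourier coefficients. -/
lemma hasSum_norm_sq (h : HNeg X r) :
    HasSum (fun k => (1 + FlatTorus.lap k) ^ (-r) * coeff h k ^ 2) (‖h‖ ^ 2) := by
  have h1 := lp.hasSum_norm (E := fun _ : FlatTorus.Freq X => ℝ) (p := 2) (by norm_num)
    (show lp (fun _ : FlatTorus.Freq X => ℝ) 2 from h)
  have e : (2 : ℝ≥0∞).toReal = ((2 : ℕ) : ℝ) := by norm_num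
  simp only [e, Real.rpow_natCast] at h1
  refine (h1.congr_fun ?_ : HasSum _ _)
  intro k
  change _ = ‖(show lp (fun _ : FlatTorus.Freq X => ℝ) 2 from h) k‖ ^ 2
  rw [coeff, mul_pow, ← Real.rpow_natCast ((1 + FlatTorus.lap k) ^ (r / 2)) 2,
    ← Real.rpow_mul (one_add_lap_pos k).le, ← mul_assoc, ← Real.rpow_add (one_add_lap_pos k)]
  simp

/-! #### The bracket with trigonometric polynomials -/

lemma integral_linearCombination_mul (a : FlatTorus.Freq X →₀ ℝ) (k : FlatTorus.Freq X) :
    ∫ x, Finsupp.linearCombination ℝ (FlatTorus.basis : FlatTorus.Freq X → X → ℝ) a x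
      * FlatTorus.basis k x ∂(FlatTorus.haar : Measure X) = a k := by
  classical
  have h1 : ∀ x, Finsupp.linearCombination ℝ (FlatTorus.basis : FlatTorus.Freq X → X → ℝ) a x
      * FlatTorus.basis k x
      = ∑ l ∈ a.support, a l * (FlatTorus.basis l x * FlatTorus.basis k x) := by
    intro x
    rw [Finsupp.linearCombination_apply, Finsupp.sum, Finset.sum_apply, Finset.sum_mul]
    exact Finset.sum_congr rfl fun l _ => by rw [Pi.smul_apply, smul_eq_mul, mul_assoc]
  simp_rw [h1]
  rw [integral_finsetSum _ fun l _ => (OrthonormalTorus.integrable l k).const_mul _]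
  simp_rw [integral_const_mul]
  rw [Finset.sum_eq_single k]
  · rw [OrthonormalTorus.normalized, mul_one]
  · intro l _ hl
    rw [OrthonormalTorus.orthonormal l k hl, mul_zero]
  · intro hk
    rw [Finsupp.notMem_support_iff.mp hk, zero_mul]

lemma pair_linearCombination (h : HNeg X r) (a : FlatTorus.Freq X →₀ ℝ) :
    pair h (Finsupp.linearCombination ℝ (FlatTorus.basis : FlatTorus.Freq X → X → ℝ) a)
      = Finsupp.linearCombination ℝ (coeff h) a := by
  rw [pair]
  simp_rw [integral_linearCombination_mul]
  rw [Finsupp.linearCombination_apply, Finsupp.sum]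
  simp_rw [smul_eq_mul]
  refine tsum_eq_sum fun k hk => ?_
  rw [Finsupp.notMem_support_iff.mp hk, zero_mul]

lemma pair_basis (h : HNeg X r) (k : FlatTorus.Freq X) :
    pair h (FlatTorus.basis k) = coeff h k := by
  have := pair_linearCombination h (Finsupp.single k 1)
  rwa [Finsupp.linearCombination_single, Finsupp.linearCombination_single, one_smul,
    one_smul] at this

lemma pair_add_right (h : HNeg X r) {f g : X → ℝ} (hf : f ∈ trigPoly X) (hg : g ∈ trigPoly X) :
    pair h (f + g) = pair h f + pair h g := by
  obtain ⟨a, rfl⟩ := exists_linearCombination hf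
  obtain ⟨b, rfl⟩ := exists_linearCombination hg
  rw [← map_add, pair_linearCombination, pair_linearCombination, pair_linearCombination, map_add]

lemma pair_smul_right (h : HNeg X r) (c : ℝ) {f : X → ℝ} (hf : f ∈ trigPoly X) :
    pair h (c • f) = c * pair h f := by
  obtain ⟨a, rfl⟩ := exists_linearCombination hf
  rw [← map_smul, pair_linearCombination, pair_linearCombination, map_smul, smul_eq_mul]

/-- The bracket with a trigonometric polynomial is a continuous linear functional. -/
lemma exists_pair_eq (r : ℝ) {f : X → ℝ} (hf : f ∈ trigPoly X) :
    ∃ ℓ : HNeg X r →L[ℝ] ℝ, ∀ h, pair h f = ℓ h := by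
  obtain ⟨a, rfl⟩ := exists_linearCombination hf
  refine ⟨Finsupp.linearCombination ℝ (coeffL r) a, fun h => ?_⟩
  rw [pair_linearCombination, Finsupp.linearCombination_apply, Finsupp.linearCombination_apply,
    Finsupp.sum, Finsupp.sum, sum_apply]
  rfl

end HNeg

/-! ### Dirac masses and the convolution with the Kuramoto kernel -/

namespace HNeg

variable {X : Type} [MeasurableSpace X] [FlatTorus X] [OrthonormalTorus X] {r : ℝ}

lemma ofCoeffs_coeff (h : HNeg X r) : ofCoeffs r (coeff h) = h := by
  refine ext_coeff fun k => coeff_ofCoeffs ?_ k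
  have h1 := lp.memℓp (show lp (fun _ : FlatTorus.Freq X => ℝ) 2 from h)
  refine (congrArg (fun f : FlatTorus.Freq X → ℝ => Memℓp f 2) (funext fun k => ?_)).mpr h1
  rw [coeff, ← mul_assoc, ← Real.rpow_add (one_add_lap_pos k)]
  simp [neg_div]

lemma coeff_dirac [MeasurableSingletonClass X] (hr : 1 < r) (x : X) (k : FlatTorus.Freq X) :
    coeff (dirac r x) k = FlatTorus.basis k x := by
  have hd : (fun k : FlatTorus.Freq X => ∫ y, FlatTorus.basis k y ∂(Measure.dirac x))
      = fun k => FlatTorus.basis k x := funext fun k => integral_dirac _ _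
  rw [dirac, ofMeasure, hd]
  refine coeff_ofCoeffs ?_ k
  refine memℓp_gen ?_
  refine Summable.of_nonneg_of_le (fun k => by positivity) (fun k => ?_)
    ((OrthonormalTorus.summable (X := X) r hr).mul_right 4)
  have e : (2 : ℝ≥0∞).toReal = ((2 : ℕ) : ℝ) := by norm_num
  have hb := OrthonormalTorus.bounded k x
  rw [e, Real.rpow_natCast, norm_mul, mul_pow,
    Real.norm_of_nonneg (Real.rpow_nonneg (one_add_lap_pos k).le _),
    ← Real.rpow_natCast ((1 + FlatTorus.lap k) ^ (-r / 2)) 2, ← Real.rpow_mul (one_add_lap_pos k).le,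
    show -r / 2 * ((2 : ℕ) : ℝ) = -r by push_cast; ring, Real.norm_eq_abs]
  refine mul_le_mul_of_nonneg_left ?_ (Real.rpow_nonneg (one_add_lap_pos k).le _)
  nlinarith [abs_nonneg (FlatTorus.basis k x)]

lemma pair_dirac [MeasurableSingletonClass X] (hr : 1 < r) (x : X) {f : X → ℝ}
    (hf : f ∈ trigPoly X) : pair (dirac r x) f = f x := by
  obtain ⟨a, rfl⟩ := exists_linearCombination hf
  rw [pair_linearCombination, Finsupp.linearCombination_apply, Finsupp.linearCombination_apply,
    Finsupp.sum, Finsupp.sum, Finset.sum_apply]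
  exact Finset.sum_congr rfl fun k _ => by rw [coeff_dirac hr, Pi.smul_apply]

end HNeg

open HNeg

lemma cosMul_one_mul_mem {f : Circ → ℝ} (hf : f ∈ trigPoly Circ) :
    (fun θ => cosMul 1 θ * f θ) ∈ trigPoly Circ := by
  refine Submodule.span_induction ?_ ?_ ?_ ?_ hf
  · rintro _ ⟨(k : ℤ), rfl⟩
    obtain ⟨α, β, -, -, h⟩ := exists_cosMul_one_mul_trig k
    rw [show (fun θ => cosMul 1 θ * FlatTorus.basis k θ) = α • trig (k + 1) + β • trig (k - 1) from
      funext h]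
    exact add_mem (Submodule.smul_mem _ _ (basis_mem (X := Circ) _))
      (Submodule.smul_mem _ _ (basis_mem (X := Circ) _))
  · exact trigPoly_congr (zero_mem _) fun _ => mul_zero _
  · intro f g _ _ h1 h2
    refine trigPoly_congr (add_mem h1 h2) fun θ => ?_
    exact mul_add _ _ _
  · intro a f _ h1
    refine trigPoly_congr (Submodule.smul_mem _ a h1) fun θ => ?_
    exact mul_left_comm _ _ _

lemma sinMul_one_mul_mem {f : Circ → ℝ} (hf : f ∈ trigPoly Circ) :
    (fun θ => sinMul 1 θ * f θ) ∈ trigPoly Circ := by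
  refine Submodule.span_induction ?_ ?_ ?_ ?_ hf
  · rintro _ ⟨(k : ℤ), rfl⟩
    obtain ⟨α, β, -, -, h⟩ := exists_sinMul_one_mul_trig k
    rw [show (fun θ => sinMul 1 θ * FlatTorus.basis k θ) = α • trig (-k + 1) + β • trig (-k - 1)
      from funext h]
    exact add_mem (Submodule.smul_mem _ _ (basis_mem (X := Circ) _))
      (Submodule.smul_mem _ _ (basis_mem (X := Circ) _))
  · exact trigPoly_congr (zero_mem _) fun _ => mul_zero _
  · intro f g _ _ h1 h2
    refine trigPoly_congr (add_mem h1 h2) fun θ => ?_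
    exact mul_add _ _ _
  · intro a f _ h1
    refine trigPoly_congr (Submodule.smul_mem _ a h1) fun θ => ?_
    exact mul_left_comm _ _ _

lemma one_mem_trigPoly : (fun _ => 1 : Circ → ℝ) ∈ trigPoly Circ := by
  rw [← show trig 0 = fun _ => 1 from funext trig_zero]
  exact basis_mem (X := Circ) _

lemma cosMul_one_mem : cosMul 1 ∈ trigPoly Circ := by
  simpa using cosMul_one_mul_mem one_mem_trigPoly

lemma sinMul_one_mem : sinMul 1 ∈ trigPoly Circ := by
  simpa using sinMul_one_mul_mem one_mem_trigPoly

lemma tensor_mem {f g : Circ → ℝ} (hf : f ∈ trigPoly Circ) (hg : g ∈ trigPoly Circ) :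
    (fun x : Circ × Circ => f x.1 * g x.2) ∈ trigPoly (Circ × Circ) := by
  refine Submodule.span_induction ?_ ?_ ?_ ?_ hf
  · rintro _ ⟨k, rfl⟩
    refine Submodule.span_induction ?_ ?_ ?_ ?_ hg
    · rintro _ ⟨l, rfl⟩
      exact basis_mem (X := Circ × Circ) (k, l)
    · exact trigPoly_congr (zero_mem _) fun _ => mul_zero _
    · intro f g _ _ h1 h2
      refine trigPoly_congr (add_mem h1 h2) fun θ => ?_
      exact mul_add _ _ _
    · intro a f _ h1
      refine trigPoly_congr (Submodule.smul_mem _ a h1) fun θ => ?_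
      exact mul_left_comm _ _ _
  · exact trigPoly_congr (zero_mem _) fun _ => zero_mul _
  · intro f g _ _ h1 h2
    refine trigPoly_congr (add_mem h1 h2) fun θ => ?_
    exact add_mul _ _ _
  · intro a f _ h1
    refine trigPoly_congr (Submodule.smul_mem _ a h1) fun θ => ?_
    exact mul_assoc _ _ _

lemma kuramoto_eq (K : ℝ) (θ θ' : Circ) : kuramoto K θ θ'
    = -K * (sinMul 1 θ * cosMul 1 θ') + K * (cosMul 1 θ * sinMul 1 θ') := by
  have h : Real.Angle.sin (θ - θ')
      = sinMul 1 θ * cosMul 1 θ' - cosMul 1 θ * sinMul 1 θ' := by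
    induction θ using circ_forall with | h x => ?_
    induction θ' using circ_forall with | h y => ?_
    simp only [cosMul_coe, sinMul_coe, Int.cast_one, one_mul]
    rw [← Real.sin_sub]
    exact Real.Angle.sin_coe (x - y)
  rw [kuramoto, h]
  ring

/-- The functions `f(θ₁) Γ(θ₁, θ₂)` are trigonometric polynomials when `f` is one. -/
lemma mul_kuramoto_mem (K : ℝ) {f : Circ → ℝ} (hf : f ∈ trigPoly Circ) :
    (fun x : Circ × Circ => f x.1 * kuramoto K x.1 x.2) ∈ trigPoly (Circ × Circ) := by
  have h1 := Submodule.smul_mem _ (-K) (tensor_mem (sinMul_one_mul_mem hf) cosMul_one_mem)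
  have h2 := Submodule.smul_mem _ K (tensor_mem (cosMul_one_mul_mem hf) sinMul_one_mem)
  refine trigPoly_congr (add_mem h1 h2) fun x => ?_
  simp only [Pi.add_apply, Pi.smul_apply, smul_eq_mul, kuramoto_eq]
  ring

lemma pair_sum_smul_left {X : Type} [MeasurableSpace X] [FlatTorus X] [OrthonormalTorus X] {r : ℝ}
    {ι : Type*} (s : Finset ι) (c : ι → ℝ) (h : ι → HNeg X r) {f : X → ℝ} (hf : f ∈ trigPoly X) :
    pair (∑ i ∈ s, c i • h i) f = ∑ i ∈ s, c i * pair (h i) f := by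
  obtain ⟨ℓ, hℓ⟩ := exists_pair_eq r hf
  simp_rw [hℓ, map_sum, map_smul, smul_eq_mul]

/-- The convolution `Γ * h` of a finite combination of Dirac masses. -/
lemma convSnd_sum_dirac {r : ℝ} (hr : 1 < r) (K : ℝ) {ι : Type*} (s : Finset ι) (c : ι → ℝ)
    (x y : ι → Circ) :
    convSnd (kuramoto K) (∑ i ∈ s, c i • dirac r (x i, y i))
      = ∑ i ∈ s, (c i * kuramoto K (x i) (y i)) • dirac r (x i) := by
  rw [← ofCoeffs_coeff (∑ i ∈ s, (c i * kuramoto K (x i) (y i)) • dirac r (x i)), convSnd]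
  congr 1
  funext k
  have hk : trig k ∈ trigPoly Circ := basis_mem (X := Circ) k
  rw [pair_sum_smul_left _ _ _ (mul_kuramoto_mem K hk), coeff_sum]
  refine Finset.sum_congr rfl fun i _ => ?_
  rw [pair_dirac hr _ (mul_kuramoto_mem K hk), coeff_smul, coeff_dirac hr]
  change _ = _ * trig k (x i)
  ring

/-! ### The energy estimate for the graph fluctuations -/

lemma dC_mul_const (f : Circ → ℝ) (c : ℝ) (θ : Circ) :
    dC (fun y => f y * c) θ = dC f θ * c :=
  deriv_mul_const_field c

lemma dC_const_mul (f : Circ → ℝ) (c : ℝ) (θ : Circ) :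
    dC (fun y => c * f y) θ = c * dC f θ :=
  deriv_const_mul_field c

lemma dC_dC_trig (k : ℤ) (θ : Circ) : dC (dC (trig k)) θ = -(k : ℝ) ^ 2 * trig k θ := by
  rw [show dC (trig k) = fun θ => -(k : ℝ) * trig (-k) θ from funext (dC_trig k), dC_const_mul,
    dC_trig, neg_neg]
  push_cast; ring

/-- The first trigonometric moments of a probability measure on the torus. -/
def cosMoment (ν : ProbabilityMeasure Circ) : ℝ := ∫ θ, cosMul 1 θ ∂(ν : Measure Circ)

/-- See `cosMoment`. -/
def sinMoment (ν : ProbabilityMeasure Circ) : ℝ := ∫ θ, sinMul 1 θ ∂(ν : Measure Circ)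

lemma continuous_integral_probabilityMeasure {f : Circ → ℝ} (hf : Continuous f) :
    Continuous fun ν : ProbabilityMeasure Circ => ∫ θ, f θ ∂(ν : Measure Circ) := by
  refine ProbabilityMeasure.continuous_integral_boundedContinuousFunction
    (BoundedContinuousFunction.mkOfCompact ⟨f, hf⟩)

lemma abs_cosMul_le (n : ℤ) (θ : Circ) : |cosMul n θ| ≤ 1 := by
  induction θ using circ_forall with | h x => ?_
  rw [cosMul_coe]; exact Real.abs_cos_le_one _

lemma abs_sinMul_le (n : ℤ) (θ : Circ) : |sinMul n θ| ≤ 1 := by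
  induction θ using circ_forall with | h x => ?_
  rw [sinMul_coe]; exact Real.abs_sin_le_one _

lemma abs_integral_le_one {f : Circ → ℝ} (hf : ∀ θ, |f θ| ≤ 1) (ν : ProbabilityMeasure Circ) :
    |∫ θ, f θ ∂(ν : Measure Circ)| ≤ 1 := by
  have := norm_integral_le_of_norm_le_const (μ := (ν : Measure Circ)) (f := f) (C := 1)
    (Filter.Eventually.of_forall hf)
  simpa using this

lemma integral_kuramoto (K : ℝ) (ν : ProbabilityMeasure Circ) (θ : Circ) :
    ∫ θ', kuramoto K θ θ' ∂(ν : Measure Circ)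
      = -K * cosMoment ν * sinMul 1 θ + K * sinMoment ν * cosMul 1 θ := by
  simp_rw [kuramoto_eq]
  rw [integral_add, integral_const_mul, integral_const_mul, integral_const_mul, integral_const_mul,
    cosMoment, sinMoment]
  · ring
  · exact integrable_of_continuous (((continuous_cosMul 1).const_mul _).const_mul _) _
  · exact integrable_of_continuous (((continuous_sinMul 1).const_mul _).const_mul _) _

/-- The tensor products of functions of one variable. -/
def tensor (f g : Circ → ℝ) (x : Circ × Circ) : ℝ := f x.1 * g x.2

lemma opL2_basis (K : ℝ) (ν : ProbabilityMeasure Circ) (k : ℤ × ℤ) :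
    opL2 (kuramoto K) ν (tensor (trig k.1) (trig k.2))
      = (-(1 / 2) * ((k.1 : ℝ) ^ 2 + (k.2 : ℝ) ^ 2)) • tensor (trig k.1) (trig k.2)
        + ((K * cosMoment ν * k.1) • tensor (fun θ => sinMul 1 θ * trig (-k.1) θ) (trig k.2)
        + ((-(K * sinMoment ν * k.1)) • tensor (fun θ => cosMul 1 θ * trig (-k.1) θ) (trig k.2)
        + ((K * cosMoment ν * k.2) • tensor (trig k.1) (fun θ => sinMul 1 θ * trig (-k.2) θ)
        + (-(K * sinMoment ν * k.2))
            • tensor (trig k.1) (fun θ => cosMul 1 θ * trig (-k.2) θ)))) := by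
  have h1 : ∀ x, dFst (tensor (trig k.1) (trig k.2)) x = -(k.1 : ℝ) * trig (-k.1) x.1 * trig k.2 x.2 := by
    intro x
    rw [← dC_trig, ← dC_mul_const]; rfl
  have h2 : ∀ x, dSnd (tensor (trig k.1) (trig k.2)) x = trig k.1 x.1 * (-(k.2 : ℝ) * trig (-k.2) x.2) := by
    intro x
    rw [← dC_trig, ← dC_const_mul]; rfl
  have h3 : ∀ x, dFst (dFst (tensor (trig k.1) (trig k.2))) x
      = -(k.1 : ℝ) ^ 2 * trig k.1 x.1 * trig k.2 x.2 := by
    intro x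
    rw [← dC_dC_trig, ← dC_mul_const, show dC (trig k.1) = fun θ => -(k.1 : ℝ) * trig (-k.1) θ from
      funext (dC_trig k.1), dFst]
    simp_rw [h1]
  have h4 : ∀ x, dSnd (dSnd (tensor (trig k.1) (trig k.2))) x
      = trig k.1 x.1 * (-(k.2 : ℝ) ^ 2 * trig k.2 x.2) := by
    intro x
    rw [← dC_dC_trig, ← dC_const_mul, show dC (trig k.2) = fun θ => -(k.2 : ℝ) * trig (-k.2) θ from
      funext (dC_trig k.2), dSnd]
    simp_rw [h2]
  funext x
  simp only [opL2, h1, h2, h3, h4, integral_kuramoto, Pi.add_apply, Pi.smul_apply, smul_eq_mul,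
    tensor]
  ring

lemma tensor_trig_mem (k l : ℤ) : tensor (trig k) (trig l) ∈ trigPoly (Circ × Circ) :=
  tensor_mem (basis_mem (X := Circ) k) (basis_mem (X := Circ) l)

/-- The sign coded by a flag, as an integer. -/
def boolSign (b : Bool) : ℤ := if b then 1 else -1

/-- The frequencies adjacent to `k` up to the signs of the coordinates: the flag `q.1` chooses the
coordinate which is changed to plus or minus itself, plus or minus one. -/
def shift (q : Bool × Bool × Bool) (k : ℤ × ℤ) : ℤ × ℤ :=
  if q.1 then (boolSign q.2.1 * k.1 + boolSign q.2.2, k.2)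
  else (k.1, boolSign q.2.1 * k.2 + boolSign q.2.2)

lemma shift_injective (q : Bool × Bool × Bool) : Function.Injective (shift q) := by
  obtain ⟨a, b, c⟩ := q
  rintro ⟨k, l⟩ ⟨k', l'⟩ h
  cases a <;> cases b <;> simp [shift, boolSign] at h ⊢ <;> omega

lemma lap_shift_le (q : Bool × Bool × Bool) (k : ℤ × ℤ) :
    1 + ((shift q k).1 ^ 2 + (shift q k).2 ^ 2) ≤ 3 * (1 + (k.1 ^ 2 + k.2 ^ 2)) := by
  obtain ⟨a, b, c⟩ := q
  obtain ⟨k, l⟩ := k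
  cases a <;> cases b <;> cases c <;>
    simp only [shift, boolSign, if_true, Bool.false_eq_true, if_false] <;>
    nlinarith [sq_nonneg (k + 1), sq_nonneg (k - 1), sq_nonneg (l + 1), sq_nonneg (l - 1),
      sq_nonneg k, sq_nonneg l]

section Energy

variable {r : ℝ}

/-- The coefficient of `h` at the frequency `k`, with the frequency group made explicit. -/
abbrev coeff₂ (h : HNeg (Circ × Circ) r) (k : ℤ × ℤ) : ℝ :=
  coeff h (show FlatTorus.Freq (Circ × Circ) from k)

lemma pair_tensor_trig (h : HNeg (Circ × Circ) r) (k l : ℤ) :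
    pair h (tensor (trig k) (trig l)) = coeff₂ h (k, l) :=
  pair_basis h (show FlatTorus.Freq (Circ × Circ) from (k, l))

/-- The sum of the sizes of the coefficients at the adjacent frequencies. -/
def adjSum (h : HNeg (Circ × Circ) r) (k : ℤ × ℤ) : ℝ := ∑ q, |coeff₂ h (shift q k)|

lemma add_le_adjSum (h : HNeg (Circ × Circ) r) (k : ℤ × ℤ) (a b : Bool) :
    |coeff₂ h (shift (a, b, true) k)| + |coeff₂ h (shift (a, b, false) k)| ≤ adjSum h k := by
  rw [adjSum, ← Finset.sum_pair (f := fun q => |coeff₂ h (shift q k)|)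
    (show (a, b, true) ≠ (a, b, false) by simp)]
  exact Finset.sum_le_sum_of_subset_of_nonneg (Finset.subset_univ _) fun _ _ _ => abs_nonneg _

lemma abs_pair_comb_le (h : HNeg (Circ × Circ) r) (k : ℤ × ℤ) (a b : Bool) {f : Circ × Circ → ℝ}
    {α β : ℝ} (hα : |α| ≤ 1) (hβ : |β| ≤ 1)
    (hf : ∀ x, f x = α * tensor (trig (shift (a, b, true) k).1) (trig (shift (a, b, true) k).2) x
      + β * tensor (trig (shift (a, b, false) k).1) (trig (shift (a, b, false) k).2) x) :
    |pair h f| ≤ adjSum h k := by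
  have : f = α • tensor (trig (shift (a, b, true) k).1) (trig (shift (a, b, true) k).2)
      + β • tensor (trig (shift (a, b, false) k).1) (trig (shift (a, b, false) k).2) := funext hf
  rw [this, pair_add_right h (Submodule.smul_mem _ _ (tensor_trig_mem _ _))
    (Submodule.smul_mem _ _ (tensor_trig_mem _ _)), pair_smul_right h _ (tensor_trig_mem _ _),
    pair_smul_right h _ (tensor_trig_mem _ _), pair_tensor_trig, pair_tensor_trig]
  refine (abs_add_le _ _).trans (le_trans ?_ (add_le_adjSum h k a b))
  rw [abs_mul, abs_mul]
  exact add_le_add (mul_le_of_le_one_left (abs_nonneg _) hα)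
    (mul_le_of_le_one_left (abs_nonneg _) hβ)

/-- The generator in Fourier coordinates: the Laplacian is diagonal, and the drift is of order one
and couples adjacent frequencies only. -/
lemma exists_pair_opL2_basis (r K : ℝ) (hK : 0 ≤ K) (k : ℤ × ℤ) :
    ∃ p q : HNeg (Circ × Circ) r →L[ℝ] ℝ,
      (∀ h, |p h| ≤ 2 * K * √((k.1 : ℝ) ^ 2 + (k.2 : ℝ) ^ 2) * adjSum h k) ∧
      (∀ h, |q h| ≤ 2 * K * √((k.1 : ℝ) ^ 2 + (k.2 : ℝ) ^ 2) * adjSum h k) ∧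
      ∀ (ν : ProbabilityMeasure Circ) (h : HNeg (Circ × Circ) r),
        pair h (opL2 (kuramoto K) ν (tensor (trig k.1) (trig k.2)))
          = -(1 / 2) * ((k.1 : ℝ) ^ 2 + (k.2 : ℝ) ^ 2) * coeff₂ h k
            + (cosMoment ν * p h + sinMoment ν * q h) := by
  have t (k : ℤ) : trig k ∈ trigPoly Circ := basis_mem (X := Circ) k
  have m1 : tensor (fun θ => sinMul 1 θ * trig (-k.1) θ) (trig k.2) ∈ trigPoly (Circ × Circ) :=
    tensor_mem (sinMul_one_mul_mem (t _)) (t _)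
  have m2 : tensor (fun θ => cosMul 1 θ * trig (-k.1) θ) (trig k.2) ∈ trigPoly (Circ × Circ) :=
    tensor_mem (cosMul_one_mul_mem (t _)) (t _)
  have m3 : tensor (trig k.1) (fun θ => sinMul 1 θ * trig (-k.2) θ) ∈ trigPoly (Circ × Circ) :=
    tensor_mem (t _) (sinMul_one_mul_mem (t _))
  have m4 : tensor (trig k.1) (fun θ => cosMul 1 θ * trig (-k.2) θ) ∈ trigPoly (Circ × Circ) :=
    tensor_mem (t _) (cosMul_one_mul_mem (t _))
  obtain ⟨ℓ₁, h1⟩ := exists_pair_eq r m1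
  obtain ⟨ℓ₂, h2⟩ := exists_pair_eq r m2
  obtain ⟨ℓ₃, h3⟩ := exists_pair_eq r m3
  obtain ⟨ℓ₄, h4⟩ := exists_pair_eq r m4
  have b1 (h : HNeg (Circ × Circ) r) : |ℓ₁ h| ≤ adjSum h k := by
    obtain ⟨α, β, hα, hβ, H⟩ := exists_sinMul_one_mul_trig (-k.1)
    rw [← h1]
    refine abs_pair_comb_le h k true true hα hβ fun x => ?_
    simp only [tensor, H, shift, boolSign, if_true, neg_neg, one_mul, reduceCtorEq, if_false,
      ← sub_eq_add_neg]
    ring_nf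
  have b2 (h : HNeg (Circ × Circ) r) : |ℓ₂ h| ≤ adjSum h k := by
    obtain ⟨α, β, hα, hβ, H⟩ := exists_cosMul_one_mul_trig (-k.1)
    rw [← h2]
    refine abs_pair_comb_le h k true false hα hβ fun x => ?_
    simp only [tensor, H, shift, boolSign, if_true, neg_one_mul, reduceCtorEq, if_false,
      ← sub_eq_add_neg]
    ring_nf
  have b3 (h : HNeg (Circ × Circ) r) : |ℓ₃ h| ≤ adjSum h k := by
    obtain ⟨α, β, hα, hβ, H⟩ := exists_sinMul_one_mul_trig (-k.2)
    rw [← h3]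
    refine abs_pair_comb_le h k false true hα hβ fun x => ?_
    simp only [tensor, H, shift, boolSign, if_true, neg_neg, one_mul, reduceCtorEq, if_false,
      ← sub_eq_add_neg]
    ring_nf
  have b4 (h : HNeg (Circ × Circ) r) : |ℓ₄ h| ≤ adjSum h k := by
    obtain ⟨α, β, hα, hβ, H⟩ := exists_cosMul_one_mul_trig (-k.2)
    rw [← h4]
    refine abs_pair_comb_le h k false false hα hβ fun x => ?_
    simp only [tensor, H, shift, boolSign, if_true, neg_one_mul, reduceCtorEq, if_false,
      ← sub_eq_add_neg]
    ring_nf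
  set L := √((k.1 : ℝ) ^ 2 + (k.2 : ℝ) ^ 2) with hL
  have k1 : |(k.1 : ℝ)| ≤ L := Real.abs_le_sqrt (by nlinarith [sq_nonneg (k.2 : ℝ)])
  have k2 : |(k.2 : ℝ)| ≤ L := Real.abs_le_sqrt (by nlinarith [sq_nonneg (k.1 : ℝ)])
  have key (u v A : ℝ) (hu : |u| ≤ A) (hv : |v| ≤ A) :
      |K * k.1 * u + K * k.2 * v| ≤ 2 * K * L * A := by
    have hA : 0 ≤ A := (abs_nonneg _).trans hu
    refine (abs_add_le _ _).trans ?_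
    rw [abs_mul, abs_mul, abs_mul, abs_mul, abs_of_nonneg hK]
    have := mul_le_mul (mul_le_mul_of_nonneg_left k1 hK) hu (abs_nonneg _) (by positivity)
    have := mul_le_mul (mul_le_mul_of_nonneg_left k2 hK) hv (abs_nonneg _) (by positivity)
    linarith
  refine ⟨(K * k.1) • ℓ₁ + (K * k.2) • ℓ₃, -((K * k.1) • ℓ₂ + (K * k.2) • ℓ₄), fun h => ?_,
    fun h => ?_, fun ν h => ?_⟩
  · exact key _ _ _ (b1 h) (b3 h)
  · change |-(K * k.1 * ℓ₂ h + K * k.2 * ℓ₄ h)| ≤ _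
    rw [abs_neg]
    exact key _ _ _ (b2 h) (b4 h)
  · have s {f : Circ × Circ → ℝ} (c : ℝ) (hf : f ∈ trigPoly (Circ × Circ)) :=
      Submodule.smul_mem _ c hf
    rw [opL2_basis, pair_add_right h (s _ (tensor_trig_mem _ _))
      (add_mem (s _ m1) (add_mem (s _ m2) (add_mem (s _ m3) (s _ m4)))),
      pair_add_right h (s _ m1) (add_mem (s _ m2) (add_mem (s _ m3) (s _ m4))),
      pair_add_right h (s _ m2) (add_mem (s _ m3) (s _ m4)),
      pair_add_right h (s _ m3) (s _ m4), pair_smul_right h _ (tensor_trig_mem _ _),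
      pair_smul_right h _ m1, pair_smul_right h _ m2, pair_smul_right h _ m3,
      pair_smul_right h _ m4, h1, h2, h3, h4, pair_tensor_trig]
    change _ = -(1 / 2) * ((k.1 : ℝ) ^ 2 + (k.2 : ℝ) ^ 2) * coeff₂ h k
      + (cosMoment ν * (K * k.1 * ℓ₁ h + K * k.2 * ℓ₃ h)
        + sinMoment ν * -(K * k.1 * ℓ₂ h + K * k.2 * ℓ₄ h))
    ring

lemma continuous_cosMoment : Continuous cosMoment :=
  continuous_integral_probabilityMeasure (continuous_cosMul 1)

lemma continuous_sinMoment : Continuous sinMoment :=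
  continuous_integral_probabilityMeasure (continuous_sinMul 1)

lemma abs_cosMoment_le (ν : ProbabilityMeasure Circ) : |cosMoment ν| ≤ 1 :=
  abs_integral_le_one (abs_cosMul_le 1) ν

lemma abs_sinMoment_le (ν : ProbabilityMeasure Circ) : |sinMoment ν| ≤ 1 :=
  abs_integral_le_one (abs_sinMul_le 1) ν

lemma adjSum_nonneg (h : HNeg (Circ × Circ) r) (k : ℤ × ℤ) : 0 ≤ adjSum h k :=
  Finset.sum_nonneg fun _ _ => abs_nonneg _

lemma adjSum_sq_le (h : HNeg (Circ × Circ) r) (k : ℤ × ℤ) :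
    adjSum h k ^ 2 ≤ 8 * ∑ q, coeff₂ h (shift q k) ^ 2 := by
  have := sq_sum_le_card_mul_sum_sq (s := Finset.univ) (f := fun q => |coeff₂ h (shift q k)|)
  simpa [adjSum] using this

/-- The growth of one Fourier coefficient is controlled by the adjacent ones, without loss of
derivatives: the term of order one is absorbed by the dissipation. -/
lemma coeff_sq_le {K : ℝ} (hK : 0 ≤ K) {x : ℝ → HNeg (Circ × Circ) r} (hx : Continuous x)
    {μ : ℝ → ProbabilityMeasure Circ} (hμ : Continuous μ) {T : ℝ} (k : ℤ × ℤ)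
    (eqn : ∀ t ∈ Icc 0 T, coeff₂ (x t) k = coeff₂ (x 0) k
      + ∫ s in (0 : ℝ)..t, pair (x s) (opL2 (kuramoto K) (μ s) (tensor (trig k.1) (trig k.2))))
    {t : ℝ} (ht : t ∈ Icc 0 T) :
    coeff₂ (x t) k ^ 2 ≤ coeff₂ (x 0) k ^ 2
      + ∫ s in (0 : ℝ)..t, 128 * K ^ 2 * ∑ q, coeff₂ (x s) (shift q k) ^ 2 := by
  obtain ⟨p, q, hp, hq, H⟩ := exists_pair_opL2_basis r K hK k
  set L := √((k.1 : ℝ) ^ 2 + (k.2 : ℝ) ^ 2) with hL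
  have hL2 : (k.1 : ℝ) ^ 2 + (k.2 : ℝ) ^ 2 = L ^ 2 := (Real.sq_sqrt (by positivity)).symm
  rw [hL2] at H
  have hc (l : ℤ × ℤ) : Continuous fun s => coeff₂ (x s) l :=
    (coeffL (X := Circ × Circ) r l).continuous.comp hx
  set g : ℝ → ℝ := fun s => -(1 / 2) * L ^ 2 * coeff₂ (x s) k
    + (cosMoment (μ s) * p (x s) + sinMoment (μ s) * q (x s)) with hg
  have hgc : Continuous g :=
    ((hc k).const_mul _).add (((continuous_cosMoment.comp hμ).mul (p.continuous.comp hx)).add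
      ((continuous_sinMoment.comp hμ).mul (q.continuous.comp hx)))
  set y : ℝ → ℝ := fun t => coeff₂ (x 0) k + ∫ s in (0 : ℝ)..t, g s with hy
  have hyx : ∀ s ∈ Icc 0 T, coeff₂ (x s) k = y s := by
    intro s hs
    rw [eqn s hs]
    simp only [hy, hg, H]
  have hyd : ∀ s, HasDerivAt y (g s) s := fun s =>
    (hgc.integral_hasStrictDerivAt 0 s).hasDerivAt.const_add _
  have hyc : Continuous y := continuous_iff_continuousAt.mpr fun s => (hyd s).continuousAt
  have hint : ∫ s in (0 : ℝ)..t, 2 * y s * g s = y t ^ 2 - y 0 ^ 2 := by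
    refine intervalIntegral.integral_eq_sub_of_hasDerivAt (f := fun s => y s ^ 2) (fun s _ => ?_)
      (((hyc.const_mul 2).mul hgc).intervalIntegrable _ _)
    exact ((hyd s).pow 2).congr_deriv (by simp)
  rw [hyx t ht, hyx 0 ⟨le_rfl, ht.1.trans ht.2⟩, ← sub_le_iff_le_add', ← hint]
  refine intervalIntegral.integral_mono_on ht.1 (((hyc.const_mul 2).mul hgc).intervalIntegrable _ _)
    ((Continuous.const_mul (continuous_finsetSum _ fun q _ => (hc _).pow 2) _).intervalIntegrable
      _ _) fun s hs => ?_
  rw [← hyx s ⟨hs.1, hs.2.trans ht.2⟩]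
  have hA := adjSum_nonneg (x s) k
  have hw : |cosMoment (μ s) * p (x s) + sinMoment (μ s) * q (x s)| ≤ 4 * K * L * adjSum (x s) k := by
    refine (abs_add_le _ _).trans ?_
    rw [abs_mul, abs_mul]
    have h1 := mul_le_mul (abs_cosMoment_le (μ s)) (hp (x s)) (abs_nonneg _) zero_le_one
    have h2 := mul_le_mul (abs_sinMoment_le (μ s)) (hq (x s)) (abs_nonneg _) zero_le_one
    linarith
  have hA2 := adjSum_sq_le (x s) k
  simp only [hg]
  set w := cosMoment (μ s) * p (x s) + sinMoment (μ s) * q (x s)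
  set c := coeff₂ (x s) k
  have h3 : c * w ≤ |c| * (4 * K * L * adjSum (x s) k) :=
    (le_abs_self _).trans (by rw [abs_mul]; exact mul_le_mul_of_nonneg_left hw (abs_nonneg _))
  have h4 : 0 ≤ (L * |c| - 4 * K * adjSum (x s) k) ^ 2 := sq_nonneg _
  have h5 : |c| ^ 2 = c ^ 2 := sq_abs c
  have h6 := mul_le_mul_of_nonneg_left hA2 (show 0 ≤ 16 * K ^ 2 by positivity)
  nlinarith

lemma rpow_lap_le (hr : 0 ≤ r) (q : Bool × Bool × Bool) (k : ℤ × ℤ) :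
    (1 + FlatTorus.lap (X := Circ × Circ) k) ^ (-r)
      ≤ 3 ^ r * (1 + FlatTorus.lap (X := Circ × Circ) (shift q k)) ^ (-r) := by
  have h1 := one_add_lap_pos (X := Circ × Circ) k
  have h2 := one_add_lap_pos (X := Circ × Circ) (shift q k)
  have h3 : 1 + FlatTorus.lap (X := Circ × Circ) (shift q k)
      ≤ 3 * (1 + FlatTorus.lap (X := Circ × Circ) k) := by
    change 1 + (((shift q k).1 : ℝ) ^ 2 + ((shift q k).2 : ℝ) ^ 2)
      ≤ 3 * (1 + ((k.1 : ℝ) ^ 2 + (k.2 : ℝ) ^ 2))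
    exact_mod_cast lap_shift_le q k
  have h4 := Real.rpow_le_rpow_of_nonpos h2 h3 (neg_nonpos.mpr hr)
  rw [Real.mul_rpow (by norm_num) h1.le, Real.rpow_neg (by norm_num)] at h4
  have h5 : (0 : ℝ) < 3 ^ r := by positivity
  calc _ = 3 ^ r * ((3 ^ r)⁻¹ * (1 + FlatTorus.lap (X := Circ × Circ) k) ^ (-r)) := by
        rw [mul_inv_cancel_left₀ h5.ne']
    _ ≤ _ := mul_le_mul_of_nonneg_left h4 h5.le

lemma sum_weight_shift_le (hr : 0 ≤ r) (h : HNeg (Circ × Circ) r) (F : Finset (ℤ × ℤ)) :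
    ∑ k ∈ F, (1 + FlatTorus.lap (X := Circ × Circ) k) ^ (-r) * ∑ q, coeff₂ h (shift q k) ^ 2
      ≤ 8 * 3 ^ r * ‖h‖ ^ 2 := by
  have h1 (q : Bool × Bool × Bool) :
      ∑ k ∈ F, (1 + FlatTorus.lap (X := Circ × Circ) (shift q k)) ^ (-r)
        * coeff₂ h (shift q k) ^ 2 ≤ ‖h‖ ^ 2 := by
    rw [← Finset.sum_image (f := fun k : ℤ × ℤ =>
      (1 + FlatTorus.lap (X := Circ × Circ) k) ^ (-r) * coeff₂ h k ^ 2)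
      (shift_injective q).injOn]
    exact sum_le_hasSum _ (fun k _ => mul_nonneg
      (Real.rpow_nonneg (one_add_lap_pos (X := Circ × Circ) k).le _) (sq_nonneg _))
      (hasSum_norm_sq h)
  calc _ ≤ ∑ k ∈ F, ∑ q, 3 ^ r * ((1 + FlatTorus.lap (X := Circ × Circ) (shift q k)) ^ (-r)
        * coeff₂ h (shift q k) ^ 2) := by
        refine Finset.sum_le_sum fun k _ => ?_
        rw [Finset.mul_sum]
        refine Finset.sum_le_sum fun q _ => ?_
        rw [← mul_assoc]
        exact mul_le_mul_of_nonneg_right (rpow_lap_le hr q k) (sq_nonneg _)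
    _ = ∑ q, 3 ^ r * ∑ k ∈ F, (1 + FlatTorus.lap (X := Circ × Circ) (shift q k)) ^ (-r)
        * coeff₂ h (shift q k) ^ 2 := by
        rw [Finset.sum_comm]
        simp_rw [Finset.mul_sum]
    _ ≤ ∑ _q : Bool × Bool × Bool, 3 ^ r * ‖h‖ ^ 2 :=
        Finset.sum_le_sum fun q _ => mul_le_mul_of_nonneg_left (h1 q) (by positivity)
    _ = 8 * 3 ^ r * ‖h‖ ^ 2 := by
        rw [Finset.sum_const, nsmul_eq_mul, mul_assoc]
        simp

/-- The energy estimate for `∂ₜ h = L⁽²⁾* h` in `H^{-r}`. -/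
lemma norm_sq_le_add_integral {K : ℝ} (hK : 0 ≤ K) (hr : 0 ≤ r) {x : ℝ → HNeg (Circ × Circ) r}
    (hx : Continuous x) {μ : ℝ → ProbabilityMeasure Circ} (hμ : Continuous μ) {T : ℝ}
    (eqn : ∀ t ∈ Icc 0 T, ∀ k : ℤ × ℤ, coeff₂ (x t) k = coeff₂ (x 0) k
      + ∫ s in (0 : ℝ)..t, pair (x s) (opL2 (kuramoto K) (μ s) (tensor (trig k.1) (trig k.2))))
    {t : ℝ} (ht : t ∈ Icc 0 T) :
    ‖x t‖ ^ 2 ≤ ‖x 0‖ ^ 2 + ∫ s in (0 : ℝ)..t, 1024 * K ^ 2 * 3 ^ r * ‖x s‖ ^ 2 := by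
  have hc (l : ℤ × ℤ) : Continuous fun s => coeff₂ (x s) l :=
    (coeffL (X := Circ × Circ) r l).continuous.comp hx
  have hw (k : ℤ × ℤ) : 0 ≤ (1 + FlatTorus.lap (X := Circ × Circ) k) ^ (-r) :=
    Real.rpow_nonneg (one_add_lap_pos (X := Circ × Circ) k).le _
  refine hasSum_le_of_sum_le (hasSum_norm_sq (x t)) fun (F : Finset (ℤ × ℤ)) => ?_
  have hii (k : ℤ × ℤ) (a b c : ℝ) : IntervalIntegrable (fun s =>
      c * (128 * K ^ 2 * ∑ q, coeff₂ (x s) (shift q k) ^ 2)) volume a b :=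
    (((continuous_finsetSum _ fun q _ => (hc _).pow 2).const_mul _).const_mul _).intervalIntegrable
      _ _
  calc _ ≤ ∑ k ∈ F, (1 + FlatTorus.lap (X := Circ × Circ) k) ^ (-r) * (coeff₂ (x 0) k ^ 2
      + ∫ s in (0 : ℝ)..t, 128 * K ^ 2 * ∑ q, coeff₂ (x s) (shift q k) ^ 2) :=
        Finset.sum_le_sum fun k _ => mul_le_mul_of_nonneg_left
          (coeff_sq_le hK hx hμ k (fun t ht => eqn t ht k) ht) (hw k)
    _ = ∑ k ∈ F, (1 + FlatTorus.lap (X := Circ × Circ) k) ^ (-r) * coeff₂ (x 0) k ^ 2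
        + ∫ s in (0 : ℝ)..t, ∑ k ∈ F, (1 + FlatTorus.lap (X := Circ × Circ) k) ^ (-r)
          * (128 * K ^ 2 * ∑ q, coeff₂ (x s) (shift q k) ^ 2) := by
        simp_rw [mul_add, Finset.sum_add_distrib]
        rw [intervalIntegral.integral_finsetSum fun k _ => hii k _ _ _]
        simp_rw [intervalIntegral.integral_const_mul]
    _ ≤ _ := by
        refine add_le_add (sum_le_hasSum _ (fun k _ => mul_nonneg (hw k) (sq_nonneg _))
          (hasSum_norm_sq (x 0))) ?_
        refine intervalIntegral.integral_mono_on ht.1 ?_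
          ((hx.norm.pow 2).const_mul _ |>.intervalIntegrable _ _) fun s _ => ?_
        · exact (continuous_finsetSum _ fun k _ => ((continuous_finsetSum _ fun q _ =>
            (hc _).pow 2).const_mul _).const_mul _).intervalIntegrable _ _
        · have h1 := mul_le_mul_of_nonneg_left (sum_weight_shift_le hr (x s) F)
            (show 0 ≤ 128 * K ^ 2 by positivity)
          refine le_trans (le_of_eq ?_) (h1.trans (le_of_eq (by ring)))
          rw [Finset.mul_sum]
          exact Finset.sum_congr rfl fun k _ => by ring

/-- On a time interval depending on `K` and `r` only, the solutions of `∂ₜ h = L⁽²⁾* h` at most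
double their squared norm. -/
lemma exists_norm_sq_le_two_mul {K : ℝ} (hK : 0 ≤ K) (hr : 0 ≤ r) {T : ℝ} (hT : 0 < T) :
    ∃ δ ∈ Ioc 0 T, ∀ {x : ℝ → HNeg (Circ × Circ) r}, Continuous x →
      ∀ {μ : ℝ → ProbabilityMeasure Circ}, Continuous μ →
      (∀ t ∈ Icc 0 T, ∀ k : ℤ × ℤ, coeff₂ (x t) k = coeff₂ (x 0) k + ∫ s in (0 : ℝ)..t,
        pair (x s) (opL2 (kuramoto K) (μ s) (tensor (trig k.1) (trig k.2)))) →
      ∀ t ∈ Icc 0 δ, ‖x t‖ ^ 2 ≤ 2 * ‖x 0‖ ^ 2 := by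
  set M : ℝ := 1024 * K ^ 2 * 3 ^ r with hM
  have hM0 : 0 ≤ M := by positivity
  refine ⟨min T (1 / (2 * M + 1)), ⟨by positivity, min_le_left _ _⟩, ?_⟩
  intro x hx μ hμ eqn
  set δ := min T (1 / (2 * M + 1)) with hδ
  have hδ0 : 0 < δ := by positivity
  have hδM : M * δ ≤ 1 / 2 := by
    have h1 : M * δ ≤ M * (1 / (2 * M + 1)) := mul_le_mul_of_nonneg_left (min_le_right _ _) hM0
    refine h1.trans ?_
    rw [mul_one_div, div_le_div_iff₀ (by positivity) (by norm_num)]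
    linarith
  -- The bound at the time where the norm is largest gives the bound at all times.
  obtain ⟨u, hu, hmax⟩ := isCompact_Icc.exists_isMaxOn (Set.nonempty_Icc.mpr hδ0.le)
    (hx.norm.pow 2).continuousOn
  have h1 := norm_sq_le_add_integral hK hr hx hμ eqn (t := u) ⟨hu.1, hu.2.trans (min_le_left _ _)⟩
  have h2 : ∫ s in (0 : ℝ)..u, M * ‖x s‖ ^ 2 ≤ ∫ s in (0 : ℝ)..u, M * ‖x u‖ ^ 2 :=
    intervalIntegral.integral_mono_on hu.1
      ((hx.norm.pow 2).const_mul _ |>.intervalIntegrable _ _) (by simp) fun s hs =>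
        mul_le_mul_of_nonneg_left (hmax ⟨hs.1, hs.2.trans hu.2⟩) hM0
  rw [intervalIntegral.integral_const, sub_zero, smul_eq_mul] at h2
  have h3 : u * (M * ‖x u‖ ^ 2) ≤ 1 / 2 * ‖x u‖ ^ 2 := by
    rw [← mul_assoc, mul_comm u M]
    exact mul_le_mul_of_nonneg_right ((mul_le_mul_of_nonneg_left hu.2 hM0).trans hδM) (sq_nonneg _)
  intro t ht
  have h4 : ‖x t‖ ^ 2 ≤ ‖x u‖ ^ 2 := hmax ht
  linarith

/-- Solutions of `∂ₜ h = L⁽²⁾* h` are Lipschitz in time, when tested against a trigonometric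
polynomial, with a constant depending on the norm of the initial condition only. -/
lemma exists_abs_pair_sub_le {K : ℝ} (hK : 0 ≤ K) (hr : 0 ≤ r) {T : ℝ} (hT : 0 < T)
    {g : Circ × Circ → ℝ} (hg : g ∈ trigPoly (Circ × Circ)) :
    ∃ δ ∈ Ioc 0 T, ∃ C : ℝ, ∀ {x : ℝ → HNeg (Circ × Circ) r}, Continuous x →
      ∀ {μ : ℝ → ProbabilityMeasure Circ}, Continuous μ →
      (∀ t ∈ Icc 0 T, ∀ k : ℤ × ℤ, coeff₂ (x t) k = coeff₂ (x 0) k + ∫ s in (0 : ℝ)..t,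
        pair (x s) (opL2 (kuramoto K) (μ s) (tensor (trig k.1) (trig k.2)))) →
      ∀ t ∈ Icc 0 δ, |pair (x t) g - pair (x 0) g| ≤ C * ‖x 0‖ * t := by
  obtain ⟨δ, hδ, H⟩ := exists_norm_sq_le_two_mul (r := r) hK hr hT
  refine ⟨δ, hδ, ?_⟩
  refine Submodule.span_induction ?_ ?_ ?_ ?_ hg
  · rintro _ ⟨(k : ℤ × ℤ), rfl⟩
    obtain ⟨p, q, -, -, hpq⟩ := exists_pair_opL2_basis r K hK k
    set N := ‖(-(1 / 2) * ((k.1 : ℝ) ^ 2 + (k.2 : ℝ) ^ 2)) • coeffL (X := Circ × Circ) r k‖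
      + (‖p‖ + ‖q‖) with hN
    refine ⟨N * 2, fun {x} hx μ hμ eqn t ht => ?_⟩
    have hb (s : ℝ) (hs : s ∈ Icc 0 δ) : ‖pair (x s) (opL2 (kuramoto K) (μ s)
        (tensor (trig k.1) (trig k.2)))‖ ≤ N * 2 * ‖x 0‖ := by
      have h1 : ‖x s‖ ≤ 2 * ‖x 0‖ := by
        refine abs_le_of_sq_le_sq' ?_ (by positivity) |>.2
        nlinarith [H hx hμ eqn s hs, sq_nonneg ‖x 0‖]
      have h2 : ‖pair (x s) (opL2 (kuramoto K) (μ s) (tensor (trig k.1) (trig k.2)))‖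
          ≤ N * ‖x s‖ := by
        rw [hpq, hN, add_mul, add_mul]
        refine (norm_add_le _ _).trans (add_le_add
          (ContinuousLinearMap.le_opNorm ((-(1 / 2) * ((k.1 : ℝ) ^ 2 + (k.2 : ℝ) ^ 2)) •
            coeffL (X := Circ × Circ) r k) (x s)) ((norm_add_le _ _).trans (add_le_add ?_ ?_)))
        · rw [norm_mul]
          exact (mul_le_of_le_one_left (norm_nonneg _) (abs_cosMoment_le _)).trans (p.le_opNorm _)
        · rw [norm_mul]
          exact (mul_le_of_le_one_left (norm_nonneg _) (abs_sinMoment_le _)).trans (q.le_opNorm _)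
      refine h2.trans ?_
      rw [mul_assoc]
      exact mul_le_mul_of_nonneg_left h1 (by positivity)
    rw [pair_basis, pair_basis]
    have h3 := intervalIntegral.norm_integral_le_of_norm_le_const (a := 0) (b := t)
      (C := N * 2 * ‖x 0‖) (f := fun s => pair (x s) (opL2 (kuramoto K) (μ s)
        (tensor (trig k.1) (trig k.2)))) fun s hs => by
          rw [Set.uIoc_of_le ht.1] at hs
          exact hb s ⟨hs.1.le, hs.2.trans ht.2⟩
    rw [sub_zero, abs_of_nonneg ht.1] at h3
    have h4 := eqn t ⟨ht.1, ht.2.trans hδ.2⟩ k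
    change |coeff₂ (x t) k - coeff₂ (x 0) k| ≤ _
    rw [h4, add_sub_cancel_left]
    exact h3
  · refine ⟨0, fun {x} _ μ _ _ t _ => ?_⟩
    have h0 (h : HNeg (Circ × Circ) r) : pair h (0 : Circ × Circ → ℝ) = 0 := by
      simpa using pair_smul_right h 0 (zero_mem (trigPoly (Circ × Circ)))
    simp [h0]
  · rintro f₁ f₂ hf₁ hf₂ ⟨C₁, h₁⟩ ⟨C₂, h₂⟩
    refine ⟨C₁ + C₂, fun {x} hx μ hμ eqn t ht => ?_⟩
    rw [pair_add_right _ hf₁ hf₂, pair_add_right _ hf₁ hf₂, add_sub_add_comm]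
    refine (abs_add_le _ _).trans ((add_le_add (h₁ hx hμ eqn t ht) (h₂ hx hμ eqn t ht)).trans ?_)
    rw [add_mul, add_mul]
  · rintro a f hf ⟨C, h⟩
    refine ⟨|a| * C, fun {x} hx μ hμ eqn t ht => ?_⟩
    rw [pair_smul_right _ _ hf, pair_smul_right _ _ hf, ← mul_sub, abs_mul, mul_assoc, mul_assoc]
    refine mul_le_mul_of_nonneg_left ?_ (abs_nonneg a)
    rw [← mul_assoc]
    exact h hx hμ eqn t ht

/-! ### The limit system is not a mean-field equation -/

/-- The bracket with `L⁽¹⁾_ν cos` is a combination of continuous functionals with coefficients which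
are continuous in `ν`. -/
lemma exists_pair_opL1_trig_one (r K : ℝ) :
    ∃ (a : Fin 5 → ProbabilityMeasure Circ → ℝ) (ℓ : Fin 5 → HNeg Circ r →L[ℝ] ℝ),
      (∀ i, Continuous (a i)) ∧ ∀ (ν : ProbabilityMeasure Circ) (h : HNeg Circ r),
        pair h (opL1 (kuramoto K) ν (trig 1)) = ∑ i, a i ν * ℓ i h := by
  have t (k : ℤ) : trig k ∈ trigPoly Circ := basis_mem (X := Circ) k
  have m1 := sinMul_one_mul_mem (t (-1))
  have m2 := cosMul_one_mul_mem (t (-1))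
  obtain ⟨ℓ₀, h0⟩ := exists_pair_eq r (t 1)
  obtain ⟨ℓ₁, h1⟩ := exists_pair_eq r m1
  obtain ⟨ℓ₂, h2⟩ := exists_pair_eq r m2
  obtain ⟨ℓ₃, h3⟩ := exists_pair_eq r sinMul_one_mem
  obtain ⟨ℓ₄, h4⟩ := exists_pair_eq r cosMul_one_mem
  set D : ProbabilityMeasure Circ → ℝ := fun ν => ∫ θ, sinMul 1 θ * trig (-1) θ ∂(ν : Measure Circ)
  set E : ProbabilityMeasure Circ → ℝ := fun ν => ∫ θ, cosMul 1 θ * trig (-1) θ ∂(ν : Measure Circ)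
  have cD : Continuous D :=
    continuous_integral_probabilityMeasure ((continuous_sinMul 1).mul (continuous_trig (-1)))
  have cE : Continuous E :=
    continuous_integral_probabilityMeasure ((continuous_cosMul 1).mul (continuous_trig (-1)))
  refine ⟨![fun _ => -(1 / 2), fun ν => K * cosMoment ν, fun ν => -K * sinMoment ν,
    fun ν => -K * E ν, fun ν => K * D ν], ![ℓ₀, ℓ₁, ℓ₂, ℓ₃, ℓ₄], ?_, fun ν h => ?_⟩
  · intro i
    fin_cases i
    · exact continuous_const
    · exact continuous_cosMoment.const_mul _
    · exact continuous_sinMoment.const_mul _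
    · exact cE.const_mul _
    · exact cD.const_mul _
  have e : opL1 (kuramoto K) ν (trig 1) = (-(1 / 2) : ℝ) • trig 1
      + ((K * cosMoment ν) • (fun θ => sinMul 1 θ * trig (-1) θ)
      + ((-K * sinMoment ν) • (fun θ => cosMul 1 θ * trig (-1) θ)
      + ((-K * E ν) • sinMul 1 + (K * D ν) • cosMul 1))) := by
    funext θ
    have i1 : ∫ θ', opTheta (kuramoto K) (trig 1) (θ, θ') ∂(ν : Measure Circ)
        = (-K * cosMoment ν * sinMul 1 θ + K * sinMoment ν * cosMul 1 θ) * -trig (-1) θ := by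
      simp only [opTheta, dC_trig]
      rw [integral_mul_const, integral_kuramoto]
      push_cast; ring
    have i2 : ∫ θ', opTheta (kuramoto K) (trig 1) (θ', θ) ∂(ν : Measure Circ)
        = K * cosMul 1 θ * D ν + -K * sinMul 1 θ * E ν := by
      have (θ' : Circ) : opTheta (kuramoto K) (trig 1) (θ', θ)
          = K * cosMul 1 θ * (sinMul 1 θ' * trig (-1) θ')
            + -K * sinMul 1 θ * (cosMul 1 θ' * trig (-1) θ') := by
        simp only [opTheta, dC_trig, kuramoto_eq]
        push_cast; ring
      simp_rw [this]
      rw [integral_add, integral_const_mul, integral_const_mul]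
      · exact (integrable_of_continuous
          ((continuous_sinMul 1).mul (continuous_trig (-1))) _).const_mul _
      · exact (integrable_of_continuous
          ((continuous_cosMul 1).mul (continuous_trig (-1))) _).const_mul _
    rw [opL1, i1, i2, dC_dC_trig]
    simp only [Pi.add_apply, Pi.smul_apply, smul_eq_mul]
    push_cast; ring
  have s {f : Circ → ℝ} (c : ℝ) (hf : f ∈ trigPoly Circ) := Submodule.smul_mem _ c hf
  have m3 := sinMul_one_mem
  have m4 := cosMul_one_mem
  rw [e, pair_add_right h (s _ (t 1)) (add_mem (s _ m1) (add_mem (s _ m2) (add_mem (s _ m3)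
    (s _ m4)))), pair_add_right h (s _ m1) (add_mem (s _ m2) (add_mem (s _ m3) (s _ m4))),
    pair_add_right h (s _ m2) (add_mem (s _ m3) (s _ m4)), pair_add_right h (s _ m3) (s _ m4),
    pair_smul_right h _ (t 1), pair_smul_right h _ m1, pair_smul_right h _ m2,
    pair_smul_right h _ m3, pair_smul_right h _ m4, h0, h1, h2, h3, h4]
  simp [Fin.sum_univ_succ]

lemma opTheta_trig_one_mem (K : ℝ) : opTheta (kuramoto K) (trig 1) ∈ trigPoly (Circ × Circ) := by
  refine trigPoly_congr (mul_kuramoto_mem K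
    (Submodule.smul_mem _ (-1) (basis_mem (X := Circ) (show ℤ from -1)))) fun x => ?_
  rw [opTheta, dC_trig]
  change _ = -1 * trig (-1) x.1 * _
  push_cast; ring

instance (X : Type) [MeasurableSpace X] [FlatTorus X] (r T : ℝ) : BorelSpace (PathSpace X r T) :=
  ⟨rfl⟩

lemma continuous_pathAt_uncurry {X : Type} [MeasurableSpace X] [FlatTorus X] {T : ℝ} (hT : 0 < T) :
    Continuous fun p : PathSpace X r T × ℝ => pathAt hT p.1 p.2 :=
  (continuous_eval (F := PathSpace X r T)).comp
    (continuous_fst.prodMk ((continuous_projIcc (h := hT.le)).comp continuous_snd))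

lemma continuous_pathAt {X : Type} [MeasurableSpace X] [FlatTorus X] {T : ℝ} (hT : 0 < T)
    (x : PathSpace X r T) : Continuous (pathAt hT x) :=
  x.continuous.comp continuous_projIcc

/-- The functional of the path which isolates the noise of the mean-field equation. -/
def noisePart (K : ℝ) {T : ℝ} (hT : 0 < T) (μ : ℝ → ProbabilityMeasure Circ) (t : ℝ)
    (x : PathSpace Circ r T) : ℝ :=
  pair (pathAt hT x t) (trig 1) - pair (pathAt hT x 0) (trig 1)
    - ∫ s in (0 : ℝ)..t, pair (pathAt hT x s) (opL1 (kuramoto K) (μ s) (trig 1))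

lemma continuous_noisePart (K : ℝ) {T : ℝ} (hT : 0 < T) {μ : ℝ → ProbabilityMeasure Circ}
    (hμ : ContinuousOn μ (Icc 0 T)) {t : ℝ} (ht : t ∈ Icc 0 T) :
    Continuous (noisePart (r := r) K hT μ t) := by
  obtain ⟨ℓ₀, h0⟩ := exists_pair_eq r (basis_mem (X := Circ) (show ℤ from 1))
  obtain ⟨a, ℓ, ha, hℓ⟩ := exists_pair_opL1_trig_one r K
  have hμ' : Continuous fun s => μ (projIcc 0 T hT.le s) :=
    hμ.comp_continuous (continuous_subtype_val.comp continuous_projIcc) fun s =>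
      (projIcc 0 T hT.le s).2
  have e : noisePart (r := r) K hT μ t = fun x => ℓ₀ (pathAt hT x t) - ℓ₀ (pathAt hT x 0)
      - ∫ s in (0 : ℝ)..t, ∑ i, a i (μ (projIcc 0 T hT.le s)) * ℓ i (pathAt hT x s) := by
    funext x
    rw [noisePart, ← h0, ← h0]
    congr 1
    refine intervalIntegral.integral_congr fun s hs => ?_
    rw [Set.uIcc_of_le ht.1] at hs
    simp only [hℓ, projIcc_of_mem hT.le ⟨hs.1, hs.2.trans ht.2⟩]
  rw [e]
  have hc (s : ℝ) : Continuous fun x : PathSpace Circ r T => pathAt hT x s :=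
    continuous_eval_const _
  refine ((ℓ₀.continuous.comp (hc t)).sub (ℓ₀.continuous.comp (hc 0))).sub ?_
  refine intervalIntegral.continuous_parametric_intervalIntegral_of_continuous' ?_ 0 t
  refine continuous_finsetSum _ fun i _ => ?_
  exact (((ha i).comp hμ').comp continuous_snd).mul
    ((ℓ i).continuous.comp (continuous_pathAt_uncurry hT))

lemma IsNoise.integrable_pair {Ω : Type*} [MeasurableSpace Ω] {P : Measure Ω} {T : ℝ} {hT : 0 < T}
    {μ : ℝ → ProbabilityMeasure Circ} {W : Ω → PathSpace Circ r T} (hW : IsNoise P hT μ W)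
    {t : ℝ} {f : Circ → ℝ} (hf : FlatTorus.Smooth f) :
    Integrable (fun ω => pair (pathAt hT (W ω) t) f) P :=
  (hW.gaussian.hasGaussianLaw_eval (projIcc 0 T hT.le t, ⟨f, hf⟩)).integrable

/-- The expectation of the part of the path driven by the noise vanishes in the mean-field
equation, but is of order `t` in the limit system, since there the energy estimate bounds the
deterministic forcing `∫ Θ* η̂ₛ ds` from below for small times. -/
theorem IsLimitSystem.map_ne_of_isMeanFieldSPDE {K : ℝ} (hK : 0 ≤ K) (hr : 0 ≤ r) {T : ℝ}
    (hT : 0 < T) {μ : ℝ → ProbabilityMeasure Circ} (hμ : ContinuousOn μ (Icc 0 T))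
    {ν₀ : Measure (HNeg Circ r × HNeg (Circ × Circ) r)} {ηhat₀ : HNeg (Circ × Circ) r}
    (hν₀ : ∀ᵐ y ∂ν₀, y.2 = ηhat₀) (hne : pair ηhat₀ (opTheta (kuramoto K) (trig 1)) ≠ 0)
    {Ω₁ : Type*} [MeasurableSpace Ω₁] {P₁ : Measure Ω₁} [IsProbabilityMeasure P₁]
    {η W : Ω₁ → PathSpace Circ r T} {ηhat : Ω₁ → PathSpace (Circ × Circ) r T}
    (h₁ : IsLimitSystem P₁ hT (kuramoto K) μ ν₀ η ηhat W)
    {Ω₂ : Type*} [MeasurableSpace Ω₂] {P₂ : Measure Ω₂}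
    {η' W' : Ω₂ → PathSpace Circ r T} (h₂ : IsMeanFieldSPDE P₂ hT (kuramoto K) μ η' W') :
    P₁.map η ≠ P₂.map η' := by
  intro hmap
  have hsm : FlatTorus.Smooth (trig 1) := contDiff_trig 1
  set Θ := opTheta (kuramoto K) (trig 1) with hΘ
  set z := pair ηhat₀ Θ with hz
  obtain ⟨ℓ, hℓ⟩ := exists_pair_eq r (opTheta_trig_one_mem K)
  obtain ⟨δ, hδ, C, H⟩ := exists_abs_pair_sub_le (r := r) hK hr hT (opTheta_trig_one_mem K)
  -- A time at which the forcing has not moved by more than half of its initial value.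
  obtain ⟨t, ht0, htδ, htC⟩ : ∃ t : ℝ, 0 < t ∧ t ≤ δ ∧ C * ‖ηhat₀‖ * t ≤ |z| / 2 := by
    have hz0 : 0 < |z| := abs_pos.mpr hne
    have hD : 0 < |C * ‖ηhat₀‖| + 1 := by positivity
    refine ⟨min δ (|z| / 2 / (|C * ‖ηhat₀‖| + 1)), lt_min hδ.1 (by positivity), min_le_left _ _, ?_⟩
    calc _ ≤ (|C * ‖ηhat₀‖| + 1) * (|z| / 2 / (|C * ‖ηhat₀‖| + 1)) :=
          mul_le_mul (by linarith [le_abs_self (C * ‖ηhat₀‖)]) (min_le_right _ _)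
            (le_min hδ.1.le (by positivity)) hD.le
      _ = |z| / 2 := mul_div_cancel₀ _ hD.ne'
  have htT : t ∈ Icc 0 T := ⟨ht0.le, htδ.trans hδ.2⟩
  have hcont := (continuous_noisePart (r := r) K hT hμ htT)
  have hsmeas := hcont.measurable.stronglyMeasurable.aestronglyMeasurable (μ := P₂.map η')
  -- The mean-field equation: the expectation vanishes.
  have e2 : noisePart K hT μ t ∘ η' =ᵐ[P₂] fun ω => pair (pathAt hT (W' ω) t) (trig 1) := by
    filter_upwards [h₂.eqn_eta] with ω hω
    rw [Function.comp_apply, noisePart, hω t htT _ hsm]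
    ring
  have I2 : Integrable (noisePart K hT μ t) (P₂.map η') :=
    (integrable_map_measure hsmeas h₂.measurable_eta.aemeasurable).mpr
      ((h₂.noise.integrable_pair hsm).congr e2.symm)
  have J2 : ∫ x, noisePart K hT μ t x ∂(P₂.map η') = 0 := by
    rw [integral_map h₂.measurable_eta.aemeasurable hsmeas]
    exact (integral_congr_ae e2).trans (h₂.noise.centred t htT _ hsm)
  rw [← hmap] at hsmeas I2 J2
  rw [integral_map h₁.measurable_eta.aemeasurable hsmeas] at J2
  replace I2 : Integrable (fun ω => noisePart K hT μ t (η ω)) P₁ :=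
    (integrable_map_measure hsmeas h₁.measurable_eta.aemeasurable).mp I2
  -- The limit system: the expectation is the one of the forcing.
  have I1 := h₁.noise.integrable_pair (t := t) hsm
  have J1 := h₁.noise.centred t htT _ hsm
  have hinit : ∀ᵐ ω ∂P₁, pathAt hT (ηhat ω) 0 = ηhat₀ := by
    rw [← h₁.init] at hν₀
    have hm1 : Measurable fun ω => pathAt hT (η ω) 0 :=
      (continuous_eval_const (F := PathSpace Circ r T) _).measurable.comp h₁.measurable_eta
    have hm2 : Measurable fun ω => pathAt hT (ηhat ω) 0 :=
      (continuous_eval_const (F := PathSpace (Circ × Circ) r T) _).measurable.comp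
        h₁.measurable_etahat
    exact ae_of_ae_map (hm1.prodMk hm2).aemeasurable hν₀
  have hμ' : Continuous fun s => μ (projIcc 0 T hT.le s) :=
    hμ.comp_continuous (continuous_subtype_val.comp continuous_projIcc) fun s =>
      (projIcc 0 T hT.le s).2
  have hlow : ∀ᵐ ω ∂P₁, t * (z ^ 2 / 2) ≤ z * (noisePart K hT μ t (η ω)
      - pair (pathAt hT (W ω) t) (trig 1)) := by
    filter_upwards [hinit, h₁.eqn_eta, h₁.eqn_etahat] with ω h0 h1 h2
    have h3 : noisePart K hT μ t (η ω) - pair (pathAt hT (W ω) t) (trig 1)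
        = ∫ s in (0 : ℝ)..t, pair (pathAt hT (ηhat ω) s) Θ := by
      rw [noisePart, h1 t htT _ hsm]
      ring
    have hx := continuous_pathAt hT (ηhat ω)
    have h4 : ∀ s ∈ Icc 0 δ, |pair (pathAt hT (ηhat ω) s) Θ - z| ≤ C * ‖ηhat₀‖ * s := by
      have := H hx hμ' fun s hs k => by
        have h5 := h2 s hs (tensor (trig k.1) (trig k.2)) <| by
          change ContDiff ℝ (⊤ : ℕ∞) fun x : ℝ × ℝ => trig k.1 (x.1 : Circ) * trig k.2 (x.2 : Circ)
          exact ((contDiff_trig k.1).comp contDiff_fst).mul ((contDiff_trig k.2).comp contDiff_snd)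
        rw [pair_tensor_trig, pair_tensor_trig] at h5
        rw [h5]
        congr 1
        refine intervalIntegral.integral_congr fun u hu => ?_
        rw [Set.uIcc_of_le hs.1] at hu
        simp only [projIcc_of_mem hT.le ⟨hu.1, hu.2.trans hs.2⟩]
      rwa [h0] at this
    rw [h3, ← intervalIntegral.integral_const_mul]
    have h6 : ∫ _s in (0 : ℝ)..t, z ^ 2 / 2 = t * (z ^ 2 / 2) := by
      rw [intervalIntegral.integral_const, sub_zero, smul_eq_mul]
    rw [← h6]
    refine intervalIntegral.integral_mono_on ht0.le (by simp) ?_ fun s hs => ?_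
    · simp_rw [hΘ, hℓ]
      exact ((ℓ.continuous.comp hx).const_mul _).intervalIntegrable _ _
    · have h7 := h4 s ⟨hs.1, hs.2.trans htδ⟩
      have h8 : |pair (pathAt hT (ηhat ω) s) Θ - z| ≤ |z| / 2 := by
        rcases le_or_gt 0 (C * ‖ηhat₀‖) with hC | hC
        · exact h7.trans ((mul_le_mul_of_nonneg_left hs.2 hC).trans htC)
        · have := mul_nonpos_of_nonpos_of_nonneg hC.le hs.1
          linarith [abs_nonneg z]
      have h9 : |z * (pair (pathAt hT (ηhat ω) s) Θ - z)| ≤ z ^ 2 / 2 := by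
        rw [abs_mul]
        refine (mul_le_mul_of_nonneg_left h8 (abs_nonneg z)).trans ?_
        rw [← sq_abs z]
        exact le_of_eq (by ring)
      have := neg_le_of_abs_le h9
      nlinarith
  have hI : ∫ ω, z * (noisePart K hT μ t (η ω) - pair (pathAt hT (W ω) t) (trig 1)) ∂P₁ = 0 := by
    rw [integral_const_mul, integral_sub I2 I1, J2, J1]
    simp
  have hle := integral_mono_ae (integrable_const (t * (z ^ 2 / 2))) ((I2.sub I1).const_mul z) hlow
  rw [integral_const, probReal_univ, one_smul] at hle
  have hpos : 0 < t * (z ^ 2 / 2) := by positivity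
  exact absurd (hle.trans hI.le) (not_le.mpr hpos)

end Energy

/-! ### Averages over signs and the simple random walk -/

/-- A sign as a real number. -/
def sgn (u : ℤˣ) : ℝ := ((u : ℤ) : ℝ)

lemma sgn_one : sgn 1 = 1 := by simp [sgn]

lemma sgn_neg (u : ℤˣ) : sgn (-u) = -sgn u := by simp [sgn]

lemma sgn_mul (u v : ℤˣ) : sgn (u * v) = sgn u * sgn v := by simp [sgn]

lemma sgn_eq_or (u : ℤˣ) : sgn u = 1 ∨ sgn u = -1 := by
  rcases Int.units_eq_one_or u with rfl | rfl <;> simp [sgn]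

lemma sgn_sq (u : ℤˣ) : sgn u ^ 2 = 1 := by
  rcases sgn_eq_or u with h | h <;> rw [h] <;> norm_num

lemma sgn_mul_self (u : ℤˣ) : sgn u * sgn u = 1 := by rw [← sq, sgn_sq]

lemma abs_sgn (u : ℤˣ) : |sgn u| = 1 := by
  rcases sgn_eq_or u with h | h <;> rw [h] <;> norm_num

lemma expect_comp_equiv {α β M : Type*} [Fintype α] [Fintype β] [AddCommMonoid M] [Module ℚ≥0 M]
    (e : α ≃ β) (F : β → M) : 𝔼 a, F (e a) = 𝔼 b, F b :=
  Finset.expect_equiv e (by simp) (by simp)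

/-- A function which an equivalence turns into its opposite has average zero. -/
lemma expect_eq_zero_of_equiv {α : Type*} [Fintype α] (e : α ≃ α) {F : α → ℝ}
    (h : ∀ a, F (e a) = -F a) : 𝔼 a, F a = 0 := by
  have := expect_comp_equiv e F
  simp_rw [h, Finset.expect_neg_distrib] at this
  linarith

/-- The change of one sign. -/
def flipAt {ι : Type*} [DecidableEq ι] (a : ι) : (ι → ℤˣ) ≃ (ι → ℤˣ) :=
  Function.Involutive.toPerm (fun r => Function.update r a (-r a)) fun r => by simp

lemma flipAt_same {ι : Type*} [DecidableEq ι] (a : ι) (r : ι → ℤˣ) : flipAt a r a = -r a :=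
  Function.update_self _ _ _

lemma flipAt_of_ne {ι : Type*} [DecidableEq ι] {a b : ι} (h : b ≠ a) (r : ι → ℤˣ) :
    flipAt a r b = r b :=
  Function.update_of_ne h _ _

/-- The transition operator of the simple random walk. -/
def walkOp : (ℤ → ℝ) →ₗ[ℝ] (ℤ → ℝ) where
  toFun g x := (g (x + 1) + g (x - 1)) / 2
  map_add' f g := by funext x; simp only [Pi.add_apply]; ring
  map_smul' c f := by funext x; simp only [Pi.smul_apply, smul_eq_mul, RingHom.id_apply]; ring

lemma expect_walk {ι : Type*} [Fintype ι] [DecidableEq ι] (s : Finset ι) (g : ℤ → ℝ) (x : ℤ) :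
    𝔼 r : ι → ℤˣ, g (x + ∑ j ∈ s, (r j : ℤ)) = (walkOp ^ s.card) g x := by
  induction s using Finset.induction_on generalizing x with
  | empty => simp
  | insert a s ha ih =>
    rw [Finset.card_insert_of_notMem ha, pow_succ', Module.End.mul_apply]
    change _ = ((walkOp ^ s.card) g (x + 1) + (walkOp ^ s.card) g (x - 1)) / 2
    rw [← ih, ← ih]
    have h1 := expect_comp_equiv (flipAt a) fun r : ι → ℤˣ => g (x + ∑ j ∈ insert a s, (r j : ℤ))
    have h2 : ∀ r : ι → ℤˣ, g (x + ∑ j ∈ insert a s, (r j : ℤ))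
        + g (x + ∑ j ∈ insert a s, (flipAt a r j : ℤ))
        = g (x + 1 + ∑ j ∈ s, (r j : ℤ)) + g (x - 1 + ∑ j ∈ s, (r j : ℤ)) := by
      intro r
      have h3 : ∑ j ∈ s, (flipAt a r j : ℤ) = ∑ j ∈ s, (r j : ℤ) :=
        Finset.sum_congr rfl fun j hj => by
          rw [flipAt_of_ne (fun h => ha (by rwa [h] at hj))]
      rw [Finset.sum_insert ha, Finset.sum_insert ha, h3, flipAt_same]
      rcases Int.units_eq_one_or (r a) with h | h <;> rw [h]
      · simp [add_assoc, sub_eq_add_neg]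
      · rw [add_comm]
        simp [add_assoc, sub_eq_add_neg]
    have h4 : (𝔼 r : ι → ℤˣ, g (x + ∑ j ∈ insert a s, (r j : ℤ)))
        + 𝔼 r : ι → ℤˣ, g (x + ∑ j ∈ insert a s, (flipAt a r j : ℤ))
        = (𝔼 r : ι → ℤˣ, g (x + 1 + ∑ j ∈ s, (r j : ℤ)))
          + 𝔼 r : ι → ℤˣ, g (x - 1 + ∑ j ∈ s, (r j : ℤ)) := by
      rw [← Finset.expect_add_distrib, ← Finset.expect_add_distrib]
      exact Finset.expect_congr rfl fun r _ => h2 r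
    linarith

/-- The probability that the walk of `m` steps from `x` ends at `0`. -/
def returnProb (m : ℕ) (x : ℤ) : ℝ := (walkOp ^ m) (fun y => if y = 0 then 1 else 0) x

lemma returnProb_succ (m : ℕ) (x : ℤ) :
    returnProb (m + 1) x = (returnProb m (x + 1) + returnProb m (x - 1)) / 2 := by
  rw [returnProb, pow_succ', Module.End.mul_apply]
  rfl

lemma returnProb_of_lt (m : ℕ) {x : ℤ} (hx : (m : ℤ) < x) : returnProb m x = 0 := by
  induction m generalizing x with
  | zero => simp [returnProb, show x ≠ 0 by push_cast at hx; omega]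
  | succ m ih =>
    push_cast at hx
    rw [returnProb_succ, ih (by omega), ih (by omega)]; norm_num

lemma returnProb_of_odd (m : ℕ) {x : ℤ} (hx : Odd (m + x)) : returnProb m x = 0 := by
  induction m generalizing x with
  | zero =>
    have : x ≠ 0 := by rintro rfl; simp at hx
    simp [returnProb, this]
  | succ m ih =>
    have e1 : (m : ℤ) + (x + 1) = ((m + 1 : ℕ) : ℤ) + x := by push_cast; ring
    have e2 : (m : ℤ) + (x - 1) = ((m + 1 : ℕ) : ℤ) + x - 2 := by push_cast; ring
    rw [returnProb_succ, ih (by rwa [e1]), ih (by rw [e2]; exact hx.sub_even even_two)]; norm_num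

lemma returnProb_eq_choose (m k : ℕ) :
    returnProb m (m - 2 * k) = (m.choose k : ℝ) / 2 ^ m := by
  induction m generalizing k with
  | zero =>
    rcases k with _ | k
    · simp [returnProb]
    · simp only [returnProb, pow_zero, Module.End.one_apply, Nat.choose_zero_succ, Nat.cast_zero,
        zero_div]
      rw [if_neg (by push_cast; omega)]
  | succ m ih =>
    rcases k with _ | k
    · rw [returnProb_succ, returnProb_of_lt m (by push_cast; omega)]
      have := ih 0
      simp only [Nat.cast_zero, mul_zero, sub_zero, Nat.choose_zero_right, Nat.cast_one] at this ⊢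
      rw [show ((m + 1 : ℕ) : ℤ) - 1 = m by push_cast; ring, this, pow_succ]
      field_simp
      ring
    · rw [returnProb_succ]
      have e1 : ((m + 1 : ℕ) : ℤ) - 2 * ((k + 1 : ℕ) : ℤ) + 1 = m - 2 * k := by push_cast; ring
      have e2 : ((m + 1 : ℕ) : ℤ) - 2 * ((k + 1 : ℕ) : ℤ) - 1 = m - 2 * ((k + 1 : ℕ) : ℤ) := by
        push_cast; ring
      rw [e1, e2, ih, ih, Nat.choose_succ_succ, pow_succ]
      push_cast
      field_simp

/-- The expected absolute value of the simple random walk after `m` steps. -/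
def absWalk (m : ℕ) : ℝ := (walkOp ^ m) (fun y : ℤ => |(y : ℝ)|) 0

lemma absWalk_succ (m : ℕ) : absWalk (m + 1) = absWalk m + returnProb m 0 := by
  have h : walkOp (fun y : ℤ => |(y : ℝ)|)
      = (fun y : ℤ => |(y : ℝ)|) + fun y : ℤ => if y = 0 then 1 else 0 := by
    funext y
    change (|((y + 1 : ℤ) : ℝ)| + |((y - 1 : ℤ) : ℝ)|) / 2 = |(y : ℝ)| + if y = 0 then 1 else 0
    push_cast
    rcases lt_trichotomy y 0 with hy | rfl | hy
    · have hy' : (y : ℝ) ≤ -1 := by exact_mod_cast (show y ≤ -1 by omega)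
      rw [if_neg hy.ne, abs_of_nonpos (by linarith), abs_of_nonpos (by linarith),
        abs_of_nonpos (by linarith)]
      ring
    · norm_num
    · have hy' : (1 : ℝ) ≤ y := by exact_mod_cast hy
      rw [if_neg hy.ne', abs_of_nonneg (by linarith), abs_of_nonneg (by linarith),
        abs_of_nonneg (by linarith)]
      ring
  rw [absWalk, pow_succ, Module.End.mul_apply, h, map_add]
  rfl

/-- The return probability `binom(2k, k) / 4^k` of the walk after `2k` steps. -/
lemma returnProb_two_mul (k : ℕ) : returnProb (2 * k) 0 = (Nat.centralBinom k : ℝ) / 4 ^ k := by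
  have h := returnProb_eq_choose (2 * k) k
  rw [show ((2 * k : ℕ) : ℤ) - 2 * k = 0 by push_cast; ring] at h
  rw [h, pow_mul, Nat.centralBinom]
  norm_num

lemma returnProb_two_mul_succ (k : ℕ) :
    returnProb (2 * (k + 1)) 0 * (2 * k + 2) = returnProb (2 * k) 0 * (2 * k + 1) := by
  have h : ((k : ℝ) + 1) * (Nat.centralBinom (k + 1) : ℝ)
      = 2 * (2 * k + 1) * (Nat.centralBinom k : ℝ) := by
    exact_mod_cast Nat.succ_mul_centralBinom_succ k
  rw [returnProb_two_mul, returnProb_two_mul, pow_succ]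
  field_simp
  linear_combination 2 * h

lemma absWalk_two_mul (k : ℕ) : absWalk (2 * k) = 2 * k * returnProb (2 * k) 0 := by
  induction k with
  | zero => simp [absWalk]
  | succ k ih =>
    have h1 : returnProb (2 * k + 1) 0 = 0 := returnProb_of_odd _ ⟨k, by push_cast; ring⟩
    rw [show 2 * (k + 1) = 2 * k + 1 + 1 by ring, absWalk_succ, absWalk_succ, ih, h1,
      show 2 * k + 1 + 1 = 2 * (k + 1) by ring]
    push_cast
    linear_combination -returnProb_two_mul_succ k

lemma absWalk_two_mul_add_one (k : ℕ) :
    absWalk (2 * k + 1) = (2 * k + 1) * returnProb (2 * k) 0 := by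
  rw [absWalk_succ, absWalk_two_mul]; ring

/-- The relation of the return probability with the Wallis product. -/
lemma returnProb_sq_mul (k : ℕ) :
    (2 * k + 1) * returnProb (2 * k) 0 ^ 2 = (Real.Wallis.W k)⁻¹ := by
  induction k with
  | zero => simp [returnProb, Real.Wallis.W]
  | succ k ih =>
    have h := returnProb_two_mul_succ k
    have hW := Real.Wallis.W_pos k
    rw [Real.Wallis.W_succ, mul_inv, ← ih]
    have h2 : returnProb (2 * (k + 1)) 0 = returnProb (2 * k) 0 * (2 * k + 1) / (2 * k + 2) := by
      rw [← h]; field_simp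
    rw [h2]
    push_cast
    field_simp
    ring

lemma absWalk_nonneg (m : ℕ) : 0 ≤ absWalk m := by
  have h (k : ℕ) : 0 ≤ returnProb (2 * k) 0 := by rw [returnProb_two_mul]; positivity
  rcases Nat.even_or_odd' m with ⟨k, rfl | rfl⟩
  · rw [absWalk_two_mul]; exact mul_nonneg (by positivity) (h k)
  · rw [absWalk_two_mul_add_one]; exact mul_nonneg (by positivity) (h k)

/-- `E|S_m| ~ √(2m/π)`. -/
lemma tendsto_absWalk_div_sqrt :
    Tendsto (fun m : ℕ => absWalk m / √m) atTop (𝓝 √(2 / π)) := by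
  have hW : Tendsto (fun m : ℕ => (Real.Wallis.W (m / 2))⁻¹) atTop (𝓝 (2 / π)) := by
    have h := (Real.Wallis.tendsto_W_nhds_pi_div_two.inv₀ (by positivity)).comp
      (Nat.tendsto_div_const_atTop (n := 2) (by norm_num))
    rwa [inv_div] at h
  have h1 : Tendsto (fun m : ℕ => absWalk m ^ 2 / m) atTop (𝓝 (2 / π)) := by
    have hm : Tendsto (fun m : ℕ => (m : ℝ) / (m + 1)) atTop (𝓝 1) :=
      tendsto_natCast_div_add_atTop 1
    have key : ∀ᶠ m : ℕ in atTop, (Real.Wallis.W (m / 2))⁻¹ * (m / (m + 1)) ≤ absWalk m ^ 2 / m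
        ∧ absWalk m ^ 2 / m ≤ (Real.Wallis.W (m / 2))⁻¹ := by
      filter_upwards [eventually_gt_atTop 0] with m hm0
      rcases Nat.even_or_odd' m with ⟨k, rfl | rfl⟩
      · rw [Nat.mul_div_cancel_left k two_pos, ← returnProb_sq_mul, absWalk_two_mul]
        have hk : (0 : ℝ) < k := by exact_mod_cast (show 0 < k by omega)
        have e := sq_nonneg (returnProb (2 * k) 0)
        push_cast
        rw [show (2 * (k : ℝ) * returnProb (2 * k) 0) ^ 2 / (2 * k)
          = 2 * k * returnProb (2 * k) 0 ^ 2 by field_simp]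
        refine ⟨le_of_eq ?_, by nlinarith⟩
        field_simp
      · rw [show (2 * k + 1) / 2 = k by omega, ← returnProb_sq_mul, absWalk_two_mul_add_one]
        push_cast
        rw [show ((2 * (k : ℝ) + 1) * returnProb (2 * k) 0) ^ 2 / (2 * k + 1)
          = (2 * k + 1) * returnProb (2 * k) 0 ^ 2 by field_simp]
        refine ⟨mul_le_of_le_one_right (by positivity) ?_, le_rfl⟩
        rw [div_le_one (by positivity)]
        linarith
    exact tendsto_of_tendsto_of_tendsto_of_le_of_le' (by simpa using hW.mul hm) hW
      (key.mono fun _ h => h.1) (key.mono fun _ h => h.2)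
  refine (h1.sqrt).congr fun m => ?_
  rw [Real.sqrt_div (sq_nonneg _), Real.sqrt_sq (absWalk_nonneg m)]

/-- If `a i ~ L √i`, then `∑_{i < n} a i ~ (2/3) L n^{3/2}`. -/
lemma tendsto_sum_of_div_sqrt {a : ℕ → ℝ} {L : ℝ}
    (ha : Tendsto (fun i : ℕ => a i / √i) atTop (𝓝 L)) :
    Tendsto (fun n : ℕ => √n / (n : ℝ) ^ 2 * ∑ i ∈ Finset.range n, a i) atTop (𝓝 (2 / 3 * L)) := by
  -- The increments of `n^{3/2} = n √n`, up to a factor, replace `√i`.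
  set b : ℕ → ℝ := fun i => ((i + 1 : ℕ) : ℝ) * √((i + 1 : ℕ) : ℝ) - i * √(i : ℝ) with hb
  have hbsum (n : ℕ) : ∑ i ∈ Finset.range n, b i = n * √(n : ℝ) := by
    rw [hb, Finset.sum_range_sub fun i : ℕ => (i : ℝ) * √(i : ℝ)]
    simp
  have hbpos (i : ℕ) : 0 ≤ b i := by
    have h1 : (i : ℝ) ≤ ((i + 1 : ℕ) : ℝ) := by push_cast; linarith
    exact sub_nonneg.mpr (mul_le_mul h1 (Real.sqrt_le_sqrt h1) (Real.sqrt_nonneg _) (by positivity))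
  have hblim : Tendsto (fun i : ℕ => b i / √i) atTop (𝓝 (3 / 2)) := by
    have hq : Tendsto (fun i : ℕ => √(((i : ℝ) + 1) / i)) atTop (𝓝 1) := by
      have h1 : Tendsto (fun i : ℕ => ((i : ℝ) + 1) / i) atTop (𝓝 1) := by
        have := tendsto_one_div_atTop_nhds_zero_nat (𝕜 := ℝ)
        refine (by simpa using this.const_add 1 :
          Tendsto (fun i : ℕ => 1 + 1 / (i : ℝ)) atTop (𝓝 1)).congr' ?_
        filter_upwards [eventually_gt_atTop 0] with i hi
        have : (0 : ℝ) < i := by exact_mod_cast hi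
        field_simp
      simpa using h1.sqrt
    have h3 : Tendsto (fun i : ℕ => (√(((i : ℝ) + 1) / i) ^ 2 + √(((i : ℝ) + 1) / i) + 1)
        / (√(((i : ℝ) + 1) / i) + 1)) atTop (𝓝 (3 / 2)) := by
      rw [show (3 / 2 : ℝ) = (1 ^ 2 + 1 + 1) / (1 + 1) by norm_num]
      exact (((hq.pow 2).add hq).add_const 1).div (hq.add_const 1) (by norm_num)
    refine h3.congr' ?_
    filter_upwards [eventually_gt_atTop 0] with i hi
    have hi' : (0 : ℝ) < i := by exact_mod_cast hi
    have hs : 0 < √(i : ℝ) := Real.sqrt_pos.mpr hi'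
    rw [Real.sqrt_div (by positivity)]
    simp only [hb]
    push_cast
    set s := √(i : ℝ)
    set t := √((i : ℝ) + 1)
    have hs2 : s ^ 2 = i := Real.sq_sqrt hi'.le
    have ht2 : t ^ 2 = i + 1 := Real.sq_sqrt (by positivity)
    have ht : 0 < t := Real.sqrt_pos.mpr (by positivity)
    rw [← ht2, ← hs2]
    field_simp
    have h5 : t ^ 2 - s ^ 2 = 1 := by rw [ht2, hs2]; ring
    linear_combination (-(t ^ 2 + t * s + s ^ 2)) * h5
  have hab : Tendsto (fun i : ℕ => a i / b i) atTop (𝓝 (2 / 3 * L)) := by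
    have h1 := ha.div hblim (by norm_num)
    rw [show L / (3 / 2) = 2 / 3 * L by ring] at h1
    refine h1.congr' ?_
    filter_upwards [eventually_gt_atTop 0] with i hi
    have hs : 0 < √(i : ℝ) := Real.sqrt_pos.mpr (by exact_mod_cast hi)
    simp only [Pi.div_apply]
    rw [div_div_div_cancel_right₀ hs.ne']
  have hbne : ∀ᶠ i in atTop, b i ≠ 0 := by
    filter_upwards [hblim.eventually_ne (show (3 / 2 : ℝ) ≠ 0 by norm_num)] with i hi h0
    exact hi (by rw [h0, zero_div])
  have ho : (fun i => a i - 2 / 3 * L * b i) =o[atTop] b := by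
    refine (Asymptotics.isLittleO_iff_tendsto' (hbne.mono fun i hi h => absurd h hi)).mpr ?_
    have := hab.sub_const (2 / 3 * L)
    rw [sub_self] at this
    refine this.congr' ?_
    filter_upwards [hbne] with i hi
    rw [sub_div, mul_div_cancel_right₀ _ hi]
  have htop : Tendsto (fun n : ℕ => ∑ i ∈ Finset.range n, b i) atTop atTop := by
    simp_rw [hbsum]
    exact tendsto_natCast_atTop_atTop.atTop_mul_atTop₀
      (Real.tendsto_sqrt_atTop.comp tendsto_natCast_atTop_atTop)
  have hsum := ho.sum_range hbpos htop
  have h2 := (Asymptotics.isLittleO_iff_tendsto' (by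
    filter_upwards [eventually_gt_atTop 0] with n hn h
    rw [hbsum] at h
    have : (0 : ℝ) < n := by exact_mod_cast hn
    exact absurd h (by positivity))).mp hsum
  have h3 := h2.add_const (2 / 3 * L)
  rw [zero_add] at h3
  refine h3.congr' ?_
  filter_upwards [eventually_gt_atTop 0] with n hn
  have hn' : (0 : ℝ) < n := by exact_mod_cast hn
  have hs : 0 < √(n : ℝ) := Real.sqrt_pos.mpr hn'
  rw [Finset.sum_sub_distrib, ← Finset.mul_sum, hbsum]
  have hs2 : √(n : ℝ) ^ 2 = n := Real.sq_sqrt hn'.le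
  set S := ∑ i ∈ Finset.range n, a i
  set s := √(n : ℝ)
  rw [← hs2]
  field_simp
  ring

/-! ### Second moments of sums of signs -/

/-- A matrix of signs. -/
abbrev Cube (n : ℕ) : Type := Fin n → Fin n → ℤˣ

lemma expect_sq_nonneg {α : Type*} [Fintype α] (F : α → ℝ) : 0 ≤ 𝔼 a, F a ^ 2 :=
  Finset.expect_nonneg fun _ _ => sq_nonneg _

lemma expect_sq_sum_eq {α ι : Type*} [Fintype α] [DecidableEq ι] (s : Finset ι) (X : ι → α → ℝ)
    (h : ∀ p ∈ s, ∀ q ∈ s, p ≠ q → 𝔼 a, X p a * X q a = 0) :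
    𝔼 a, (∑ p ∈ s, X p a) ^ 2 = ∑ p ∈ s, 𝔼 a, X p a ^ 2 := by
  simp_rw [sq, Finset.sum_mul_sum]
  rw [Finset.expect_sum_comm]
  refine Finset.sum_congr rfl fun p hp => ?_
  rw [Finset.expect_sum_comm]
  exact Finset.sum_eq_single_of_mem p hp fun q hq hqp => h p hp q hq hqp.symm

/-- The average over the matrices of a product of functions of the rows. -/
lemma expect_prod_rows {K : Type*} [Field K] [CharZero K] {n : ℕ}
    (h : Fin n → (Fin n → ℤˣ) → K) :
    𝔼 w : Cube n, ∏ k, h k (w k) = ∏ k, 𝔼 r, h k r := by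
  simp_rw [Fintype.expect_eq_sum_div_card]
  rw [Finset.prod_div_distrib, Fintype.prod_sum]
  congr 1
  simp

lemma expect_row {n : ℕ} (i : Fin n) (f : (Fin n → ℤˣ) → ℝ) :
    𝔼 w : Cube n, f (w i) = 𝔼 r, f r := by
  have := expect_prod_rows (K := ℝ) (n := n) fun k => if k = i then f else fun _ => 1
  rw [Fintype.prod_eq_single i fun k hk => by simp [hk]] at this
  simp only [if_true] at this
  rw [← this]
  refine Finset.expect_congr rfl fun w _ => ?_
  rw [Fintype.prod_eq_single i fun k hk => by simp [hk]]
  simp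

lemma expect_row_mul_row {n : ℕ} {i k : Fin n} (hik : i ≠ k) (f g : (Fin n → ℤˣ) → ℝ) :
    𝔼 w : Cube n, f (w i) * g (w k) = (𝔼 r, f r) * 𝔼 r, g r := by
  have := expect_prod_rows (K := ℝ) (n := n) fun l => if l = i then f else if l = k then g
    else fun _ => 1
  rw [Fintype.prod_eq_mul i k hik fun l hl => by simp [hl.1, hl.2]] at this
  simp only [if_true, if_neg hik.symm] at this
  rw [← this]
  refine Finset.expect_congr rfl fun w _ => ?_
  rw [Fintype.prod_eq_mul i k hik fun l hl => by simp [hl.1, hl.2]]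
  simp [hik.symm]

/-- The action of an equivalence on one row of the matrix. -/
def onRow {n : ℕ} (i : Fin n) (e : (Fin n → ℤˣ) ≃ (Fin n → ℤˣ)) : Cube n ≃ Cube n :=
  Equiv.piCongrRight fun k => if k = i then e else Equiv.refl _

lemma onRow_same {n : ℕ} (i : Fin n) (e : (Fin n → ℤˣ) ≃ (Fin n → ℤˣ)) (w : Cube n) :
    onRow i e w i = e (w i) := by
  simp [onRow]

lemma onRow_of_ne {n : ℕ} {i k : Fin n} (h : k ≠ i) (e : (Fin n → ℤˣ) ≃ (Fin n → ℤˣ))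
    (w : Cube n) : onRow i e w k = w k := by
  simp [onRow, h]

lemma expect_sgn_mul_sgn {ι : Type*} [Fintype ι] [DecidableEq ι] {j k : ι} (h : j ≠ k) :
    𝔼 r : ι → ℤˣ, sgn (r j) * sgn (r k) = 0 :=
  expect_eq_zero_of_equiv (flipAt j) fun r => by
    rw [flipAt_same, flipAt_of_ne h.symm, sgn_neg, neg_mul]

lemma expect_sq_sum_sgn {ι : Type*} [Fintype ι] [DecidableEq ι] (s : Finset ι) :
    𝔼 r : ι → ℤˣ, (∑ j ∈ s, sgn (r j)) ^ 2 = s.card := by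
  rw [expect_sq_sum_eq s (fun j (r : ι → ℤˣ) => sgn (r j)) fun j _ k _ h => expect_sgn_mul_sgn h]
  simp_rw [sgn_sq, Finset.expect_const Finset.univ_nonempty]
  simp

/-! #### The majority sign of a row -/

/-- The sum of the first `m` entries. -/
def rowSum {n : ℕ} (m : ℕ) (r : Fin n → ℤˣ) : ℤ := ∑ j with j.val < m, (r j : ℤ)

/-- The sign of the sum of the first `m` entries, the entry `i` being used to break ties: it enters
with half the weight of the others, so that the sum is never zero. -/
def rowSign {n : ℕ} (m : ℕ) (i : Fin n) (r : Fin n → ℤˣ) : ℤˣ :=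
  if 0 < 2 * rowSum m r + r i then 1 else -1

lemma rowSum_neg {n : ℕ} (m : ℕ) (r : Fin n → ℤˣ) : rowSum m (-r) = -rowSum m r := by
  simp [rowSum]

lemma rowSign_neg {n : ℕ} (m : ℕ) (i : Fin n) (r : Fin n → ℤˣ) :
    rowSign m i (-r) = -rowSign m i r := by
  have h : ((-r) i : ℤ) = -(r i : ℤ) := by simp
  rw [rowSign, rowSign, rowSum_neg, h]
  rcases Int.units_eq_one_or (r i) with hr | hr <;> rw [hr] <;>
    simp only [Units.val_one, Units.val_neg] <;> split_ifs <;> first | omega | simp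

lemma rowSign_congr {n m : ℕ} {i : Fin n} (hm : m ≤ i) {r r' : Fin n → ℤˣ}
    (h : ∀ j ≤ i, r j = r' j) : rowSign m i r = rowSign m i r' := by
  have : rowSum m r = rowSum m r' := by
    refine Finset.sum_congr rfl fun j hj => ?_
    rw [Finset.mem_filter] at hj
    rw [h j (by rw [Fin.le_def]; omega)]
  rw [rowSign, rowSign, this, h i le_rfl]

lemma sgn_rowSign_mul_rowSum {n : ℕ} (m : ℕ) (i : Fin n) (r : Fin n → ℤˣ) :
    sgn (rowSign m i r) * (rowSum m r : ℝ) = |(rowSum m r : ℝ)| := by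
  rw [rowSign]
  split_ifs with h
  · have h0 : 0 ≤ rowSum m r := by
      rcases Int.units_eq_one_or (r i) with hr | hr <;> rw [hr] at h <;> simp at h <;> omega
    rw [sgn_one, one_mul, abs_of_nonneg (by exact_mod_cast h0)]
  · have h0 : rowSum m r ≤ 0 := by
      rcases Int.units_eq_one_or (r i) with hr | hr <;> rw [hr] at h <;> simp at h <;> omega
    rw [sgn_neg, sgn_one, neg_one_mul, abs_of_nonpos (by exact_mod_cast h0)]

/-- The correlation of the majority sign with one entry. -/
def signCorr (n m : ℕ) (i j : Fin n) : ℝ := 𝔼 r : Fin n → ℤˣ, sgn (rowSign m i r) * sgn (r j)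

lemma signCorr_eq_zero {n m : ℕ} {i j : Fin n} (hj : m ≤ j) (hji : j ≠ i) :
    signCorr n m i j = 0 := by
  refine expect_eq_zero_of_equiv (flipAt j) fun r => ?_
  have : rowSum m (flipAt j r) = rowSum m r := by
    refine Finset.sum_congr rfl fun k hk => ?_
    rw [Finset.mem_filter] at hk
    rw [flipAt_of_ne (by rintro rfl; omega)]
  rw [rowSign, rowSign, this, flipAt_of_ne hji.symm, flipAt_same, sgn_neg, mul_neg]

lemma card_filter_val_lt {n m : ℕ} (h : m ≤ n) :
    (Finset.univ.filter fun j : Fin n => j.val < m).card = m := by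
  rw [Fin.card_filter_val_lt, min_eq_right h]

lemma expect_sgn_rowSign_mul_sum {n m : ℕ} {i : Fin n} (hm : m ≤ i) :
    𝔼 r : Fin n → ℤˣ, sgn (rowSign m i r) * ∑ j with j < i, sgn (r j) = absWalk m := by
  have h1 : ∑ j with j < i, signCorr n m i j = ∑ j : Fin n with j.val < m, signCorr n m i j := by
    symm
    refine Finset.sum_subset (fun j hj => ?_) fun j hj hj' => ?_
    · rw [Finset.mem_filter] at hj ⊢
      exact ⟨hj.1, Fin.lt_def.mpr (hj.2.trans_le hm)⟩
    · rw [Finset.mem_filter] at hj hj'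
      exact signCorr_eq_zero (by simpa using hj') hj.2.ne
  have h2 : 𝔼 r : Fin n → ℤˣ, sgn (rowSign m i r) * ∑ j with j < i, sgn (r j)
      = ∑ j with j < i, signCorr n m i j := by
    simp_rw [Finset.mul_sum]
    rw [Finset.expect_sum_comm]
    rfl
  have h3 : ∑ j : Fin n with j.val < m, signCorr n m i j
      = 𝔼 r : Fin n → ℤˣ, |(rowSum m r : ℝ)| := by
    simp only [signCorr]
    rw [← Finset.expect_sum_comm]
    refine Finset.expect_congr rfl fun r _ => ?_
    rw [← sgn_rowSign_mul_rowSum m i, rowSum, ← Finset.mul_sum]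
    push_cast
    rfl
  have h4 := expect_walk (Finset.univ.filter fun j : Fin n => j.val < m)
    (fun y : ℤ => |(y : ℝ)|) 0
  rw [card_filter_val_lt (hm.trans i.isLt.le)] at h4
  rw [h2, h1, h3, absWalk, ← h4]
  refine Finset.expect_congr rfl fun r _ => ?_
  rw [zero_add, rowSum]

/-- Bessel's inequality for the majority sign. -/
lemma sum_signCorr_sq_le (n m : ℕ) (i : Fin n) : ∑ j, signCorr n m i j ^ 2 ≤ 1 := by
  have h := expect_sq_nonneg fun r : Fin n → ℤˣ =>
    sgn (rowSign m i r) - ∑ j, signCorr n m i j * sgn (r j)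
  have h1 : 𝔼 r : Fin n → ℤˣ, (∑ j, signCorr n m i j * sgn (r j)) ^ 2
      = ∑ j, signCorr n m i j ^ 2 := by
    rw [expect_sq_sum_eq Finset.univ (fun j (r : Fin n → ℤˣ) => signCorr n m i j * sgn (r j))]
    · simp_rw [mul_pow, sgn_sq, mul_one, Finset.expect_const Finset.univ_nonempty]
    · intro j _ k _ hjk
      simp_rw [mul_mul_mul_comm _ (sgn _), ← Finset.mul_expect, expect_sgn_mul_sgn hjk, mul_zero]
  have h2 : 𝔼 r : Fin n → ℤˣ, sgn (rowSign m i r) * ∑ j, signCorr n m i j * sgn (r j)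
      = ∑ j, signCorr n m i j ^ 2 := by
    simp_rw [Finset.mul_sum]
    rw [Finset.expect_sum_comm]
    refine Finset.sum_congr rfl fun j _ => ?_
    simp_rw [mul_left_comm _ (signCorr n m i j), ← Finset.mul_expect]
    rw [sq]; rfl
  simp_rw [sub_sq, sgn_sq, mul_assoc (2 : ℝ)] at h
  rw [Finset.expect_add_distrib, Finset.expect_sub_distrib, ← Finset.mul_expect, h1, h2,
    Finset.expect_const Finset.univ_nonempty] at h
  linarith

/-! #### Sums over pairs -/

/-- The sign attached to the vertex `i`: the majority sign of row `i`. -/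
def vSign {n : ℕ} (m : ℕ → ℕ) (w : Cube n) (i : Fin n) : ℤˣ := rowSign (m i) i (w i)

lemma vSign_onRow_of_ne {n : ℕ} {m : ℕ → ℕ} {i k : Fin n} (h : k ≠ i)
    (e : (Fin n → ℤˣ) ≃ (Fin n → ℤˣ)) (w : Cube n) : vSign m (onRow i e w) k = vSign m w k := by
  rw [vSign, vSign, onRow_of_ne h]

/-- The signs of the vertices only depend on the lower triangle of the matrix. -/
lemma vSign_flip_upper {n : ℕ} {m : ℕ → ℕ} (hm : ∀ i, m i ≤ i) {i j : Fin n} (h : j < i)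
    (w : Cube n) (k : Fin n) : vSign m (onRow j (flipAt i) w) k = vSign m w k := by
  by_cases hk : k = j
  · subst hk
    rw [vSign, vSign, onRow_same]
    exact rowSign_congr (hm _) fun l hl => flipAt_of_ne (hl.trans_lt h).ne _
  · exact vSign_onRow_of_ne hk _ w

/-- The pairs `(i, j)` with `j < i`. -/
def lowPairs (n : ℕ) : Finset (Fin n × Fin n) := Finset.univ.filter fun p => p.2 < p.1

lemma mem_lowPairs {n : ℕ} {p : Fin n × Fin n} : p ∈ lowPairs n ↔ p.2 < p.1 := by
  simp [lowPairs]

lemma card_lowPairs_le (n : ℕ) : ((lowPairs n).card : ℝ) ≤ (n : ℝ) ^ 2 := by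
  have : (lowPairs n).card ≤ n ^ 2 := by
    refine (Finset.card_filter_le _ _).trans (le_of_eq ?_)
    simp [sq]
  exact_mod_cast this

lemma sum_lowPairs {n : ℕ} (F : Fin n → Fin n → ℝ) :
    ∑ p ∈ lowPairs n, F p.1 p.2 = ∑ i, ∑ j with j < i, F i j := by
  simp_rw [lowPairs, Finset.sum_filter]
  rw [← Finset.univ_product_univ, Finset.sum_product]

lemma expect_sq_sum_lowPairs_le {n : ℕ} (X : Fin n × Fin n → Cube n → ℝ)
    (hb : ∀ p ∈ lowPairs n, ∀ w, |X p w| ≤ 1)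
    (h : ∀ p ∈ lowPairs n, ∀ q ∈ lowPairs n, p ≠ q → 𝔼 w, X p w * X q w = 0) :
    𝔼 w, (∑ p ∈ lowPairs n, X p w) ^ 2 ≤ (n : ℝ) ^ 2 := by
  rw [expect_sq_sum_eq _ X h]
  refine le_trans (Finset.sum_le_sum fun p hp => Finset.expect_le Finset.univ_nonempty
    fun w _ => (sq_le_one_iff_abs_le_one _).mpr (hb p hp w)) ?_
  rw [Finset.sum_const, nsmul_eq_mul, mul_one]
  exact card_lowPairs_le n

/-- The entries above the diagonal are independent of the signs of the vertices. -/
lemma expect_sq_upper_le {n : ℕ} {m : ℕ → ℕ} (hm : ∀ i, m i ≤ i) (f : ℤˣ → ℤˣ → ℝ)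
    (hf : ∀ u v, |f u v| ≤ 1) :
    𝔼 w : Cube n, (∑ p ∈ lowPairs n, sgn (w p.2 p.1) * f (vSign m w p.1) (vSign m w p.2)) ^ 2
      ≤ (n : ℝ) ^ 2 := by
  refine expect_sq_sum_lowPairs_le
    (fun p w => sgn (w p.2 p.1) * f (vSign m w p.1) (vSign m w p.2)) (fun p _ w => ?_)
    fun p hp q hq hpq => ?_
  · rw [abs_mul, abs_sgn, one_mul]; exact hf _ _
  · refine expect_eq_zero_of_equiv (onRow p.2 (flipAt p.1)) fun w => ?_
    simp only [vSign_flip_upper hm (mem_lowPairs.mp hp)]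
    have h1 : onRow p.2 (flipAt p.1) w p.2 p.1 = -w p.2 p.1 := by rw [onRow_same, flipAt_same]
    have h2 : onRow p.2 (flipAt p.1) w q.2 q.1 = w q.2 q.1 := by
      by_cases h : q.2 = p.2
      · rw [h, onRow_same, flipAt_of_ne fun h' => hpq (Prod.ext h'.symm h.symm)]
      · rw [onRow_of_ne h]
    rw [h1, h2, sgn_neg]
    ring

/-- An entry of row `i` below the diagonal is independent of the signs of the vertices `j < i`. -/
lemma expect_sq_lower_le {n : ℕ} (m : ℕ → ℕ) (f : ℤˣ → ℝ) (hf : ∀ u, |f u| ≤ 1) :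
    𝔼 w : Cube n, (∑ p ∈ lowPairs n, sgn (w p.1 p.2) * f (vSign m w p.2)) ^ 2
      ≤ (n : ℝ) ^ 2 := by
  have key : ∀ p ∈ lowPairs n, ∀ q ∈ lowPairs n, p ≠ q → q.1 ≤ p.1 →
      𝔼 w : Cube n, sgn (w p.1 p.2) * f (vSign m w p.2) * (sgn (w q.1 q.2) * f (vSign m w q.2))
        = 0 := by
    intro p hp q hq hpq hle
    have hp' := mem_lowPairs.mp hp
    have hq' := mem_lowPairs.mp hq
    refine expect_eq_zero_of_equiv (onRow p.1 (flipAt p.2)) fun w => ?_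
    have h2 : onRow p.1 (flipAt p.2) w q.1 q.2 = w q.1 q.2 := by
      by_cases h : q.1 = p.1
      · rw [h, onRow_same, flipAt_of_ne fun h' => hpq (Prod.ext h.symm h'.symm)]
      · rw [onRow_of_ne h]
    rw [vSign_onRow_of_ne hp'.ne, vSign_onRow_of_ne (hq'.trans_le hle).ne, h2, onRow_same,
      flipAt_same, sgn_neg]
    ring
  refine expect_sq_sum_lowPairs_le (fun p w => sgn (w p.1 p.2) * f (vSign m w p.2))
    (fun p _ w => ?_) fun p hp q hq hpq => ?_
  · rw [abs_mul, abs_sgn, one_mul]; exact hf _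
  · rcases le_total q.1 p.1 with h | h
    · exact key p hp q hq hpq h
    · exact (Finset.expect_congr rfl fun w _ => mul_comm _ _).trans (key q hq p hp hpq.symm h)

/-- The sum of the entries below the diagonal, weighted by the sign of their row, is close to its
expectation. -/
lemma expect_sq_sign_mul_lower_sub_le {n : ℕ} {m : ℕ → ℕ} (hm : ∀ i, m i ≤ i) :
    𝔼 w : Cube n, (∑ p ∈ lowPairs n, sgn (w p.1 p.2) * sgn (vSign m w p.1)
      - ∑ i : Fin n, absWalk (m i)) ^ 2 ≤ (n : ℝ) ^ 2 := by
  set Y : Fin n → (Fin n → ℤˣ) → ℝ := fun i r =>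
    sgn (rowSign (m i) i r) * ∑ j with j < i, sgn (r j) with hY
  have hYm (i : Fin n) : 𝔼 r, Y i r = absWalk (m i) := expect_sgn_rowSign_mul_sum (hm i)
  have h1 (w : Cube n) : ∑ p ∈ lowPairs n, sgn (w p.1 p.2) * sgn (vSign m w p.1)
      - ∑ i : Fin n, absWalk (m i) = ∑ i, (Y i (w i) - absWalk (m i)) := by
    rw [sum_lowPairs fun i j => sgn (w i j) * sgn (vSign m w i), Finset.sum_sub_distrib]
    congr 1
    refine Finset.sum_congr rfl fun i _ => ?_
    rw [hY]
    simp only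
    rw [Finset.mul_sum]
    exact Finset.sum_congr rfl fun j _ => mul_comm _ _
  simp_rw [h1]
  rw [expect_sq_sum_eq Finset.univ fun i (w : Cube n) => Y i (w i) - absWalk (m i)]
  · have h2 (i : Fin n) : 𝔼 w : Cube n, (Y i (w i) - absWalk (m i)) ^ 2 ≤ n := by
      rw [expect_row i fun r => (Y i r - absWalk (m i)) ^ 2]
      have h3 : 𝔼 r, Y i r ^ 2 ≤ n := by
        simp_rw [hY, mul_pow, sgn_sq, one_mul]
        rw [expect_sq_sum_sgn]
        exact_mod_cast (Finset.card_filter_le _ _).trans (by simp)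
      simp_rw [sub_sq]
      rw [Finset.expect_add_distrib, Finset.expect_sub_distrib, ← Finset.expect_mul,
        ← Finset.mul_expect, hYm, Finset.expect_const Finset.univ_nonempty]
      nlinarith [sq_nonneg (absWalk (m i))]
    refine (Finset.sum_le_sum fun i _ => h2 i).trans (le_of_eq ?_)
    simp [sq]
  · intro i _ k _ hik
    rw [expect_row_mul_row hik (fun r => Y i r - absWalk (m i)) fun r => Y k r - absWalk (m k)]
    rw [Finset.expect_sub_distrib, hYm, Finset.expect_const Finset.univ_nonempty, sub_self,
      zero_mul]

/-- The sum of the entries below the diagonal, weighted by the signs of both of their indices, is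
negligible: the column sums are orthogonal, because the sign of the column is independent of the
rows below it, and their size is controlled by Bessel's inequality. -/
lemma expect_sq_sign_mul_sign_mul_lower_le {n : ℕ} (m : ℕ → ℕ) :
    𝔼 w : Cube n, (∑ p ∈ lowPairs n,
      sgn (w p.1 p.2) * (sgn (vSign m w p.1) * sgn (vSign m w p.2))) ^ 2 ≤ 2 * (n : ℝ) ^ 2 := by
  set y : Fin n → Fin n → (Fin n → ℤˣ) → ℝ := fun i j r => sgn (rowSign (m i) i r) * sgn (r j)
    with hy
  set G : Fin n → Cube n → ℝ := fun j w => ∑ i with j < i, y i j (w i) with hG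
  have h1 (w : Cube n) : ∑ p ∈ lowPairs n,
      sgn (w p.1 p.2) * (sgn (vSign m w p.1) * sgn (vSign m w p.2))
      = ∑ j, sgn (vSign m w j) * G j w := by
    rw [sum_lowPairs fun i j => sgn (w i j) * (sgn (vSign m w i) * sgn (vSign m w j))]
    simp_rw [hG, Finset.mul_sum, Finset.sum_filter]
    rw [Finset.sum_comm]
    refine Finset.sum_congr rfl fun j _ => Finset.sum_congr rfl fun i _ => ?_
    split_ifs
    · simp only [hy, vSign]; ring
    · rfl
  have key : ∀ j k : Fin n, j < k →
      𝔼 w : Cube n, sgn (vSign m w j) * G j w * (sgn (vSign m w k) * G k w) = 0 := by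
    intro j k hjk
    refine expect_eq_zero_of_equiv (onRow j (Equiv.neg _)) fun w => ?_
    have hGl (l : Fin n) (hl : j ≤ l) : G l (onRow j (Equiv.neg _) w) = G l w := by
      refine Finset.sum_congr rfl fun i hi => ?_
      rw [Finset.mem_filter] at hi
      rw [onRow_of_ne (hl.trans_lt hi.2).ne']
    have hs : vSign m (onRow j (Equiv.neg _) w) j = -vSign m w j := by
      rw [vSign, vSign, onRow_same, Equiv.neg_apply, rowSign_neg]
    rw [hGl j le_rfl, hGl k hjk.le, hs, vSign_onRow_of_ne hjk.ne', sgn_neg]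
    ring
  have hGsq (j : Fin n) : 𝔼 w : Cube n, G j w ^ 2
      ≤ ∑ i : Fin n, ∑ k : Fin n, ((if i = k then 1 else 0)
        + (signCorr n (m i) i j ^ 2 + signCorr n (m k) k j ^ 2) / 2) := by
    have e : 𝔼 w : Cube n, G j w ^ 2
        = ∑ i with j < i, ∑ k with j < k, 𝔼 w : Cube n, y i j (w i) * y k j (w k) := by
      simp_rw [hG, sq, Finset.sum_mul_sum]
      rw [Finset.expect_sum_comm]
      refine Finset.sum_congr rfl fun i _ => ?_
      rw [Finset.expect_sum_comm]
    have hb (i k : Fin n) : 𝔼 w : Cube n, y i j (w i) * y k j (w k) ≤ (if i = k then 1 else 0)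
        + (signCorr n (m i) i j ^ 2 + signCorr n (m k) k j ^ 2) / 2 := by
      split_ifs with hik
      · subst hik
        have : ∀ w : Cube n, y i j (w i) * y i j (w i) = 1 := fun w => by
          simp only [hy]
          rw [mul_mul_mul_comm, sgn_mul_self, sgn_mul_self, mul_one]
        simp_rw [this]
        rw [Finset.expect_const Finset.univ_nonempty]
        nlinarith [sq_nonneg (signCorr n (m i) i j)]
      · rw [expect_row_mul_row hik]
        change signCorr n (m i) i j * signCorr n (m k) k j ≤ _
        nlinarith [sq_nonneg (signCorr n (m i) i j - signCorr n (m k) k j)]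
    have h0 (i k : Fin n) : 0 ≤ (if i = k then (1 : ℝ) else 0)
        + (signCorr n (m i) i j ^ 2 + signCorr n (m k) k j ^ 2) / 2 := by
      split_ifs <;> positivity
    rw [e]
    refine (Finset.sum_le_sum fun i _ => (Finset.sum_le_sum fun k _ => hb i k).trans
      (Finset.sum_le_sum_of_subset_of_nonneg (Finset.filter_subset _ _) fun k _ _ => h0 i k)).trans
      (Finset.sum_le_sum_of_subset_of_nonneg (Finset.filter_subset _ _) fun i _ _ =>
        Finset.sum_nonneg fun k _ => h0 i k)
  simp_rw [h1]
  rw [expect_sq_sum_eq Finset.univ fun j (w : Cube n) => sgn (vSign m w j) * G j w]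
  · simp_rw [mul_pow, sgn_sq, one_mul]
    refine (Finset.sum_le_sum fun j _ => hGsq j).trans ?_
    have hB : ∑ j : Fin n, ∑ i : Fin n, signCorr n (m i) i j ^ 2 ≤ n := by
      rw [Finset.sum_comm]
      refine (Finset.sum_le_sum fun (i : Fin n) _ =>
        sum_signCorr_sq_le n (m i) i).trans (le_of_eq ?_)
      simp
    have e (j : Fin n) : ∑ i : Fin n, ∑ k : Fin n, ((if i = k then (1 : ℝ) else 0)
        + (signCorr n (m i) i j ^ 2 + signCorr n (m k) k j ^ 2) / 2)
        = n + n * ∑ i : Fin n, signCorr n (m i) i j ^ 2 := by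
      simp_rw [Finset.sum_add_distrib, ← Finset.sum_div, Finset.sum_add_distrib]
      simp
      rw [← Finset.mul_sum]
      ring
    simp_rw [e, Finset.sum_add_distrib, ← Finset.mul_sum]
    have hn : (0 : ℝ) ≤ n := by positivity
    have := mul_le_mul_of_nonneg_left hB hn
    simp only [Finset.sum_const, Finset.card_univ, Fintype.card_fin, nsmul_eq_mul]
    nlinarith
  · intro j _ k _ hjk
    rcases lt_or_gt_of_ne hjk with h | h
    · exact key j k h
    · exact (Finset.expect_congr rfl fun w _ => mul_comm _ _).trans (key k j h)

/-! ### Realising the signs as functions of the graph -/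

instance : MeasurableSingletonClass ℤˣ :=
  ⟨fun u => ⟨{(u : ℤ)}, measurableSet_singleton _, by ext v; simp [Units.ext_iff]⟩⟩

/-- The restriction of a matrix to the positions in `D`. -/
def restrictTo {n : ℕ} (D : Fin n × Fin n → Prop) (w : Cube n) (q : {q // D q}) : ℤˣ :=
  w q.1.1 q.1.2

open Classical in
/-- The extension by `1` of a matrix given on the positions in `D`. -/
def extendOne {n : ℕ} (D : Fin n × Fin n → Prop) (c : {q // D q} → ℤˣ) : Cube n :=
  fun i j => if h : D (i, j) then c ⟨(i, j), h⟩ else 1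

lemma restrictTo_extendOne {n : ℕ} (D : Fin n × Fin n → Prop) (c : {q // D q} → ℤˣ) :
    restrictTo D (extendOne D c) = c := by
  funext q
  exact dif_pos q.2

lemma expect_restrictTo {n : ℕ} (D : Fin n × Fin n → Prop) [Fintype {q // D q}]
    (F : ({q // D q} → ℤˣ) → ℝ) : 𝔼 w : Cube n, F (restrictTo D w) = 𝔼 c, F c := by
  classical
  have e := expect_comp_equiv ((Equiv.curry (Fin n) (Fin n) ℤˣ).symm.trans
    (Equiv.piEquivPiSubtypeProd D fun _ => ℤˣ)) fun c => F c.1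
  refine Eq.trans e ?_
  rw [← Finset.univ_product_univ, Finset.expect_product]
  exact Finset.expect_congr rfl fun c _ => Finset.expect_const Finset.univ_nonempty (F c)

/-- Let `w ↦ (E w, V w)` send a matrix `w` of signs to a graph `E w` and a vector of signs `V w`,
both of them depending only on the entries of `w` in `D`, and let `E` be injective on these
entries. Then `E` permutes the matrices on `D`, so that a random graph `ε` with uniform entries on
`D` is `E w` for a uniform matrix `w` which is a function of `ε`, and `V w` is a choice of signs
as a function of the graph. -/
lemma exists_signs {Ω : Type*} [MeasurableSpace Ω] {P : Measure Ω} [IsProbabilityMeasure P] {n : ℕ}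
    (D : Fin n × Fin n → Prop) [Fintype {q // D q}] (E : Cube n → Cube n)
    (V : Cube n → Fin n → ℤˣ)
    (hinj : ∀ w w', restrictTo D (E w) = restrictTo D (E w') → restrictTo D w = restrictTo D w')
    (hdep : ∀ w w', restrictTo D w = restrictTo D w' → E w = E w' ∧ V w = V w')
    {ε : Ω → Cube n} (hε : Measurable ε)
    (hext : ∀ ω w, restrictTo D (E w) = restrictTo D (ε ω) → E w = ε ω)
    (huni : ∀ c, P.real {ω | restrictTo D (ε ω) = c} = (1 / 2) ^ Fintype.card {q // D q}) :
    ∃ σ : Fin n → Ω → ℤˣ, (∀ i, Measurable (σ i)) ∧ ∀ H : Cube n → (Fin n → ℤˣ) → ℝ,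
      ∫ ω, H (ε ω) (fun i => σ i ω) ∂P = 𝔼 w, H (E w) (V w) := by
  set Ψ : ({q // D q} → ℤˣ) → {q // D q} → ℤˣ := fun c => restrictTo D (E (extendOne D c))
  have hΨ : Function.Injective Ψ := fun c c' h => by
    have := hinj _ _ h
    rwa [restrictTo_extendOne, restrictTo_extendOne] at this
  set e : ({q // D q} → ℤˣ) ≃ ({q // D q} → ℤˣ) :=
    Equiv.ofBijective Ψ (Finite.injective_iff_bijective.mp hΨ) with he
  set r : Ω → {q // D q} → ℤˣ := fun ω => restrictTo D (ε ω) with hr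
  have hrm : Measurable r := (measurable_of_countable (restrictTo D)).comp hε
  refine ⟨fun i ω => V (extendOne D (e.symm (r ω))) i, fun i =>
    (measurable_of_countable fun c => V (extendOne D (e.symm c)) i).comp hrm, fun H => ?_⟩
  have hE (ω : Ω) : ε ω = E (extendOne D (e.symm (r ω))) :=
    (hext ω _ (e.apply_symm_apply (r ω))).symm
  set F : ({q // D q} → ℤˣ) → ℝ := fun c => H (E (extendOne D c)) (V (extendOne D c)) with hF
  have h1 : ∫ ω, H (ε ω) (fun i => V (extendOne D (e.symm (r ω))) i) ∂P
      = ∫ c, F (e.symm c) ∂(P.map r) := by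
    rw [integral_map hrm.aemeasurable (measurable_of_countable _).aestronglyMeasurable]
    refine integral_congr_ae (Eventually.of_forall fun ω => ?_)
    simp only [hF]
    rw [← hE ω]
  have : IsProbabilityMeasure (P.map r) := Measure.isProbabilityMeasure_map hrm.aemeasurable
  rw [h1, integral_fintype Integrable.of_finite]
  have h2 (c : {q // D q} → ℤˣ) :
      (P.map r).real {c} = (1 / 2) ^ Fintype.card {q // D q} := by
    rw [map_measureReal_apply hrm (measurableSet_singleton c)]
    exact huni c
  have h3 : ∑ c, (P.map r).real {c} • F (e.symm c) = 𝔼 c, F (e.symm c) := by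
    simp_rw [h2, smul_eq_mul]
    rw [← Finset.mul_sum, Fintype.expect_eq_sum_div_card]
    classical
    have h4 : (Fintype.card ({q // D q} → ℤˣ) : ℝ) = 2 ^ Fintype.card {q // D q} := by
      rw [Fintype.card_pi]
      simp
    rw [h4, one_div, inv_pow, div_eq_inv_mul]
  rw [h3, expect_comp_equiv e.symm F, ← expect_restrictTo D]
  refine Finset.expect_congr rfl fun w _ => ?_
  have := hdep (extendOne D (restrictTo D w)) w (restrictTo_extendOne D _)
  simp only [hF, this.1, this.2]

/-- The entry `ξ ∈ {0, 1}` of the adjacency matrix as a sign. -/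
def edgeSign (x : ℝ) : ℤˣ := if x = 1 then 1 else -1

lemma sgn_edgeSign {x : ℝ} (h : x = 0 ∨ x = 1) : sgn (edgeSign x) = x / (1 / 2) - 1 := by
  rcases h with rfl | rfl <;> norm_num [edgeSign, sgn]

lemma measurable_edgeSign : Measurable edgeSign :=
  Measurable.ite (measurableSet_singleton 1) measurable_const measurable_const

lemma measureReal_forall_edgeSign_eq {Ω ι : Type*} [MeasurableSpace Ω] {P : Measure Ω}
    [IsProbabilityMeasure P] [Fintype ι] {ξ : ι → Ω → ℝ} (hm : ∀ q, Measurable (ξ q))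
    (hlaw : ∀ q, P {ω | ξ q ω = 1} = ENNReal.ofReal (1 / 2)) (hind : iIndepFun ξ P)
    (c : ι → ℤˣ) : P.real {ω | ∀ q, edgeSign (ξ q ω) = c q} = (1 / 2) ^ Fintype.card ι := by
  have h1 : {ω | ∀ q, edgeSign (ξ q ω) = c q}
      = ⋂ q ∈ Finset.univ, ξ q ⁻¹' (edgeSign ⁻¹' {c q}) := by
    ext ω; simp
  have hp (q : ι) : P.real (ξ q ⁻¹' {1}) = 1 / 2 := by
    rw [measureReal_def]
    change (P {ω | ξ q ω = 1}).toReal = _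
    rw [hlaw q, ENNReal.toReal_ofReal (by norm_num)]
  have h2 (q : ι) : P.real (ξ q ⁻¹' (edgeSign ⁻¹' {c q})) = 1 / 2 := by
    rcases Int.units_eq_one_or (c q) with h | h
    · rw [h, ← hp q]
      congr 2
      ext x
      by_cases hx : x = 1 <;> simp [edgeSign, hx]
    · have : edgeSign ⁻¹' {c q} = {1}ᶜ := by
        rw [h]
        ext x
        by_cases hx : x = 1 <;> simp [edgeSign, hx]
      rw [this, preimage_compl, probReal_compl_eq_one_sub (hm q (measurableSet_singleton 1)), hp]
      norm_num
  rw [h1, measureReal_def, hind.measure_inter_preimage_eq_mul Finset.univ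
    (sets := fun q => edgeSign ⁻¹' {c q})
    fun q _ => measurable_edgeSign (measurableSet_singleton _), ENNReal.toReal_prod]
  simp_rw [← measureReal_def, h2]
  simp

/-! ### Asymptotics of the block sums -/

/-- Families of functions on the sign matrices with second moment `O(n²)`. -/
def QuadBounded (X : (n : ℕ) → Cube n → ℝ) : Prop :=
  ∃ C : ℝ, ∀ n, 𝔼 w, X n w ^ 2 ≤ C * (n : ℝ) ^ 2

namespace QuadBounded

variable {X Y : (n : ℕ) → Cube n → ℝ}

lemma add (hX : QuadBounded X) (hY : QuadBounded Y) :
    QuadBounded fun n w => X n w + Y n w := by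
  obtain ⟨C, hC⟩ := hX
  obtain ⟨C', hC'⟩ := hY
  refine ⟨2 * (C + C'), fun n => ?_⟩
  have h : 𝔼 w, (X n w + Y n w) ^ 2 ≤ 𝔼 w, (2 * X n w ^ 2 + 2 * Y n w ^ 2) :=
    Finset.expect_le_expect fun w _ => by nlinarith [sq_nonneg (X n w - Y n w)]
  rw [Finset.expect_add_distrib, ← Finset.mul_expect, ← Finset.mul_expect] at h
  linarith [hC n, hC' n]

lemma const_mul (hX : QuadBounded X) (c : ℝ) : QuadBounded fun n w => c * X n w := by
  obtain ⟨C, hC⟩ := hX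
  refine ⟨c ^ 2 * C, fun n => ?_⟩
  simp_rw [mul_pow, ← Finset.mul_expect]
  rw [mul_assoc]
  exact mul_le_mul_of_nonneg_left (hC n) (sq_nonneg c)

lemma of_abs_le (h : ∀ n w, |X n w| ≤ n) : QuadBounded X := by
  refine ⟨1, fun n => Finset.expect_le Finset.univ_nonempty fun w _ => ?_⟩
  rw [one_mul]
  exact sq_le_sq.mpr (by rw [Nat.abs_cast]; exact h n w)

/-- An error `O(n)` in `L²` is negligible after multiplication by `n^{-3/2}`. -/
lemma tendsto_expect_sq {A : ℕ → ℝ} {d : ℝ} (h : QuadBounded fun n w => X n w - A n)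
    (hA : Tendsto (fun n : ℕ => √n / (n : ℝ) ^ 2 * A n) atTop (𝓝 d)) :
    Tendsto (fun n : ℕ => 𝔼 w, (√n / (n : ℝ) ^ 2 * X n w - d) ^ 2) atTop (𝓝 0) := by
  obtain ⟨C, hC⟩ := h
  have h1 : Tendsto (fun n : ℕ => 2 * C * (1 / (n : ℝ)) + 2 * (√n / (n : ℝ) ^ 2 * A n - d) ^ 2)
      atTop (𝓝 0) := by
    simpa using (tendsto_one_div_atTop_nhds_zero_nat (𝕜 := ℝ)).const_mul (2 * C) |>.add
      (((hA.sub_const d).pow 2).const_mul 2)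
  refine squeeze_zero' (Eventually.of_forall fun n => expect_sq_nonneg _) ?_ h1
  filter_upwards [eventually_gt_atTop 0] with n hn
  have hn' : (0 : ℝ) < n := by exact_mod_cast hn
  have hs : (√n / (n : ℝ) ^ 2) ^ 2 = 1 / (n : ℝ) ^ 3 := by
    rw [div_pow, Real.sq_sqrt hn'.le]
    field_simp
  have h2 : 𝔼 w, (√n / (n : ℝ) ^ 2 * X n w - d) ^ 2
      ≤ 𝔼 w, (2 * (√n / (n : ℝ) ^ 2) ^ 2 * (X n w - A n) ^ 2
        + 2 * (√n / (n : ℝ) ^ 2 * A n - d) ^ 2) :=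
    Finset.expect_le_expect fun w _ => by
      nlinarith [sq_nonneg (√n / (n : ℝ) ^ 2 * (X n w - A n) - (√n / (n : ℝ) ^ 2 * A n - d))]
  refine h2.trans ?_
  rw [Finset.expect_add_distrib, ← Finset.mul_expect, Finset.expect_const Finset.univ_nonempty, hs]
  have h3 := mul_le_mul_of_nonneg_left (hC n) (show 0 ≤ 2 * (1 / (n : ℝ) ^ 3) by positivity)
  have h4 : 2 * (1 / (n : ℝ) ^ 3) * (C * (n : ℝ) ^ 2) = 2 * C * (1 / (n : ℝ)) := by field_simp
  linarith

end QuadBounded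

/-- The coefficient of `u` in the expansion of `f (u, v)` in `1`, `u`, `v` and `uv`. -/
def lowerCoeff (f : ℤˣ → ℤˣ → ℝ) : ℝ := (f 1 1 + f 1 (-1) - f (-1) 1 - f (-1) (-1)) / 4

/-- Among the functions `1`, `u`, `v` and `uv` of the signs of a pair, only the sign `u` of the row
correlates with the entries below the diagonal. -/
lemma quadBounded_lower {m : ℕ → ℕ} (hm : ∀ i, m i ≤ i) (f : ℤˣ → ℤˣ → ℝ) :
    QuadBounded fun n w => ∑ p ∈ lowPairs n, sgn (w p.1 p.2) * f (vSign m w p.1) (vSign m w p.2)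
      - lowerCoeff f * ∑ i : Fin n, absWalk (m i) := by
  have h1 : QuadBounded fun n w => ∑ p ∈ lowPairs n, sgn (w p.1 p.2) * 1 :=
    ⟨1, fun n => by rw [one_mul]; exact expect_sq_lower_le m (fun _ => 1) (by simp)⟩
  have h2 : QuadBounded fun n w => ∑ p ∈ lowPairs n, sgn (w p.1 p.2) * sgn (vSign m w p.2) :=
    ⟨1, fun n => by rw [one_mul]; exact expect_sq_lower_le m sgn fun u => (abs_sgn u).le⟩
  have h3 : QuadBounded fun n w => ∑ p ∈ lowPairs n, sgn (w p.1 p.2) * sgn (vSign m w p.1)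
      - ∑ i : Fin n, absWalk (m i) :=
    ⟨1, fun n => by rw [one_mul]; exact expect_sq_sign_mul_lower_sub_le hm⟩
  have h4 : QuadBounded fun n w => ∑ p ∈ lowPairs n,
      sgn (w p.1 p.2) * (sgn (vSign m w p.1) * sgn (vSign m w p.2)) :=
    ⟨2, fun n => expect_sq_sign_mul_sign_mul_lower_le m⟩
  have hf (u v : ℤˣ) : f u v = (f 1 1 + f 1 (-1) + f (-1) 1 + f (-1) (-1)) / 4
      + (f 1 1 - f 1 (-1) + f (-1) 1 - f (-1) (-1)) / 4 * sgn v + lowerCoeff f * sgn u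
      + (f 1 1 - f 1 (-1) - f (-1) 1 + f (-1) (-1)) / 4 * (sgn u * sgn v) := by
    rcases Int.units_eq_one_or u with rfl | rfl <;> rcases Int.units_eq_one_or v with rfl | rfl <;>
      simp only [sgn_neg, sgn_one, lowerCoeff] <;> ring
  convert (((h1.const_mul ((f 1 1 + f 1 (-1) + f (-1) 1 + f (-1) (-1)) / 4)).add
    (h2.const_mul ((f 1 1 - f 1 (-1) + f (-1) 1 - f (-1) (-1)) / 4))).add
    (h3.const_mul (lowerCoeff f))).add
    (h4.const_mul ((f 1 1 - f 1 (-1) - f (-1) 1 + f (-1) (-1)) / 4)) using 3 with n w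
  rw [mul_sub, ← add_sub_assoc, sub_add_eq_add_sub]
  congr 1
  simp only [Finset.mul_sum, ← Finset.sum_add_distrib]
  refine Finset.sum_congr rfl fun p _ => ?_
  rw [hf]
  ring

/-- The indicator of the sign `a`. -/
def ind (a u : ℤˣ) : ℝ := if u = a then 1 else 0

lemma abs_ind_mul_ind_le (a b u v : ℤˣ) : |ind a u * ind b v| ≤ 1 := by
  simp only [ind]
  split_ifs <;> simp

/-- The sum of the entries of `E` in the block of the rows of sign `a` and of the columns of
sign `b`. -/
def blockSum {n : ℕ} (E : Cube n) (σ : Fin n → ℤˣ) (a b : ℤˣ) : ℝ :=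
  ∑ i, ∑ j, sgn (E i j) * (ind a (σ i) * ind b (σ j))

lemma sum_eq_sum_lowPairs {n : ℕ} (F : Fin n → Fin n → ℝ) :
    ∑ i, ∑ j, F i j = ∑ p ∈ lowPairs n, (F p.1 p.2 + F p.2 p.1) + ∑ i, F i i := by
  rw [Finset.sum_add_distrib, sum_lowPairs, sum_lowPairs fun i j => F j i]
  simp_rw [Finset.sum_filter]
  rw [Finset.sum_comm (f := fun i j : Fin n => if j < i then F j i else 0),
    ← Finset.sum_add_distrib, ← Finset.sum_add_distrib]
  refine Finset.sum_congr rfl fun i _ => ?_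
  have h : F i i = ∑ j, if i = j then F i j else 0 := by simp
  rw [h, ← Finset.sum_add_distrib, ← Finset.sum_add_distrib]
  refine Finset.sum_congr rfl fun j _ => ?_
  rcases lt_trichotomy i j with h | h | h
  · simp [h, h.not_gt, h.ne]
  · simp [h]
  · simp [h, h.not_gt, h.ne']

/-- If the entries `(i, j)` and `(j, i)`, `j < i`, of the graph contribute
`w i j F (σ i, σ j) + w j i G (σ i, σ j)` to the block sum, then only the first part has a
macroscopic contribution. -/
lemma quadBounded_blockSum {m : ℕ → ℕ} (hm : ∀ i, m i ≤ i) (E : (n : ℕ) → Cube n → Cube n)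
    {a b : ℤˣ} {F G : ℤˣ → ℤˣ → ℝ} (hG : ∀ u v, |G u v| ≤ 1)
    (hE : ∀ n w, ∀ i j : Fin n, j < i →
      sgn (E n w i j) * (ind a (vSign m w i) * ind b (vSign m w j))
        + sgn (E n w j i) * (ind a (vSign m w j) * ind b (vSign m w i))
      = sgn (w i j) * F (vSign m w i) (vSign m w j)
        + sgn (w j i) * G (vSign m w i) (vSign m w j)) :
    QuadBounded fun n w => blockSum (E n w) (vSign m w) a b
      - lowerCoeff F * ∑ i : Fin n, absWalk (m i) := by
  have h1 : QuadBounded fun n w =>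
      ∑ p ∈ lowPairs n, sgn (w p.2 p.1) * G (vSign m w p.1) (vSign m w p.2) :=
    ⟨1, fun n => by rw [one_mul]; exact expect_sq_upper_le hm G hG⟩
  have h2 : QuadBounded fun n w =>
      ∑ i, sgn (E n w i i) * (ind a (vSign m w i) * ind b (vSign m w i)) := by
    refine QuadBounded.of_abs_le fun n w => (Finset.abs_sum_le_sum_abs _ _).trans ?_
    refine (Finset.sum_le_sum fun i _ => ?_).trans (by simp : ∑ _i : Fin n, (1 : ℝ) ≤ n)
    rw [abs_mul, abs_sgn, one_mul]
    exact abs_ind_mul_ind_le _ _ _ _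
  convert ((quadBounded_lower hm F).add h1).add h2 using 3 with n w
  rw [blockSum, sum_eq_sum_lowPairs, sub_add_eq_add_sub, ← Finset.sum_add_distrib,
    sub_add_eq_add_sub]
  congr 2
  exact Finset.sum_congr rfl fun p hp => hE n w p.1 p.2 (mem_lowPairs.mp hp)

lemma tendsto_expect_sq_blockSum {m : ℕ → ℕ} (hm : ∀ i, m i ≤ i) {L : ℝ}
    (hL : Tendsto (fun i : ℕ => absWalk (m i) / √i) atTop (𝓝 L))
    (E : (n : ℕ) → Cube n → Cube n) {a b : ℤˣ} {F G : ℤˣ → ℤˣ → ℝ} (hG : ∀ u v, |G u v| ≤ 1)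
    (hE : ∀ n w, ∀ i j : Fin n, j < i →
      sgn (E n w i j) * (ind a (vSign m w i) * ind b (vSign m w j))
        + sgn (E n w j i) * (ind a (vSign m w j) * ind b (vSign m w i))
      = sgn (w i j) * F (vSign m w i) (vSign m w j)
        + sgn (w j i) * G (vSign m w i) (vSign m w j)) :
    Tendsto (fun n : ℕ => 𝔼 w, (√n / (n : ℝ) ^ 2 * blockSum (E n w) (vSign m w) a b
      - lowerCoeff F * (2 / 3 * L)) ^ 2) atTop (𝓝 0) := by
  refine (quadBounded_blockSum hm E hG hE).tendsto_expect_sq ?_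
  refine ((tendsto_sum_of_div_sqrt hL).const_mul (lowerCoeff F)).congr fun n => ?_
  rw [Finset.sum_range]
  ring

/-- The signs of the vertices are uniformly distributed. -/
lemma expect_vSign {n : ℕ} (m : ℕ → ℕ) (g : (Fin n → ℤˣ) → ℝ) :
    𝔼 w : Cube n, g (vSign m w) = 𝔼 r, g r := by
  -- Changing the sign of a row changes the sign of its vertex.
  have h (s : Fin n → ℤˣ) : 𝔼 w : Cube n, g (s * vSign m w) = 𝔼 w : Cube n, g (vSign m w) := by
    have := expect_comp_equiv (Equiv.piCongrRight fun k : Fin n =>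
      if s k = 1 then Equiv.refl (Fin n → ℤˣ) else Equiv.neg _) fun w : Cube n => g (vSign m w)
    rw [← this]
    refine Finset.expect_congr rfl fun w _ => ?_
    congr 1
    funext k
    rw [Pi.mul_apply, vSign, vSign, Equiv.piCongrRight_apply, Pi.map_apply]
    rcases Int.units_eq_one_or (s k) with hs | hs
    · simp [hs]
    · rw [hs, if_neg (by decide), Equiv.neg_apply, rowSign_neg]
      simp
  calc 𝔼 w : Cube n, g (vSign m w) = 𝔼 s : Fin n → ℤˣ, 𝔼 w : Cube n, g (s * vSign m w) := by
        simp_rw [h]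
        rw [Finset.expect_const Finset.univ_nonempty]
    _ = 𝔼 w : Cube n, 𝔼 s : Fin n → ℤˣ, g (s * vSign m w) := Finset.expect_comm _ _ _
    _ = 𝔼 _w : Cube n, 𝔼 r, g r :=
        Finset.expect_congr rfl fun w _ => expect_comp_equiv (Equiv.mulRight (vSign m w)) g
    _ = 𝔼 r, g r := Finset.expect_const Finset.univ_nonempty _

/-! ### Choice of the signs on the two kinds of graphs -/

/-- Signs `σ` of the vertices, functions of the graphs `ξ`, which are uniformly distributed but such
that the graph fluctuations of the four blocks converge to the constants `d`. -/
structure IsSignChoice {Ω : Type*} [MeasurableSpace Ω] (P : Measure Ω)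
    (ξ : (n : ℕ) → Fin n → Fin n → Ω → ℝ) (σ : (n : ℕ) → Fin n → Ω → ℤˣ) (d : ℤˣ → ℤˣ → ℝ) :
    Prop where
  measurable : ∀ n i, Measurable (σ n i)
  law : ∀ n (g : (Fin n → ℤˣ) → ℝ), ∫ ω, g (fun i => σ n i ω) ∂P = 𝔼 r, g r
  block : ∀ a b, Tendsto (fun n : ℕ => ∫ ω, (√n / (n : ℝ) ^ 2 *
    blockSum (fun i j => edgeSign (ξ n i j ω)) (fun i => σ n i ω) a b - d a b) ^ 2 ∂P) atTop (𝓝 0)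

lemma vSign_congr {n : ℕ} {m : ℕ → ℕ} (hm : ∀ i, m i ≤ i) {w w' : Cube n} {i : Fin n}
    (h : ∀ j ≤ i, w i j = w' i j) : vSign m w i = vSign m w' i :=
  rowSign_congr (hm _) h

/-- A symmetric matrix of signs: below the diagonal, the entries of column `j` are multiplied by the
opposite of the sign of `j`. -/
def symGraph {n : ℕ} (w : Cube n) : Cube n := fun i j =>
  if j < i then -vSign id w j * w i j else if i < j then -vSign id w i * w j i else w i i

lemma symGraph_of_lt {n : ℕ} (w : Cube n) {i j : Fin n} (h : j < i) :
    symGraph w i j = -vSign id w j * w i j := if_pos h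

lemma symGraph_of_gt {n : ℕ} (w : Cube n) {i j : Fin n} (h : j < i) :
    symGraph w j i = -vSign id w j * w i j := by
  rw [symGraph, if_neg h.not_gt, if_pos h]

lemma symGraph_self {n : ℕ} (w : Cube n) (i : Fin n) : symGraph w i i = w i i := by
  simp [symGraph]

lemma symGraph_injOn {n : ℕ} {w w' : Cube n}
    (h : ∀ i j, j ≤ i → symGraph w i j = symGraph w' i j) (i : Fin n) :
    ∀ j ≤ i, w i j = w' i j := by
  induction i using WellFoundedLT.induction with
  | ind i ih =>
    intro j hj
    have hij := h i j hj
    rcases hj.lt_or_eq with hlt | rfl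
    · rw [symGraph_of_lt w hlt, symGraph_of_lt w' hlt,
        vSign_congr (m := id) (fun _ => le_rfl) (ih j hlt)] at hij
      exact mul_left_cancel hij
    · rwa [symGraph_self, symGraph_self] at hij

/-- The pair `j < i` contributes `-σ j w i j` twice, so that in the block `(a, b)` the coefficient of
`σ i w i j` is `-a b / 2`. -/
lemma IsSymmetricER.exists_isSignChoice {Ω : Type*} [MeasurableSpace Ω] {P : Measure Ω}
    [IsProbabilityMeasure P] {ξ : (n : ℕ) → Fin n → Fin n → Ω → ℝ}
    (h : IsSymmetricER P (fun _ => 1 / 2) ξ) :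
    ∃ σ, IsSignChoice P ξ σ fun a b => -(sgn a * sgn b) / 2 * (2 / 3 * √(2 / π)) := by
  have key (n : ℕ) : ∃ σ : Fin n → Ω → ℤˣ, (∀ i, Measurable (σ i)) ∧
      ∀ H : Cube n → (Fin n → ℤˣ) → ℝ,
      ∫ ω, H (fun i j => edgeSign (ξ n i j ω)) (fun i => σ i ω) ∂P
        = 𝔼 w, H (symGraph w) (vSign id w) := by
    refine exists_signs (fun q : Fin n × Fin n => q.2 ≤ q.1) symGraph (vSign id)
      (fun w w' hw => ?_) (fun w w' hw => ?_) ?_ (fun ω w hw => ?_) fun c => ?_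
    · funext q
      exact symGraph_injOn (fun i j hij => congrFun hw ⟨(i, j), hij⟩) q.1.1 q.1.2 q.2
    · have hw' (i j : Fin n) (hij : j ≤ i) : w i j = w' i j := congrFun hw ⟨(i, j), hij⟩
      have hv : vSign id w = vSign id w' := by
        funext i
        exact vSign_congr (fun _ => le_rfl) (hw' i)
      refine ⟨?_, hv⟩
      funext i j
      rcases lt_trichotomy j i with hij | rfl | hij
      · rw [symGraph_of_lt _ hij, symGraph_of_lt _ hij, hv, hw' i j hij.le]
      · rw [symGraph_self, symGraph_self, hw' j j le_rfl]
      · rw [symGraph_of_gt _ hij, symGraph_of_gt _ hij, hv, hw' j i hij.le]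
    · exact measurable_pi_iff.mpr fun i => measurable_pi_iff.mpr fun j =>
        measurable_edgeSign.comp (h.measurable n i j)
    · have hw' (i j : Fin n) (hij : j ≤ i) : symGraph w i j = edgeSign (ξ n i j ω) :=
        congrFun hw ⟨(i, j), hij⟩
      funext i j
      rcases le_or_gt j i with hij | hij
      · exact hw' i j hij
      · rw [symGraph_of_gt w hij, ← symGraph_of_lt w hij, hw' j i hij.le, h.symm n i j]
    · have hind : iIndepFun (fun q : {q : Fin n × Fin n // q.2 ≤ q.1} => ξ n q.1.1 q.1.2) P := by
        have := (h.indep n).precomp (g := fun q : {q : Fin n × Fin n // q.2 ≤ q.1} =>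
          (⟨(q.1.2, q.1.1), q.2⟩ : {q : Fin n × Fin n // q.1 ≤ q.2})) fun q q' hq => by
            simp only [Subtype.mk.injEq, Prod.mk.injEq] at hq
            exact Subtype.ext (Prod.ext hq.2 hq.1)
        convert this using 2 with q
        exact h.symm n _ _
      rw [← measureReal_forall_edgeSign_eq (fun q => h.measurable n _ _) (fun q => h.law n _ _)
        hind c]
      congr 2
      ext ω
      exact funext_iff
  choose σ hσm hσ using key
  refine ⟨σ, hσm, fun n g => ?_, fun a b => ?_⟩
  · rw [hσ n fun _ s => g s, expect_vSign id g]
  · refine Tendsto.congr (fun n : ℕ => (hσ n fun E s =>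
      (√n / (n : ℝ) ^ 2 * blockSum E s a b - _) ^ 2).symm) ?_
    have hc : lowerCoeff (fun u v => -(sgn v * (ind a u * ind b v + ind a v * ind b u)))
        = -(sgn a * sgn b) / 2 := by
      rcases Int.units_eq_one_or a with rfl | rfl <;> rcases Int.units_eq_one_or b with rfl | rfl <;>
        norm_num [lowerCoeff, ind, sgn, show (1 : ℤˣ) ≠ -1 by decide, show (-1 : ℤˣ) ≠ 1 by decide]
    rw [← hc]
    refine tendsto_expect_sq_blockSum (m := id) (G := fun _ _ => 0) (fun _ => le_rfl)
      tendsto_absWalk_div_sqrt (fun n => symGraph) (by simp) fun n w i j hij => ?_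
    rw [symGraph_of_lt w hij, symGraph_of_gt w hij, sgn_mul, sgn_neg]
    ring

/-- A matrix of signs: the entry `w i j` with `j < i` is placed, with the sign `-1`, at `(i, j)` if
the sign of `j` is `1`, and at `(j, i)` otherwise; the remaining places are filled with the entries
above the diagonal. -/
def dirGraph {n : ℕ} (w : Cube n) : Cube n := fun i j =>
  if j < i then (if vSign (· / 2) w j = 1 then -w i j else w j i)
  else if i < j then (if vSign (· / 2) w i = 1 then w i j else w j i) else w i i

lemma dirGraph_of_lt {n : ℕ} (w : Cube n) {i j : Fin n} (h : j < i) :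
    dirGraph w i j = if vSign (· / 2) w j = 1 then -w i j else w j i := if_pos h

lemma dirGraph_of_gt {n : ℕ} (w : Cube n) {i j : Fin n} (h : j < i) :
    dirGraph w j i = if vSign (· / 2) w j = 1 then w j i else w i j := by
  rw [dirGraph, if_neg h.not_gt, if_pos h]

lemma dirGraph_self {n : ℕ} (w : Cube n) (i : Fin n) : dirGraph w i i = w i i := by
  simp [dirGraph]

lemma dirGraph_injective (n : ℕ) : Function.Injective (dirGraph : Cube n → Cube n) := by
  intro w w' h
  have key (i : Fin n) : ∀ j ≤ i, w i j = w' i j ∧ w j i = w' j i := by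
    induction i using WellFoundedLT.induction with
    | ind i ih =>
      intro j hj
      have h1 := congrFun (congrFun h i) j
      have h2 := congrFun (congrFun h j) i
      rcases hj.lt_or_eq with hlt | rfl
      · rw [dirGraph_of_lt w hlt, dirGraph_of_lt w' hlt, vSign_congr
          (fun k => Nat.div_le_self k 2) fun k hk => (ih j hlt k hk).1] at h1
        rw [dirGraph_of_gt w hlt, dirGraph_of_gt w' hlt, vSign_congr
          (fun k => Nat.div_le_self k 2) fun k hk => (ih j hlt k hk).1] at h2
        split_ifs at h1 h2
        · exact ⟨neg_injective h1, h2⟩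
        · exact ⟨h2, h1⟩
      · rw [dirGraph_self, dirGraph_self] at h1
        exact ⟨h1, h1⟩
  funext i j
  rcases le_total j i with hij | hij
  · exact (key i j hij).1
  · exact (key j i hij).2

/-- The walk of half the length, which a majority among the first half of the entries involves. -/
lemma tendsto_absWalk_half_div_sqrt :
    Tendsto (fun i : ℕ => absWalk (i / 2) / √i) atTop (𝓝 (1 / √π)) := by
  have h1 : Tendsto (fun i : ℕ => √(((i / 2 : ℕ) : ℝ) / i)) atTop (𝓝 √(1 / 2)) := by
    refine Tendsto.sqrt ?_
    refine ((tendsto_nat_floor_mul_div_atTop (R := ℝ) (a := 1 / 2) (by norm_num)).comp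
      tendsto_natCast_atTop_atTop).congr fun i => ?_
    simp only [Function.comp]
    rw [← Nat.floor_div_eq_div (K := ℝ) i 2]
    rw [one_div, inv_mul_eq_div, Nat.cast_ofNat]
  have h2 := (tendsto_absWalk_div_sqrt.comp
    (Nat.tendsto_div_const_atTop (n := 2) (by norm_num))).mul h1
  have e : √(2 / π) * √(1 / 2) = 1 / √π := by
    rw [← Real.sqrt_mul (by positivity), ← Real.sqrt_one, ← Real.sqrt_div (by norm_num),
      Real.sqrt_one]
    congr 1
    field_simp
  rw [e] at h2
  refine h2.congr' ?_
  filter_upwards [eventually_ge_atTop 2] with i hi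
  have h3 : (0 : ℝ) < ((i / 2 : ℕ) : ℝ) := by exact_mod_cast Nat.div_pos hi two_pos
  simp only [Function.comp]
  rw [Real.sqrt_div h3.le, div_mul_div_cancel₀ (Real.sqrt_pos.mpr h3).ne']

/-- Only the entry `w i j`, `j < i`, correlates with the signs; it is placed at `(i, j)` or `(j, i)`
according to `σ j`, which gives the coefficient `(b - a - 2 a b) / 8` of `σ i w i j` in the block
`(a, b)`. -/
lemma IsDirectedER.exists_isSignChoice {Ω : Type*} [MeasurableSpace Ω] {P : Measure Ω}
    [IsProbabilityMeasure P] {ξ : (n : ℕ) → Fin n → Fin n → Ω → ℝ}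
    (h : IsDirectedER P (fun _ => 1 / 2) ξ) :
    ∃ σ, IsSignChoice P ξ σ fun a b =>
      (sgn b - sgn a - 2 * (sgn a * sgn b)) / 8 * (2 / 3 * (1 / √π)) := by
  have hm (i : ℕ) : i / 2 ≤ i := Nat.div_le_self i 2
  have key (n : ℕ) : ∃ σ : Fin n → Ω → ℤˣ, (∀ i, Measurable (σ i)) ∧
      ∀ H : Cube n → (Fin n → ℤˣ) → ℝ,
      ∫ ω, H (fun i j => edgeSign (ξ n i j ω)) (fun i => σ i ω) ∂P
        = 𝔼 w, H (dirGraph w) (vSign (· / 2) w) := by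
    have hres {w w' : Cube n} (hw : restrictTo (fun _ => True) w = restrictTo (fun _ => True) w') :
        w = w' := by
      funext i j
      exact congrFun hw ⟨(i, j), trivial⟩
    refine exists_signs (fun _ : Fin n × Fin n => True) dirGraph (vSign (· / 2))
      (fun w w' hw => ?_) (fun w w' hw => ?_) ?_ (fun ω w hw => hres hw) fun c => ?_
    · rw [dirGraph_injective n (hres hw)]
    · rw [hres hw]
      exact ⟨rfl, rfl⟩
    · exact measurable_pi_iff.mpr fun i => measurable_pi_iff.mpr fun j =>
        measurable_edgeSign.comp (h.measurable n i j)
    · rw [← measureReal_forall_edgeSign_eq (fun q => h.measurable n _ _) (fun q => h.law n _ _)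
        ((h.indep n).precomp (Subtype.val_injective (p := fun _ : Fin n × Fin n => True))) c]
      congr 2
      ext ω
      exact funext_iff
  choose σ hσm hσ using key
  refine ⟨σ, hσm, fun n g => ?_, fun a b => ?_⟩
  · rw [hσ n fun _ s => g s, expect_vSign (· / 2) g]
  · refine Tendsto.congr (fun n : ℕ => (hσ n fun E s =>
      (√n / (n : ℝ) ^ 2 * blockSum E s a b - _) ^ 2).symm) ?_
    have hc : lowerCoeff (fun u v => if v = 1 then -(ind a u * ind b v) else ind a v * ind b u)
        = (sgn b - sgn a - 2 * (sgn a * sgn b)) / 8 := by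
      rcases Int.units_eq_one_or a with rfl | rfl <;> rcases Int.units_eq_one_or b with rfl | rfl <;>
        norm_num [lowerCoeff, ind, sgn, show (1 : ℤˣ) ≠ -1 by decide, show (-1 : ℤˣ) ≠ 1 by decide]
    rw [← hc]
    refine tendsto_expect_sq_blockSum (m := (· / 2))
      (G := fun u v => if v = 1 then ind a v * ind b u else ind a u * ind b v) hm
      tendsto_absWalk_half_div_sqrt (fun n => dirGraph) (fun u v => ?_) fun n w i j hij => ?_
    · split_ifs <;> exact abs_ind_mul_ind_le _ _ _ _
    · rw [dirGraph_of_lt w hij, dirGraph_of_gt w hij]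
      split_ifs
      · rw [sgn_neg]
        ring
      · ring

/-! ### The fluctuations as functions of the signs -/

/-- The point with sign `u`: `0` for `1` and `π / 2` for `-1`. -/
def signPoint (u : ℤˣ) : Circ := if u = 1 then 0 else quarter

lemma signPoint_one : signPoint 1 = 0 := if_pos rfl

lemma signPoint_neg_one : signPoint (-1) = quarter := if_neg (by decide)

lemma sum_sign {M : Type*} [AddCommMonoid M] (f : ℤˣ → M) : ∑ u, f u = f 1 + f (-1) := by
  rw [show (Finset.univ : Finset ℤˣ) = {1, -1} from rfl, Finset.sum_pair (by decide)]

lemma sum_ind_mul_ind_smul {V : Type*} [AddCommGroup V] [Module ℝ V] (f : ℤˣ × ℤˣ → V)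
    (u v : ℤˣ) : ∑ p : ℤˣ × ℤˣ, (ind p.1 u * ind p.2 v) • f p = f (u, v) := by
  rw [Fintype.sum_eq_single (u, v) fun p hp => ?_]
  · simp [ind]
  · by_cases h : u = p.1
    · have : v ≠ p.2 := fun h' => hp (Prod.ext h.symm h'.symm)
      simp [ind, this]
    · simp [ind, h]

lemma eq_add_sgn_smul {V : Type*} [AddCommGroup V] [Module ℝ V] (f : ℤˣ → V) (u : ℤˣ) :
    f u = (1 / 2 : ℝ) • (f 1 + f (-1)) + (sgn u / 2) • (f 1 - f (-1)) := by
  rcases Int.units_eq_one_or u with rfl | rfl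
  · rw [sgn_one]; module
  · rw [sgn_neg, sgn_one]; module

lemma sum_eq_add_sgn_smul {V : Type*} [AddCommGroup V] [Module ℝ V] (f : ℤˣ → V) {n : ℕ}
    (s : Fin n → ℤˣ) : ∑ i, f (s i)
      = (n : ℝ) • (1 / 2 : ℝ) • (f 1 + f (-1)) + ((∑ i, sgn (s i)) / 2) • (f 1 - f (-1)) := by
  rw [Finset.sum_congr rfl fun i _ => eq_add_sgn_smul f (s i), Finset.sum_add_distrib,
    Finset.sum_const, Finset.card_univ, Fintype.card_fin, ← Nat.cast_smul_eq_nsmul ℝ,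
    Finset.sum_div, Finset.sum_smul]

lemma HNeg.ofMeasure_eq {X : Type} [MeasurableSpace X] [FlatTorus X] [OrthonormalTorus X] {r : ℝ}
    {μ : Measure X} {h : HNeg X r} (H : ∀ k, ∫ x, FlatTorus.basis k x ∂μ = coeff h k) :
    ofMeasure r μ = h := by
  rw [ofMeasure, funext H, ofCoeffs_coeff]

lemma integral_empMeasure {n : ℕ} (θ : Fin n → Circ) (f : Circ → ℝ) :
    ∫ x, f x ∂(empMeasure θ) = (1 / (n : ℝ)) * ∑ i, f (θ i) := by
  rw [empMeasure, integral_smul_measure, integral_finsetSum_measure fun i _ =>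
    integrable_dirac (by simp)]
  simp [integral_dirac]

lemma integral_halfHalf (f : Circ → ℝ) :
    ∫ x, f x ∂halfHalf = (1 / 2) * (f (signPoint 1) + f (signPoint (-1))) := by
  rw [halfHalf, integral_smul_measure, integral_add_measure (integrable_dirac (by simp))
    (integrable_dirac (by simp)), integral_dirac, integral_dirac, signPoint_one, signPoint_neg_one]
  simp

/-- The normalised sum of the signs, `(2 √n)⁻¹ ∑ᵢ σᵢ`. -/
def normSum {n : ℕ} (s : Fin n → ℤˣ) : ℝ := √n / n * ((∑ i, sgn (s i)) / 2)

lemma fluct_signPoint {r : ℝ} (hr : 1 < r) {n : ℕ} (s : Fin n → ℤˣ) :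
    fluct r halfHalf (fun i => signPoint (s i))
      = normSum s • (dirac r (signPoint 1) - dirac r (signPoint (-1))) := by
  have h1 : ofMeasure r (empMeasure fun i => signPoint (s i))
      = (1 / (n : ℝ)) • ∑ i, dirac r (signPoint (s i)) :=
    ofMeasure_eq fun k => by
      rw [integral_empMeasure, coeff_smul, coeff_sum]
      simp_rw [coeff_dirac hr]
  have h2 : ofMeasure r halfHalf
      = (1 / 2 : ℝ) • (dirac r (signPoint 1) + dirac r (signPoint (-1))) :=
    ofMeasure_eq fun k => by
      rw [integral_halfHalf, coeff_smul, coeff_add, coeff_dirac hr, coeff_dirac hr]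
  rw [fluct, h1, h2, normSum]
  rw [sum_eq_add_sgn_smul fun u => dirac r (signPoint u)]
  rcases Nat.eq_zero_or_pos n with rfl | hn
  · simp
  · have : (n : ℝ) ≠ 0 := by exact_mod_cast hn.ne'
    match_scalars <;> field_simp <;> ring

lemma graphFluct_signPoint (r : ℝ) {n : ℕ} {ξ : Fin n → Fin n → ℝ}
    (hξ : ∀ i j, ξ i j = 0 ∨ ξ i j = 1) (s : Fin n → ℤˣ) :
    graphFluct r (1 / 2) ξ (fun i => signPoint (s i))
      = ∑ p : ℤˣ × ℤˣ, (√n / (n : ℝ) ^ 2 * blockSum (fun i j => edgeSign (ξ i j)) s p.1 p.2) •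
        dirac r (signPoint p.1, signPoint p.2) := by
  rw [graphFluct]
  simp_rw [← sgn_edgeSign (hξ _ _)]
  have h (i j : Fin n) := (sum_ind_mul_ind_smul
    (fun p => dirac r (signPoint p.1, signPoint p.2)) (s i) (s j)).symm
  simp only at h
  simp_rw [h, Finset.smul_sum]
  rw [Finset.sum_congr rfl fun i _ => Finset.sum_comm, Finset.sum_comm]
  refine Finset.sum_congr rfl fun p _ => ?_
  rw [blockSum, Finset.mul_sum, Finset.sum_smul]
  refine Finset.sum_congr rfl fun i _ => ?_
  rw [Finset.mul_sum, Finset.sum_smul]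
  refine Finset.sum_congr rfl fun j _ => ?_
  simp only [smul_smul]
  congr 1
  ring

lemma dBL_signPoint_le {n : ℕ} (hn : 0 < n) (s : Fin n → ℤˣ) :
    dBL (empMeasure fun i => signPoint (s i)) halfHalf ≤ |(∑ i, sgn (s i)) / n| := by
  refine Real.sSup_le ?_ (abs_nonneg _)
  rintro x ⟨f, hf, -, rfl⟩
  have hn' : (n : ℝ) ≠ 0 := by exact_mod_cast hn.ne'
  rw [integral_empMeasure, integral_halfHalf]
  rw [sum_eq_add_sgn_smul fun u => f (signPoint u)]
  simp only [smul_eq_mul]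
  have h1 : |f (signPoint 1) - f (signPoint (-1))| ≤ 2 :=
    (abs_sub _ _).trans (by linarith [hf (signPoint 1), hf (signPoint (-1))])
  calc _ = (∑ i, sgn (s i)) / n * ((f (signPoint 1) - f (signPoint (-1))) / 2) := by
        field_simp
        ring
    _ ≤ |(∑ i, sgn (s i)) / n| * 1 := by
        refine (le_abs_self _).trans ?_
        rw [abs_mul, abs_div _ (2 : ℝ), abs_two]
        exact mul_le_mul_of_nonneg_left (by linarith) (abs_nonneg _)
    _ = _ := mul_one _

lemma dBL_nonneg {n : ℕ} (θ : Fin n → Circ) : 0 ≤ dBL (empMeasure θ) halfHalf := by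
  by_cases h : BddAbove {x : ℝ | ∃ f : Circ → ℝ, (∀ θ, |f θ| ≤ 1) ∧ LipschitzWith 1 f ∧
    x = ∫ θ, f θ ∂(empMeasure θ) - ∫ θ, f θ ∂halfHalf}
  · exact le_csSup h ⟨0, by simp, LipschitzWith.const 0 |>.weaken (by simp), by simp⟩
  · exact (Real.sSup_of_not_bddAbove h).ge

/-! ### Moments of the sum of the signs -/

lemma walkOp_pow_pow_four (n : ℕ) (x : ℤ) :
    (walkOp ^ n) (fun y : ℤ => (y : ℝ) ^ 4) x = x ^ 4 + 6 * n * x ^ 2 + 3 * n ^ 2 - 2 * n := by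
  induction n generalizing x with
  | zero => simp
  | succ n ih =>
    rw [pow_succ', Module.End.mul_apply]
    change ((walkOp ^ n) (fun y : ℤ => (y : ℝ) ^ 4) (x + 1)
      + (walkOp ^ n) (fun y : ℤ => (y : ℝ) ^ 4) (x - 1)) / 2 = _
    rw [ih, ih]
    push_cast
    ring

lemma walkOp_pow_cos (n : ℕ) (t : ℝ) (x : ℤ) :
    (walkOp ^ n) (fun y : ℤ => cos (t * y)) x = cos t ^ n * cos (t * x) := by
  induction n generalizing x with
  | zero => simp
  | succ n ih =>
    rw [pow_succ', Module.End.mul_apply]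
    change ((walkOp ^ n) (fun y : ℤ => cos (t * y)) (x + 1)
      + (walkOp ^ n) (fun y : ℤ => cos (t * y)) (x - 1)) / 2 = _
    rw [ih, ih]
    push_cast
    rw [mul_add, mul_sub, mul_one, cos_add, cos_sub]
    ring

lemma expect_sum_sgn (n : ℕ) (g : ℝ → ℝ) :
    𝔼 s : Fin n → ℤˣ, g (∑ i, sgn (s i)) = (walkOp ^ n) (fun y : ℤ => g y) 0 := by
  have := expect_walk (Finset.univ : Finset (Fin n)) (fun y : ℤ => g y) 0
  rw [Finset.card_univ, Fintype.card_fin] at this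
  rw [← this]
  refine Finset.expect_congr rfl fun s _ => ?_
  rw [zero_add]
  push_cast
  rfl

lemma expect_sum_sgn_pow_four_le (n : ℕ) :
    𝔼 s : Fin n → ℤˣ, (∑ i, sgn (s i)) ^ 4 ≤ 3 * (n : ℝ) ^ 2 := by
  rw [expect_sum_sgn n fun x => x ^ 4, walkOp_pow_pow_four]
  push_cast
  have : (0 : ℝ) ≤ n := by positivity
  nlinarith

lemma expect_cos_sum_sgn (n : ℕ) (t : ℝ) :
    𝔼 s : Fin n → ℤˣ, cos (t * ∑ i, sgn (s i)) = cos t ^ n := by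
  rw [expect_sum_sgn n fun x => cos (t * x), walkOp_pow_cos]
  simp

lemma expect_sin_sum_sgn (n : ℕ) (t : ℝ) :
    𝔼 s : Fin n → ℤˣ, sin (t * ∑ i, sgn (s i)) = 0 := by
  refine expect_eq_zero_of_equiv (Equiv.neg _) fun s => ?_
  simp [sgn_neg, Finset.sum_neg_distrib]

lemma expect_normSum_sq_le (n : ℕ) : 𝔼 s : Fin n → ℤˣ, normSum s ^ 2 ≤ 1 := by
  simp_rw [normSum, mul_pow, div_pow, ← Finset.mul_expect, ← Finset.expect_div]
  rw [expect_sq_sum_sgn, Real.sq_sqrt (by positivity), Finset.card_univ, Fintype.card_fin]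
  rcases Nat.eq_zero_or_pos n with rfl | hn
  · simp
  · have : (n : ℝ) ≠ 0 := by exact_mod_cast hn.ne'
    field_simp
    norm_num

/-! ### Convergence and moments from second moments -/

lemma integrable_comp_of_finite {Ω α : Type*} [MeasurableSpace Ω] {P : Measure Ω}
    [IsProbabilityMeasure P] [Finite α] [MeasurableSpace α] [MeasurableSingletonClass α]
    {ψ : Ω → α} (hψ : Measurable ψ) (F : α → ℝ) : Integrable (fun ω => F (ψ ω)) P := by
  have : IsProbabilityMeasure (P.map ψ) := Measure.isProbabilityMeasure_map hψ.aemeasurable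
  exact (Integrable.of_finite (μ := P.map ψ) (f := F)).comp_measurable hψ

/-- Convergence in probability from convergence in `L²`. -/
lemma tendstoInMeasure_of_norm_sq_le {Ω E : Type*} [MeasurableSpace Ω] {P : Measure Ω}
    [IsProbabilityMeasure P] [NormedAddCommGroup E] {X : ℕ → Ω → E} {c : E} {Z : ℕ → Ω → ℝ}
    (hZ : ∀ n, Integrable (Z n) P) (h : ∀ n ω, ‖X n ω - c‖ ^ 2 ≤ Z n ω)
    (h0 : Tendsto (fun n => ∫ ω, Z n ω ∂P) atTop (𝓝 0)) :
    TendstoInMeasure P X atTop fun _ => c := by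
  rw [tendstoInMeasure_iff_measureReal_norm]
  intro δ hδ
  have h1 : Tendsto (fun n => (∫ ω, Z n ω ∂P) / δ ^ 2) atTop (𝓝 0) := by
    simpa using h0.div_const (δ ^ 2)
  refine squeeze_zero (fun n => measureReal_nonneg) (fun n => ?_) h1
  have h2 := mul_meas_ge_le_integral_of_nonneg
    (Eventually.of_forall fun ω => (sq_nonneg _).trans (h n ω)) (hZ n) (δ ^ 2)
  rw [le_div_iff₀ (by positivity), mul_comm]
  refine le_trans (mul_le_mul_of_nonneg_left (measureReal_mono fun ω hω => ?_) (by positivity)) h2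
  exact le_trans (pow_le_pow_left₀ hδ.le hω 2) (h n ω)

/-- Bounded second moments give bounded moments of order `3 / 2`. -/
lemma iSup_lintegral_rpow_lt_top {Ω E : Type*} [MeasurableSpace Ω] {P : Measure Ω}
    [IsProbabilityMeasure P] [NormedAddCommGroup E] {X : ℕ → Ω → E} {Z : ℕ → Ω → ℝ} {C : ℝ}
    (hZ : ∀ n, Integrable (Z n) P) (h : ∀ n ω, ‖X n ω‖ ^ 2 ≤ Z n ω)
    (hC : ∀ n, ∫ ω, Z n ω ∂P ≤ C) :
    ⨆ n, ∫⁻ ω, ‖X n ω‖ₑ ^ (1 + 1 / 2 : ℝ) ∂P < ⊤ := by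
  refine lt_of_le_of_lt (iSup_le fun n => ?_) (ENNReal.ofReal_lt_top (r := 1 + C))
  have h1 (x : ℝ) (hx : 0 ≤ x) : x ^ (1 + 1 / 2 : ℝ) ≤ 1 + x ^ 2 := by
    rcases le_total x 1 with h | h
    · have := Real.rpow_le_one hx h (show (0 : ℝ) ≤ 1 + 1 / 2 by norm_num)
      nlinarith [sq_nonneg x]
    · have := Real.rpow_le_rpow_of_exponent_le h (show (1 + 1 / 2 : ℝ) ≤ (2 : ℕ) by norm_num)
      rw [Real.rpow_natCast] at this
      linarith
  calc ∫⁻ ω, ‖X n ω‖ₑ ^ (1 + 1 / 2 : ℝ) ∂P ≤ ∫⁻ ω, ENNReal.ofReal (1 + Z n ω) ∂P := by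
        refine lintegral_mono fun ω => ?_
        rw [← ofReal_norm, ENNReal.ofReal_rpow_of_nonneg (norm_nonneg _) (by norm_num)]
        exact ENNReal.ofReal_le_ofReal ((h1 _ (norm_nonneg _)).trans (by linarith [h n ω]))
    _ = ENNReal.ofReal (∫ ω, (1 + Z n ω) ∂P) :=
        (ofReal_integral_eq_lintegral_ofReal ((integrable_const 1).add (hZ n))
          (Eventually.of_forall fun ω => add_nonneg zero_le_one ((sq_nonneg _).trans (h n ω)))).symm
    _ ≤ ENNReal.ofReal (1 + C) := by
        rw [integral_add (integrable_const 1) (hZ n), integral_const]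
        refine ENNReal.ofReal_le_ofReal ?_
        simpa using hC n

lemma norm_sum_smul_sq_le {ι E : Type*} [Fintype ι] [NormedAddCommGroup E] [NormedSpace ℝ E]
    (c : ι → ℝ) (v : ι → E) : ‖∑ p, c p • v p‖ ^ 2 ≤ (∑ p, c p ^ 2) * ∑ p, ‖v p‖ ^ 2 := by
  have h1 : ‖∑ p, c p • v p‖ ≤ ∑ p, |c p| * ‖v p‖ :=
    (norm_sum_le _ _).trans (le_of_eq (Finset.sum_congr rfl fun p _ => by
      rw [norm_smul, Real.norm_eq_abs]))
  refine (pow_le_pow_left₀ (norm_nonneg _) h1 2).trans ?_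
  refine (Finset.sum_mul_sq_le_sq_mul_sq _ _ _).trans (le_of_eq ?_)
  simp_rw [sq_abs]

section RandomCombination

variable {Ω ι E : Type*} [MeasurableSpace Ω] {P : Measure Ω} [IsProbabilityMeasure P] [Fintype ι]
  [NormedAddCommGroup E] [NormedSpace ℝ E] {c : ℕ → ι → Ω → ℝ} {d : ι → ℝ}

lemma tendstoInMeasure_sum_smul (hc : ∀ n p, Integrable (fun ω => (c n p ω - d p) ^ 2) P)
    (h : ∀ p, Tendsto (fun n => ∫ ω, (c n p ω - d p) ^ 2 ∂P) atTop (𝓝 0)) (v : ι → E) :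
    TendstoInMeasure P (fun n ω => ∑ p, c n p ω • v p) atTop fun _ => ∑ p, d p • v p := by
  refine tendstoInMeasure_of_norm_sq_le
    (Z := fun n ω => (∑ p, (c n p ω - d p) ^ 2) * ∑ p, ‖v p‖ ^ 2)
    (fun n => (integrable_finsetSum _ fun p _ => hc n p).mul_const _) (fun n ω => ?_) ?_
  · rw [← Finset.sum_sub_distrib]
    simp_rw [← sub_smul]
    exact norm_sum_smul_sq_le _ _
  · simp_rw [integral_mul_const, integral_finsetSum _ fun p _ => hc _ p]
    simpa using (tendsto_finsetSum Finset.univ fun p _ => h p).mul_const (∑ p, ‖v p‖ ^ 2)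

lemma iSup_lintegral_sum_smul_lt_top (hc : ∀ n p, Integrable (fun ω => (c n p ω - d p) ^ 2) P)
    (h : ∀ p, Tendsto (fun n => ∫ ω, (c n p ω - d p) ^ 2 ∂P) atTop (𝓝 0)) (v : ι → E) :
    ⨆ n, ∫⁻ ω, ‖∑ p, c n p ω • v p‖ₑ ^ (1 + 1 / 2 : ℝ) ∂P < ⊤ := by
  obtain ⟨B, hB⟩ := (tendsto_finsetSum Finset.univ fun p _ => h p).bddAbove_range
  have hM : 0 ≤ ∑ p, ‖v p‖ ^ 2 := Finset.sum_nonneg fun p _ => sq_nonneg _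
  refine iSup_lintegral_rpow_lt_top (C := (2 * B + ∑ p, 2 * d p ^ 2) * ∑ p, ‖v p‖ ^ 2)
    (Z := fun n ω => (2 * ∑ p, (c n p ω - d p) ^ 2 + ∑ p, 2 * d p ^ 2) * ∑ p, ‖v p‖ ^ 2)
    (fun n => (((integrable_finsetSum _ fun p _ => hc n p).const_mul 2).add
      (integrable_const _)).mul_const _) (fun n ω => ?_) fun n => ?_
  · refine (norm_sum_smul_sq_le _ _).trans (mul_le_mul_of_nonneg_right ?_ hM)
    rw [Finset.mul_sum, ← Finset.sum_add_distrib]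
    exact Finset.sum_le_sum fun p _ => by nlinarith [sq_nonneg (c n p ω - 2 * d p)]
  · rw [integral_mul_const, integral_add (((integrable_finsetSum _ fun p _ => hc n p).const_mul 2))
      (integrable_const _), integral_const_mul, integral_finsetSum _ fun p _ => hc n p,
      integral_const, probReal_univ, one_smul]
    have : ∑ p, ∫ ω, (c n p ω - d p) ^ 2 ∂P ≤ B := hB ⟨n, rfl⟩
    exact mul_le_mul_of_nonneg_right (by linarith) hM

end RandomCombination

/-! ### The central limit theorem for the signs -/

lemma tendsto_cos_pow (t : ℝ) :
    Tendsto (fun n : ℕ => cos (√n / n / 2 * t) ^ n) atTop (𝓝 (exp (-(t ^ 2 / 8)))) := by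
  have hsq (n : ℕ) (hn : 0 < n) : (n : ℝ) * (√n / n / 2 * t) ^ 2 = t ^ 2 / 4 := by
    have hn' : (0 : ℝ) < n := by exact_mod_cast hn
    rw [mul_pow, div_pow, div_pow, Real.sq_sqrt hn'.le]
    field_simp
    ring
  have hx : Tendsto (fun n : ℕ => (√n / n / 2 * t) ^ 2) atTop (𝓝 0) := by
    have h1 : Tendsto (fun n : ℕ => t ^ 2 / 4 * (1 / (n : ℝ))) atTop (𝓝 0) := by
      simpa using (tendsto_one_div_atTop_nhds_zero_nat (𝕜 := ℝ)).const_mul (t ^ 2 / 4)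
    refine h1.congr' ?_
    filter_upwards [eventually_gt_atTop 0] with n hn
    rw [← hsq n hn]
    have hn' : (n : ℝ) ≠ 0 := by exact_mod_cast hn.ne'
    field_simp
  have key : Tendsto (fun n : ℕ => (n : ℝ) * (cos (√n / n / 2 * t) - 1)) atTop
      (𝓝 (-(t ^ 2 / 8))) := by
    rw [tendsto_iff_dist_tendsto_zero]
    have h1 : Tendsto (fun n : ℕ => t ^ 2 / 4 * (5 / 96) * (√n / n / 2 * t) ^ 2) atTop (𝓝 0) := by
      simpa using hx.const_mul (t ^ 2 / 4 * (5 / 96))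
    refine squeeze_zero' (Eventually.of_forall fun _ => dist_nonneg) ?_ h1
    filter_upwards [eventually_gt_atTop 0, hx.eventually_le_const one_pos] with n hn hx1
    -- `cos x = 1 - x² / 2 + O(x⁴)`, with `n x² = t² / 4`.
    have hb := Real.cos_bound ((sq_le_one_iff_abs_le_one _).mp hx1)
    have hs := hsq n hn
    set x := √n / n / 2 * t
    rw [Real.dist_eq, show (n : ℝ) * (cos x - 1) - -(t ^ 2 / 8)
      = n * (cos x - (1 - x ^ 2 / 2)) by linear_combination (-1 / 2) * hs,
      abs_mul, Nat.abs_cast]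
    refine (mul_le_mul_of_nonneg_left hb (by positivity)).trans (le_of_eq ?_)
    rw [show |x| ^ 4 = (x ^ 2) ^ 2 by rw [← sq_abs x]; ring, ← hs]
    ring
  refine (Real.tendsto_one_add_pow_exp_of_tendsto key).congr fun n => ?_
  rw [add_sub_cancel]

lemma covZ_posSemidef : covZ.PosSemidef := by
  have : covZ = (!![1 / 2, -1 / 2; 0, 0] : Matrix (Fin 2) (Fin 2) ℝ).conjTranspose
      * !![1 / 2, -1 / 2; 0, 0] := by
    ext i j
    fin_cases i <;> fin_cases j <;> norm_num [covZ, Matrix.mul_apply, Fin.sum_univ_two]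
  rw [this]
  exact Matrix.posSemidef_conjTranspose_mul_self _

lemma charFun_lawZ (t : EuclideanSpace ℝ (Fin 2)) :
    charFun lawZ t = ((exp (-((t 0 - t 1) ^ 2 / 8)) : ℝ) : ℂ) := by
  rw [lawZ, charFun_multivariateGaussian covZ_posSemidef, inner_zero_right]
  push_cast
  congr 1
  simp [covZ, Matrix.mulVec, dotProduct, Fin.sum_univ_two]
  ring

namespace IsSignChoice

variable {Ω : Type*} [MeasurableSpace Ω] {P : Measure Ω}
  {ξ : (n : ℕ) → Fin n → Fin n → Ω → ℝ} {σ : (n : ℕ) → Fin n → Ω → ℤˣ} {d : ℤˣ → ℤˣ → ℝ}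

lemma measurable_signs (h : IsSignChoice P ξ σ d) (n : ℕ) :
    Measurable fun ω => fun i => σ n i ω :=
  measurable_pi_iff.mpr (h.measurable n)

variable [IsProbabilityMeasure P]

/-- The law of large numbers, from the fourth moment of the sum of the signs. -/
lemma ae_tendsto_dBL (h : IsSignChoice P ξ σ d) :
    ∀ᵐ ω ∂P, Tendsto (fun n => dBL (empMeasure fun i => signPoint (σ n i ω)) halfHalf)
      atTop (𝓝 0) := by
  -- The expectations of the fourth powers are summable.
  set Y : ℕ → Ω → ℝ := fun n ω => ((∑ i, sgn (σ n i ω)) / n) ^ 4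
  have hY (n : ℕ) : Integrable (Y n) P :=
    integrable_comp_of_finite (h.measurable_signs n) fun s => ((∑ i, sgn (s i)) / n) ^ 4
  have hY0 (n : ℕ) (ω : Ω) : 0 ≤ Y n ω := by positivity
  have hle (n : ℕ) : ∫ ω, Y n ω ∂P ≤ 3 * (1 / (n : ℝ) ^ 2) := by
    have h1 : ∫ ω, Y n ω ∂P = (𝔼 s : Fin n → ℤˣ, (∑ i, sgn (s i)) ^ 4) / (n : ℝ) ^ 4 := by
      rw [Finset.expect_div, ← h.law n fun s => (∑ i, sgn (s i)) ^ 4 / (n : ℝ) ^ 4]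
      simp only [Y, div_pow]
    rw [h1]
    refine (div_le_div_of_nonneg_right (expect_sum_sgn_pow_four_le n) (by positivity)).trans
      (le_of_eq ?_)
    rcases Nat.eq_zero_or_pos n with rfl | hn
    · simp
    · have : (n : ℝ) ≠ 0 := by exact_mod_cast hn.ne'
      field_simp
  have hfin : ∫⁻ ω, ∑' n, ENNReal.ofReal (Y n ω) ∂P ≠ ⊤ := by
    rw [lintegral_tsum fun n => (hY n).aestronglyMeasurable.aemeasurable.ennreal_ofReal]
    simp_rw [← fun n => ofReal_integral_eq_lintegral_ofReal (hY n)
      (Eventually.of_forall (hY0 n))]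
    have hs : Summable fun n : ℕ => ∫ ω, Y n ω ∂P :=
      Summable.of_nonneg_of_le (fun n => integral_nonneg (hY0 n)) hle
        ((Real.summable_one_div_nat_pow.mpr one_lt_two).mul_left 3)
    exact hs.tsum_ofReal_ne_top
  have hae := ae_lt_top' (AEMeasurable.tsum fun n =>
    (hY n).aestronglyMeasurable.aemeasurable.ennreal_ofReal) hfin
  filter_upwards [hae] with ω hω
  have h1 := ENNReal.tendsto_atTop_zero_of_tsum_ne_top hω.ne
  have h2 : Tendsto (fun n => Y n ω) atTop (𝓝 0) := by
    have := (ENNReal.tendsto_toReal ENNReal.zero_ne_top).comp h1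
    simpa [Function.comp_def, ENNReal.toReal_ofReal (hY0 _ ω)] using this
  have h3 : Tendsto (fun n : ℕ => |(∑ i, sgn (σ n i ω)) / n|) atTop (𝓝 0) := by
    have := h2.sqrt.sqrt
    simp only [Real.sqrt_zero] at this
    refine this.congr fun n => ?_
    rw [show Y n ω = (((∑ i, sgn (σ n i ω)) / n) ^ 2) ^ 2 by simp only [Y]; ring,
      Real.sqrt_sq (sq_nonneg _), Real.sqrt_sq_eq_abs]
  refine squeeze_zero' (Eventually.of_forall fun n => dBL_nonneg _) ?_ h3
  filter_upwards [eventually_gt_atTop 0] with n hn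
  exact dBL_signPoint_le hn _

lemma charFun_map_normSum (h : IsSignChoice P ξ σ d) (n : ℕ) (t : EuclideanSpace ℝ (Fin 2)) :
    charFun (P.map fun ω => normSum (fun i => σ n i ω) • (!₂[1, -1] : EuclideanSpace ℝ (Fin 2))) t
      = ((cos (√n / n / 2 * (t 0 - t 1)) ^ n : ℝ) : ℂ) := by
  have hm := h.measurable_signs n
  rw [charFun_apply, integral_map]
  · have h1 (ω : Ω) : Complex.exp ((inner ℝ
        (normSum (fun i => σ n i ω) • (!₂[1, -1] : EuclideanSpace ℝ (Fin 2))) t : ℝ) * Complex.I)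
        = ((cos (√n / n / 2 * (t 0 - t 1) * ∑ i, sgn (σ n i ω)) : ℝ) : ℂ)
          + ((sin (√n / n / 2 * (t 0 - t 1) * ∑ i, sgn (σ n i ω)) : ℝ) : ℂ) * Complex.I := by
      rw [Complex.ofReal_cos, Complex.ofReal_sin, ← Complex.exp_mul_I]
      congr 3
      rw [inner_smul_left, PiLp.inner_apply, Fin.sum_univ_two]
      simp [normSum]
      ring
    simp_rw [h1]
    rw [integral_add, integral_mul_const, integral_complex_ofReal, integral_complex_ofReal]
    · rw [h.law n fun s => cos (√n / n / 2 * (t 0 - t 1) * ∑ i, sgn (s i)),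
        h.law n fun s => sin (√n / n / 2 * (t 0 - t 1) * ∑ i, sgn (s i)),
        expect_cos_sum_sgn, expect_sin_sum_sgn]
      simp
    · exact (integrable_comp_of_finite hm fun s =>
        cos (√n / n / 2 * (t 0 - t 1) * ∑ i, sgn (s i))).ofReal
    · exact (integrable_comp_of_finite hm fun s =>
        sin (√n / n / 2 * (t 0 - t 1) * ∑ i, sgn (s i))).ofReal.mul_const _
  · exact ((measurable_of_countable fun s : Fin n → ℤˣ => normSum s •
      (!₂[1, -1] : EuclideanSpace ℝ (Fin 2))).comp hm).aemeasurable
  · fun_prop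

/-- The central limit theorem for the vector `(Z₁, Z₂)` of the masses at `0` and `π / 2`. -/
lemma tendstoInDistribution_normSum (h : IsSignChoice P ξ σ d) :
    TendstoInDistribution (fun n ω => normSum (fun i => σ n i ω) •
      (!₂[1, -1] : EuclideanSpace ℝ (Fin 2))) atTop id (fun _ => P) lawZ where
  forall_aemeasurable n := ((measurable_of_countable fun s : Fin n → ℤˣ => normSum s •
      (!₂[1, -1] : EuclideanSpace ℝ (Fin 2))).comp (h.measurable_signs n)).aemeasurable
  tendsto := by
    refine ProbabilityMeasure.tendsto_iff_tendsto_charFun.mpr fun t => ?_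
    simp only [ProbabilityMeasure.coe_mk, Measure.map_id, charFun_lawZ, h.charFun_map_normSum]
    exact (Complex.continuous_ofReal.tendsto _).comp (tendsto_cos_pow _)

end IsSignChoice

/-! ### Non-universality for graphs with a choice of signs -/

lemma kuramoto_signPoint (K : ℝ) (u v : ℤˣ) :
    kuramoto K (signPoint u) (signPoint v) = K * ((sgn u - sgn v) / 2) := by
  have h0 : Real.Angle.sin (0 : Circ) = 0 := Real.Angle.sin_zero
  have h1 : Real.Angle.sin quarter = 1 :=
    (Real.Angle.sin_coe (π / 2)).trans Real.sin_pi_div_two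
  have h2 : Real.Angle.sin (-quarter) = -1 :=
    (Real.Angle.sin_neg _).trans (congrArg Neg.neg h1)
  rw [kuramoto]
  rcases Int.units_eq_one_or u with rfl | rfl <;> rcases Int.units_eq_one_or v with rfl | rfl <;>
    simp only [signPoint_one, signPoint_neg_one, sgn_neg, sgn_one, sub_self, zero_sub, sub_zero,
      h0, h1, h2] <;> ring

lemma trig_neg_one_quarter : trig (-1) quarter = √2 := by
  have h1 : Real.Angle.sin quarter = 1 :=
    (Real.Angle.sin_coe (π / 2)).trans Real.sin_pi_div_two
  rw [trig, if_neg (by decide), if_neg (by decide), neg_neg, one_smul]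
  exact (congrArg (√2 * ·) h1).trans (mul_one _)

lemma trig_neg_one_zero : trig (-1) 0 = 0 := by
  rw [trig, if_neg (by decide), if_neg (by decide), smul_zero]
  exact (congrArg (√2 * ·) Real.Angle.sin_zero).trans (mul_zero _)

/-- The distribution `z 0 • δ_0 + z 1 • δ_{π/2}`. -/
def diracPair (r : ℝ) (z : EuclideanSpace ℝ (Fin 2)) : HNeg Circ r :=
  z 0 • dirac r (0 : Circ) + z 1 • dirac r quarter

lemma continuous_diracPair (r : ℝ) : Continuous (diracPair r) := by
  unfold diracPair
  fun_prop

/-- The sum of `d (u, v)` times the Dirac mass at the point of signs `(u, v)`. -/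
def blockDirac (d : ℤˣ → ℤˣ → ℝ) (r : ℝ) : HNeg (Circ × Circ) r :=
  ∑ p : ℤˣ × ℤˣ, d p.1 p.2 • dirac r (signPoint p.1, signPoint p.2)

lemma blockDirac_eq (d : ℤˣ → ℤˣ → ℝ) (r : ℝ) :
    blockDirac d r = d 1 1 • dirac r (0, 0) + d 1 (-1) • dirac r (0, quarter)
      + (d (-1) 1 • dirac r (quarter, 0) + d (-1) (-1) • dirac r (quarter, quarter)) := by
  rw [blockDirac, Fintype.sum_prod_type, sum_sign]
  simp_rw [sum_sign, signPoint_one, signPoint_neg_one]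

lemma convSnd_blockDirac (d : ℤˣ → ℤˣ → ℝ) {r : ℝ} (hr : 1 < r) (K : ℝ) :
    convSnd (kuramoto K) (blockDirac d r)
      = (K * d 1 (-1)) • dirac r (0 : Circ) - (K * d (-1) 1) • dirac r quarter := by
  rw [blockDirac, convSnd_sum_dirac hr, Fintype.sum_prod_type, sum_sign]
  simp_rw [sum_sign, kuramoto_signPoint, signPoint_one, signPoint_neg_one, sgn_neg, sgn_one]
  module

/-- The part at `π / 2` is detected by the sine, which vanishes at `0`. -/
lemma sub_dirac_quarter_ne_zero {r : ℝ} (hr : 1 < r) (a : ℝ) {b : ℝ} (hb : b ≠ 0) :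
    a • dirac r (0 : Circ) - b • dirac r quarter ≠ 0 := by
  intro h
  have h1 := congrArg (fun x => coeff x (-1 : ℤ)) h
  simp only [coeff_sub, coeff_smul] at h1
  rw [coeff_dirac hr, coeff_dirac hr, coeff_zero] at h1
  change a * trig (-1) 0 - b * trig (-1) quarter = 0 at h1
  rw [trig_neg_one_zero, trig_neg_one_quarter] at h1
  have : √(2 : ℝ) ≠ 0 := by positivity
  simp [this, hb] at h1

lemma pair_blockDirac_opTheta_ne_zero {d : ℤˣ → ℤˣ → ℝ} (hd : d (-1) 1 ≠ 0) {r : ℝ} (hr : 1 < r)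
    {K : ℝ} (hK : K ≠ 0) : pair (blockDirac d r) (opTheta (kuramoto K) (trig 1)) ≠ 0 := by
  have h1 (u v : ℤˣ) : pair (dirac r (signPoint u, signPoint v)) (opTheta (kuramoto K) (trig 1))
      = -(K * ((sgn u - sgn v) / 2) * trig (-1) (signPoint u)) := by
    rw [pair_dirac hr _ (opTheta_trig_one_mem K), opTheta, dC_trig]
    simp only [kuramoto_signPoint]
    push_cast
    ring
  rw [blockDirac, pair_sum_smul_left _ _ _ (opTheta_trig_one_mem K), Fintype.sum_prod_type,
    sum_sign]
  simp_rw [sum_sign, h1, signPoint_one, signPoint_neg_one, trig_neg_one_zero, trig_neg_one_quarter,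
    sgn_neg, sgn_one]
  have : √(2 : ℝ) ≠ 0 := by positivity
  ring_nf
  positivity

namespace IsSignChoice

variable {Ω : Type u} [MeasurableSpace Ω] {P : Measure Ω} [IsProbabilityMeasure P]
  {ξ : (n : ℕ) → Fin n → Fin n → Ω → ℝ} {σ : (n : ℕ) → Fin n → Ω → ℤˣ} {d : ℤˣ → ℤˣ → ℝ}

/-- The measure fluctuations are driven by the sum of the signs, which obeys a central limit theorem,
while the graph fluctuations converge in `L²` to the constants `d`; the limit is not universal as
soon as the block `(π / 2, 0)`, on which the kernel does not vanish, has a nonzero limit. -/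
theorem nonUniversalExample (h : IsSignChoice P ξ σ d) (hm : ∀ n i j, Measurable (ξ n i j))
    (hξ : ∀ n i j ω, ξ n i j ω = 0 ∨ ξ n i j ω = 1) {K : ℝ} (hK : 0 < K) (hd : d (-1) 1 ≠ 0) :
    NonUniversalExample.{u, v, w} P (fun _ => 1 / 2) ξ K (fun n i ω => signPoint (σ n i ω))
      (blockDirac d)
      (fun r => (K * d 1 (-1)) • dirac r (0 : Circ) - (K * d (-1) 1) • dirac r quarter) := by
  set ψ : (n : ℕ) → Ω → Cube n × (Fin n → ℤˣ) := fun n ω =>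
    (fun i j => edgeSign (ξ n i j ω), fun i => σ n i ω) with hψ
  have hψm (n : ℕ) : Measurable (ψ n) :=
    (measurable_pi_iff.mpr fun i => measurable_pi_iff.mpr fun j =>
      measurable_edgeSign.comp (hm n i j)).prodMk (h.measurable_signs n)
  set c : ℕ → ℤˣ × ℤˣ → Ω → ℝ := fun n p ω =>
    √n / (n : ℝ) ^ 2 * blockSum (ψ n ω).1 (ψ n ω).2 p.1 p.2 with hc
  have hcm (n : ℕ) (p : ℤˣ × ℤˣ) : Measurable (c n p) :=
    (measurable_of_countable fun y : Cube n × (Fin n → ℤˣ) =>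
      √n / (n : ℝ) ^ 2 * blockSum y.1 y.2 p.1 p.2).comp (hψm n)
  have hci (n : ℕ) (p : ℤˣ × ℤˣ) : Integrable (fun ω => (c n p ω - d p.1 p.2) ^ 2) P :=
    integrable_comp_of_finite (hψm n) fun y =>
      (√n / (n : ℝ) ^ 2 * blockSum y.1 y.2 p.1 p.2 - d p.1 p.2) ^ 2
  have hclim (p : ℤˣ × ℤˣ) :
      Tendsto (fun n => ∫ ω, (c n p ω - d p.1 p.2) ^ 2 ∂P) atTop (𝓝 0) := h.block p.1 p.2
  have hgraph (r : ℝ) (n : ℕ) (ω : Ω) :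
      graphFluct r (1 / 2) (fun i j => ξ n i j ω) (fun i => signPoint (σ n i ω))
        = ∑ p : ℤˣ × ℤˣ, c n p ω • dirac r (signPoint p.1, signPoint p.2) :=
    graphFluct_signPoint r (fun i j => hξ n i j ω) _
  have hfluct {r : ℝ} (hr : 1 < r) (n : ℕ) (ω : Ω) :
      fluct r halfHalf (fun i => signPoint (σ n i ω)) = diracPair r
        (normSum (fun i => σ n i ω) • (!₂[1, -1] : EuclideanSpace ℝ (Fin 2))) := by
    rw [fluct_signPoint hr, signPoint_one, signPoint_neg_one, diracPair]
    simp [sub_eq_add_neg]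
  refine ⟨fun n i => (measurable_of_countable signPoint).comp (h.measurable n i),
    fun n i ω => ?_, h.ae_tendsto_dBL, fun r₀ hr₀ => ⟨⟨1 / 2, by norm_num, by norm_num, ?_, ?_⟩, ?_⟩,
    fun r₀ hr₀ => ?_, fun r₀ hr₀ => convSnd_blockDirac d (by linarith) K,
    fun r₀ hr₀ => sub_dirac_quarter_ne_zero (by linarith) _ (mul_ne_zero hK.ne' hd),
    fun r₀ hr₀ T hT μ hμ Ω₁ _ P₁ _ η ηhat W h₁ Ω₂ _ P₂ _ η' W' h₂ => ?_⟩
  · rcases Int.units_eq_one_or (σ n i ω) with hs | hs <;> rw [hs]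
    · exact Or.inl signPoint_one
    · exact Or.inr signPoint_neg_one
  · set b := ‖dirac r₀ (signPoint 1) - dirac r₀ (signPoint (-1))‖ ^ 2
    refine iSup_lintegral_rpow_lt_top (Z := fun n ω => normSum (fun i => σ n i ω) ^ 2 * b) (C := b)
      (fun n => integrable_comp_of_finite (h.measurable_signs n) fun s => normSum s ^ 2 * b)
      (fun n ω => ?_) fun n => ?_
    · rw [fluct_signPoint (by linarith), norm_smul, mul_pow, Real.norm_eq_abs, sq_abs]
    · rw [integral_mul_const, h.law n fun s => normSum s ^ 2]
      exact mul_le_of_le_one_left (sq_nonneg _) (expect_normSum_sq_le n)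
  · simp only [hgraph]
    exact iSup_lintegral_sum_smul_lt_top hci hclim _
  · refine TendstoInDistribution.prodMk_of_tendstoInMeasure_const _ _ (diracPair (r₀ + 2)) ?_ ?_
      fun n => ?_
    · simp_rw [hfluct (show 1 < r₀ + 2 by linarith)]
      exact h.tendstoInDistribution_normSum.continuous_comp (continuous_diracPair _)
    · simp only [hgraph]
      exact tendstoInMeasure_sum_smul hci hclim _
    · simp only [hgraph]
      exact (Finset.measurable_sum _ fun p _ => (hcm n p).smul_const _).aemeasurable
  · have hr : 1 < r₀ + 2 := by linarith
    simp only [hgraph, ← convSnd_blockDirac d hr]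
    rw [blockDirac]
    simp only [convSnd_sum_dirac hr, mul_smul]
    refine TendstoInMeasure.tendstoInDistribution (tendstoInMeasure_sum_smul hci hclim _) fun n => ?_
    exact (Finset.measurable_sum _ fun p _ => (hcm n p).smul_const _).aemeasurable
  · have hlim : Measurable (limitPair (r₀ + 4) (blockDirac d (r₀ + 4))) :=
      (continuous_diracPair _).measurable.prodMk measurable_const
    have hν : ∀ᵐ y ∂(lawZ.map (limitPair (r₀ + 4) (blockDirac d (r₀ + 4)))),
        y.2 = blockDirac d (r₀ + 4) :=
      (ae_map_iff hlim.aemeasurable (measurable_snd (measurableSet_singleton _))).mpr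
        (Eventually.of_forall fun z => rfl)
    exact h₁.map_ne_of_isMeanFieldSPDE hK.le (by linarith) hT hμ.continuousOn hν
      (pair_blockDirac_opTheta_ne_zero hd (by linarith) hK.ne') h₂

end IsSignChoice

end KuramotoFluct

end

theorem mainTheorem6 {Ω : Type u} [MeasurableSpace Ω] (P : MeasureTheory.Measure Ω)
    [MeasureTheory.IsProbabilityMeasure P] (ξ : (n : ℕ) → Fin n → Fin n → Ω → ℝ)
    (K : ℝ) (hK : 0 < K) :
    (KuramotoFluct.IsDirectedER P (fun _ => 1 / 2) ξ →
      ∃ θ : (n : ℕ) → Fin n → Ω → KuramotoFluct.Circ,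
        KuramotoFluct.NonUniversalExample.{u, v, w} P (fun _ => 1 / 2) ξ K θ
          (fun r => (1 / (6 * √π)) •
            (-KuramotoFluct.HNeg.dirac r ((0 : KuramotoFluct.Circ), (0 : KuramotoFluct.Circ))
              + (2 : ℝ) • KuramotoFluct.HNeg.dirac r (KuramotoFluct.quarter, 0)
              - KuramotoFluct.HNeg.dirac r (KuramotoFluct.quarter, KuramotoFluct.quarter)))
          (fun r => (-(K / (3 * √π))) • KuramotoFluct.HNeg.dirac r KuramotoFluct.quarter)) ∧
    (KuramotoFluct.IsSymmetricER P (fun _ => 1 / 2) ξ →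
      ∃ θ : (n : ℕ) → Fin n → Ω → KuramotoFluct.Circ,
        KuramotoFluct.NonUniversalExample.{u, v, w} P (fun _ => 1 / 2) ξ K θ
          (fun r => (2 / (3 * √(2 * π))) •
            (-KuramotoFluct.HNeg.dirac r ((0 : KuramotoFluct.Circ), (0 : KuramotoFluct.Circ))
              + KuramotoFluct.HNeg.dirac r ((0 : KuramotoFluct.Circ), KuramotoFluct.quarter)
              + KuramotoFluct.HNeg.dirac r (KuramotoFluct.quarter, (0 : KuramotoFluct.Circ))
              - KuramotoFluct.HNeg.dirac r (KuramotoFluct.quarter, KuramotoFluct.quarter)))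
          (fun r => (2 * K / (3 * √(2 * π))) •
            (KuramotoFluct.HNeg.dirac r (0 : KuramotoFluct.Circ)
              - KuramotoFluct.HNeg.dirac r KuramotoFluct.quarter))) := by
  have hπ : √π ≠ 0 := (Real.sqrt_pos.mpr Real.pi_pos).ne'
  constructor
  · intro h
    obtain ⟨σ, hσ⟩ := h.exists_isSignChoice
    have key := hσ.nonUniversalExample.{u, v, w} h.measurable h.values hK (by
      simp only [KuramotoFluct.sgn_neg, KuramotoFluct.sgn_one]
      positivity)
    refine ⟨fun n i ω => KuramotoFluct.signPoint (σ n i ω), ?_⟩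
    convert key using 2 with r r
    · rw [KuramotoFluct.blockDirac_eq]
      simp only [KuramotoFluct.sgn_neg, KuramotoFluct.sgn_one]
      match_scalars <;> field_simp <;> norm_num
    · simp only [KuramotoFluct.sgn_neg, KuramotoFluct.sgn_one]
      match_scalars <;> field_simp <;> norm_num
  · intro h
    obtain ⟨σ, hσ⟩ := h.exists_isSignChoice
    have h2 : √(2 / π) = 2 / √(2 * π) := by
      rw [Real.sqrt_div (by norm_num), Real.sqrt_mul (by norm_num)]
      have : √(2 : ℝ) ≠ 0 := by positivity
      field_simp
      norm_num
    have h3 : √(2 * π) ≠ 0 := by positivity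
    have key := hσ.nonUniversalExample.{u, v, w} h.measurable h.values hK (by
      rw [h2]
      simp only [KuramotoFluct.sgn_neg, KuramotoFluct.sgn_one]
      positivity)
    refine ⟨fun n i ω => KuramotoFluct.signPoint (σ n i ω), ?_⟩
    convert key using 2 with r r
    · rw [KuramotoFluct.blockDirac_eq, h2]
      simp only [KuramotoFluct.sgn_neg, KuramotoFluct.sgn_one]
      match_scalars <;> field_simp
    · rw [h2]
      simp only [KuramotoFluct.sgn_neg, KuramotoFluct.sgn_one]
      match_scalars <;> field_simp
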